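/- **Setting.** Let $n\in\mathbb N$, $d\ge 2$, $s\in\mathbb N$, $\delta>0$, $\Delta,\bar\Delta\ge 0$, $M,R,\sigma>0$, $\kappa_1>\kappa_0>0$, $l>1$. Write $\mathcal Q_\Delta(a)=\Delta(\lfloor a/\Delta\rfloor+\frac12)$ for $\Delta>0$ and $\mathcal Q_0(a)=a$ (applied entrywise to vectors); $\mathscr U([-\frac{\Delta}{2},\frac{\Delta}{2}])$ is the uniform law (the point mass at $0$ if $\Delta=0$); $\|X\|_{\psi_2}=\inf\{t>0:\mathbb E\exp(X^2/t^2)\le 2\}$, and $\|x\|_{\psi_2}=\sup_{\|v\|_2=1}\|v^\top x\|_{\psi_2}$ for a random vector $x$. Let $y_k=x_k^\top\theta^\star+\epsilon_k$, $k=1,\dots,n$, where the $x_k\in\mathbb R^d$ are i.i.d., zero-mean, with $\|x_k\|_{\psi_2}\le\sigma$ and $\kappa_0\le\lambda_{\min}(\Sigma^\star)\le\lambda_{\max}(\Sigma^\star)\le\kappa_1$ for $\Sigma^\star=\mathbb E(x_kx_k^\top)$; the $\epsilon_k$ are i.i.d. and independent of the $x_k$; $\mathbb E|y_k|^{2l}\le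 M$; and $\theta^\star\in\mathbb R^d$ has at most $s$ nonzero entries and $\|\theta^\star\|_2\le R$. The responses are truncated to $\widetilde y_k=\mathrm{sign}(y_k)\min\{|y_k|,\zeta_y\}$ and quantized to $\dot y_k=\mathcal Q_\Delta(\widetilde y_k+\phi_k)$ with uniform dither $\phi_k\sim\mathscr U([-\frac{\Delta}{2},\frac{\Delta}{2}])$. The covariates are quantized to $\dot x_k=\mathcal Q_{\bar\Delta}(x_k+\tau_k)$ with triangular dither, i.e. $\tau_k$ is distributed as the sum of two independent uniform vectors on $[-\frac{\bar\Delta}{2},\frac{\bar\Delta}{2}]^d$. All the $x_k,\epsilon_k,\phi_k,\tau_k$ are mutually independent. Let $$Q=\frac1n\sum_{k=1}^n\dot x_k\dot x_k^\top-\frac{\bar\Delta^2}{4}I_d,\qquad b=\frac1n\sum_{k=1}^n\dot y_k\dot x_k,\qquad \mathcal S=\{\theta\in\mathbb R^d:\|\theta\|_1\le R\sqrt s\}$$ (the matrix $Q$ need not be positive semi-definite). A *stationary point* is a $\widetilde\theta\in\mathcal S$ such that, for some subgradient $g$ of $\|\cdot\|_1$ at $\widetilde\theta$, $$\langle Q\widetilde\theta-b+\lambda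 g,\ \theta-\widetilde\theta\rangle\ge 0\qquad\text{for all }\theta\in\mathcal S.$$ **Theorem.** There are absolute constants $C_2,C_3>0$ such that, for all $l>1$ and $0<a_1\le a_2$, there is $C_0=C_0(l,a_1,a_2)>0$ such that for every $C_1\ge C_0$ there are $C,C'>0$ depending only on $l,a_1,a_2,C_1$ with the following property. For all $(\kappa_0,\sigma,\Delta,\bar\Delta,M,R)$ as above there is $c>0$, depending only on these six numbers and on $l,a_1,a_2,C_1$, such that in the above setting, for any $D\in\{\Delta,\bar\Delta\}$, if $$a_1\Big(\frac{\sigma M^{1/l}}{\sigma+D}\,\frac{n}{\delta\log d}\Big)^{1/2}\le\zeta_y\le a_2\Big(\frac{\sigma M^{1/l}}{\sigma+D}\,\frac{n}{\delta\log d}\Big)^{1/2},$$ $$\lambda=C_1\frac{(\sigma+\bar\Delta)^2}{\sqrt{\kappa_0}}\big(\Delta+M^{1/(2l)}\big)\sqrt{\frac{\delta\log d}{n}},\qquad n\ge c\,\delta s\log d,$$ then with probability at least $1-8d^{1-\delta}-C_2\exp(-C_3n)$ every stationary point $\widetilde\theta$ satisfies $$\|\widetilde\theta-\theta^\star\|_2\le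 C\,\mathscr L\sqrt{\frac{\delta s\log d}{n}}\qquad\text{and}\qquad\|\widetilde\theta-\theta^\star\|_1\le C'\,\mathscr L\,s\sqrt{\frac{\delta\log d}{n}},\qquad \mathscr L=\frac{(\sigma+\bar\Delta)^2(\Delta+M^{1/(2l)})}{\kappa_0^{3/2}}.$$ (For $n=0$, which the hypotheses allow only if $s=0$, quotients by $n$ are read as $0$.) -/

import Mathlib

open MeasureTheory ProbabilityTheory
open scoped ENNReal Matrix

noncomputable section

namespace QCS

/-- The `ℓ₁` norm of a vector. -/
def l1Norm {d : ℕ} (v : Fin d → ℝ) : ℝ := ∑ i, |v i|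

/-- The `ℓ₂` norm of a vector. -/
def l2Norm {d : ℕ} (v : Fin d → ℝ) : ℝ := Real.sqrt (∑ i, v i ^ 2)

/-- `v` has at most `s` nonzero entries. -/
def IsSparse {d : ℕ} (s : ℕ) (v : Fin d → ℝ) : Prop :=
  (Finset.univ.filter (fun i => v i ≠ 0)).card ≤ s

/-- The uniform quantizer `a ↦ Δ (⌊a / Δ⌋ + 1/2)`; level `0` means no quantization. -/
def quantize (Δ a : ℝ) : ℝ := if Δ = 0 then a else Δ * ((⌊a / Δ⌋ : ℝ) + 1 / 2)

/-- Truncation of a scalar at the threshold `ζ`. -/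
def truncate (ζ a : ℝ) : ℝ := Real.sign a * min |a| ζ

/-- The uniform distribution on `[-Δ/2, Δ/2]`; the point mass at `0` if `Δ = 0`. -/
def uniformDither (Δ : ℝ) : Measure ℝ :=
  if Δ = 0 then Measure.dirac 0 else ProbabilityTheory.cond volume (Set.Icc (-(Δ / 2)) (Δ / 2))

/-- The uniform distribution on the cube `[-Δ/2, Δ/2]^d`. -/
def uniformCube (d : ℕ) (Δ : ℝ) : Measure (Fin d → ℝ) :=
  Measure.pi (fun _ => uniformDither Δ)

/-- The law of the sum of two independent uniform vectors in `[-Δ/2, Δ/2]^d`. -/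
def triangularDither (d : ℕ) (Δ : ℝ) : Measure (Fin d → ℝ) :=
  Measure.conv (uniformCube d Δ) (uniformCube d Δ)

/-- The sub-Gaussian norm `inf {t > 0 : E exp (X² / t²) ≤ 2}`, with value `∞` if there is
no such `t`. -/
def psi2Norm {Ω : Type*} [MeasurableSpace Ω] (μ : Measure Ω) (X : Ω → ℝ) : ℝ≥0∞ :=
  sInf {r : ℝ≥0∞ | ∃ t : ℝ, 0 < t ∧ r = ENNReal.ofReal t ∧
    ∫⁻ ω, ENNReal.ofReal (Real.exp (X ω ^ 2 / t ^ 2)) ∂μ ≤ 2}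

/-- The sub-Gaussian norm of a random vector: the supremum over unit directions. -/
def psi2NormVec {Ω : Type*} [MeasurableSpace Ω] {d : ℕ} (μ : Measure Ω)
    (x : Ω → Fin d → ℝ) : ℝ≥0∞ :=
  ⨆ (v : Fin d → ℝ) (_ : l2Norm v = 1), psi2Norm μ (fun ω => v ⬝ᵥ x ω)

/-- The matrix `E (x xᵀ)`. -/
def secondMoment {Ω : Type*} [MeasurableSpace Ω] {d : ℕ} (μ : Measure Ω)
    (x : Ω → Fin d → ℝ) : Matrix (Fin d) (Fin d) ℝ :=
  Matrix.of fun i j => ∫ ω, x ω i * x ω j ∂μ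

/-- The response `y = xᵀ θ + ε` of the linear model. -/
def response {Ω : Type*} {d : ℕ} (θ : Fin d → ℝ) (x : Ω → Fin d → ℝ) (ε : Ω → ℝ) (ω : Ω) : ℝ :=
  x ω ⬝ᵥ θ + ε ω

/-- The sampling scheme: i.i.d. covariates `x k`, i.i.d. noise `ε k` independent of the
covariates, uniform dithers `φ k` (level `Δ`, for the responses) and triangular dither vectors
`τ k` (level `Δb`, for the covariates). The last four fields together say that all the `4 n`
random elements are mutually independent. -/
structure SamplingScheme {Ω : Type*} [MeasurableSpace Ω] (μ : Measure Ω) {n d : ℕ} (Δ Δb : ℝ)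
    (x : Fin n → Ω → Fin d → ℝ) (ε : Fin n → Ω → ℝ) (φ : Fin n → Ω → ℝ)
    (τ : Fin n → Ω → Fin d → ℝ) : Prop where
  measurable_x : ∀ k, Measurable (x k)
  measurable_ε : ∀ k, Measurable (ε k)
  measurable_φ : ∀ k, Measurable (φ k)
  measurable_τ : ∀ k, Measurable (τ k)
  identDistrib_x : ∀ j k, IdentDistrib (x j) (x k) μ μ
  identDistrib_ε : ∀ j k, IdentDistrib (ε j) (ε k) μ μ
  law_φ : ∀ k, μ.map (φ k) = uniformDither Δ
  law_τ : ∀ k, μ.map (τ k) = triangularDither d Δb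
  indep_x_ε : ∀ k, IndepFun (x k) (ε k) μ
  indep_φ_τ : ∀ k, IndepFun (φ k) (τ k) μ
  indep_signal_dither : ∀ k,
    IndepFun (fun ω => (x k ω, ε k ω)) (fun ω => (φ k ω, τ k ω)) μ
  indep_samples : iIndepFun (fun k ω => (x k ω, ε k ω, φ k ω, τ k ω)) μ

/-- The quantized covariate: entrywise `quantize Δb (x + τ)`. -/
def quantizedCovariate {d : ℕ} (Δb : ℝ) (x τ : Fin d → ℝ) : Fin d → ℝ :=
  fun i => quantize Δb (x i + τ i)

/-- The quantized response: `quantize Δ (y truncated at ζ + φ)`. -/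
def quantizedResponse (Δ ζ y φ : ℝ) : ℝ := quantize Δ (truncate ζ y + φ)

/-- `(1/n) ∑ₖ xₖ xₖᵀ - (Δb²/4) I` for (quantized) covariates `xₖ`. -/
def matQ {n d : ℕ} (Δb : ℝ) (x : Fin n → Fin d → ℝ) : Matrix (Fin d) (Fin d) ℝ :=
  (1 / (n : ℝ)) • (∑ k, Matrix.vecMulVec (x k) (x k)) - (Δb ^ 2 / 4) • (1 : Matrix _ _ ℝ)

/-- `(1/n) ∑ₖ yₖ xₖ` for (quantized) pairs `(xₖ, yₖ)`. -/
def vecB {n d : ℕ} (x : Fin n → Fin d → ℝ) (y : Fin n → ℝ) : Fin d → ℝ :=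
  (1 / (n : ℝ)) • ∑ k, y k • x k

/-- The subdifferential of `f` at `θ`. -/
def subdifferential {d : ℕ} (f : (Fin d → ℝ) → ℝ) (θ : Fin d → ℝ) : Set (Fin d → ℝ) :=
  {g | ∀ u, f θ + g ⬝ᵥ (u - θ) ≤ f u}

/-- `θ` is a stationary point of
`minimize (1/2) θᵀ Q θ - bᵀ θ + lam ‖θ‖₁ subject to ‖θ‖₁ ≤ r`: it is feasible and, for some
subgradient `g` of the `ℓ₁` norm at `θ`, `⟨Q θ - b + lam g, u - θ⟩ ≥ 0` for all feasible `u`. -/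
def IsStationary {d : ℕ} (Q : Matrix (Fin d) (Fin d) ℝ) (b : Fin d → ℝ) (lam r : ℝ)
    (θ : Fin d → ℝ) : Prop :=
  l1Norm θ ≤ r ∧ ∃ g ∈ subdifferential l1Norm θ,
    ∀ u : Fin d → ℝ, l1Norm u ≤ r → 0 ≤ (Q *ᵥ θ - b + lam • g) ⬝ᵥ (u - θ)

/-- The factor `(σ + Δb)² (Δ + M^{1/(2l)}) / κ₀^{3/2}`. -/
def errorFactor (l κ₀ σ Δ Δb M : ℝ) : ℝ :=
  (σ + Δb) ^ 2 * (Δ + M ^ (1 / (2 * l))) / κ₀ ^ (3 / 2 : ℝ)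

end QCS

end

/-!
Adding the triangular dither makes `ẋ ẋᵀ - (Δ̄² / 4) I` an unbiased estimate of `x xᵀ`, and adding
the uniform dither makes `ẏ` an unbiased estimate of the truncated response, so that `b - Q θ⋆` is
centred up to the truncation bias, which is of higher order because `l > 1`. A Bernstein inequality
that needs only `2 l` moments of `y`, applicable because the truncated response is bounded, gives
`‖b - Q θ⋆‖_∞ ≤ λ / 2` with high probability.

A lower-tail bound controls the quadratic form of `Q` in a fixed direction, hence, by a union bound,
at all sums of `p` signed basis vectors. Maurey's empirical method transfers the bound to every `v`,
at the price of a multiple of `‖v‖₁² / p`; for the difference of two feasible points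
`‖v‖₁ ≤ 2 R √s`, so a suitable `p` makes this deficit at most `(λ / 4) ‖v‖₁`.

On these two events the stationarity inequality tested at `θ⋆` puts the error in a cone
`‖v‖₁ ≲ √s ‖v‖₂`, and strong convexity on that cone bounds it.
-/

noncomputable section

namespace QCS

section Quantizer

variable {Δ : ℝ}

/-- The rounding error `quantize Δ a - a`. It is `Δ`-periodic in `a`, unlike `quantize Δ` itself. -/
def quantError (Δ a : ℝ) : ℝ := quantize Δ a - a

@[fun_prop]
lemma measurable_quantize (Δ : ℝ) : Measurable (quantize Δ) := by
  unfold quantize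
  split_ifs <;> fun_prop

@[fun_prop]
lemma measurable_quantError (Δ : ℝ) : Measurable (quantError Δ) :=
  (measurable_quantize Δ).sub measurable_id

@[simp]
lemma quantize_zero_left (a : ℝ) : quantize 0 a = a := if_pos rfl

@[simp]
lemma quantError_zero_left (a : ℝ) : quantError 0 a = 0 := by simp [quantError]

lemma quantError_eq_fract (hΔ : 0 < Δ) (a : ℝ) :
    quantError Δ a = Δ * (1 / 2 - Int.fract (a / Δ)) := by
  rw [quantError, quantize, if_neg hΔ.ne', Int.fract]
  field_simp
  ring

lemma abs_quantError_le (hΔ : 0 ≤ Δ) (a : ℝ) : |quantError Δ a| ≤ Δ / 2 := by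
  rcases hΔ.eq_or_lt with rfl | h
  · simp
  · have h₀ := Int.fract_nonneg (a / Δ)
    have h₁ := (Int.fract_lt_one (a / Δ)).le
    rw [quantError_eq_fract h, abs_le]
    constructor <;> nlinarith

lemma periodic_quantError (hΔ : 0 < Δ) : Function.Periodic (quantError Δ) Δ := fun a => by
  simp only [quantError_eq_fract hΔ, add_div, div_self hΔ.ne', Int.fract_add_one]

lemma integral_quantError_pow_period (hΔ : 0 < Δ) (p : ℕ) (a : ℝ) :
    ∫ u in (-(Δ / 2))..(Δ / 2), quantError Δ (a + u) ^ p = ∫ u in (0 : ℝ)..Δ, (Δ / 2 - u) ^ p := by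
  have hper : Function.Periodic (fun u => quantError Δ u ^ p) Δ := fun u => by
    simp only [periodic_quantError hΔ u]
  rw [intervalIntegral.integral_comp_add_left (fun u => quantError Δ u ^ p),
    show a + Δ / 2 = a + -(Δ / 2) + Δ by ring, hper.intervalIntegral_add_eq _ 0, zero_add,
    intervalIntegral.integral_of_le hΔ.le, intervalIntegral.integral_of_le hΔ.le,
    ← integral_Ico_eq_integral_Ioc, ← integral_Ico_eq_integral_Ioc]
  refine setIntegral_congr_fun measurableSet_Ico fun u hu => ?_
  rw [quantError_eq_fract hΔ, Int.fract_eq_self.2 ⟨div_nonneg hu.1 hΔ.le, (div_lt_one hΔ).2 hu.2⟩]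
  congr 1
  field_simp

lemma abs_quantize_add_sub_le {a u : ℝ} (hΔ : 0 ≤ Δ) :
    |quantize Δ (a + u) - a| ≤ Δ / 2 + |u| := by
  rw [show quantize Δ (a + u) - a = quantError Δ (a + u) + u by unfold quantError; ring]
  exact (abs_add_le _ _).trans (add_le_add_left (abs_quantError_le hΔ _) _)

end Quantizer

section UniformDither

variable {Δ : ℝ}

lemma isProbabilityMeasure_uniformDither (hΔ : 0 ≤ Δ) : IsProbabilityMeasure (uniformDither Δ) := by
  unfold uniformDither
  split_ifs with h
  · infer_instance
  · have hpos : 0 < Δ := lt_of_le_of_ne' hΔ h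
    refine cond_isProbabilityMeasure_of_finite ?_ ?_ <;> simp [Real.volume_Icc, hpos]

lemma ae_abs_le_uniformDither (Δ : ℝ) : ∀ᵐ u ∂(uniformDither Δ), |u| ≤ Δ / 2 := by
  unfold uniformDither
  split_ifs with h
  · rw [ae_dirac_iff (measurableSet_le (by fun_prop) (by fun_prop)), h]
    simp
  · exact ae_cond_of_forall_mem measurableSet_Icc fun u hu => abs_le.2 hu

lemma integral_uniformDither (hΔ : 0 < Δ) (f : ℝ → ℝ) :
    ∫ u, f u ∂(uniformDither Δ) = Δ⁻¹ * ∫ u in (-(Δ / 2))..(Δ / 2), f u := by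
  rw [uniformDither, if_neg hΔ.ne', ProbabilityTheory.cond, integral_smul_measure, Real.volume_Icc,
    integral_Icc_eq_integral_Ioc, intervalIntegral.integral_of_le (by linarith), smul_eq_mul,
    ENNReal.toReal_inv, ENNReal.toReal_ofReal (by linarith)]
  ring_nf

lemma integrable_uniformDither (hΔ : 0 ≤ Δ) {f : ℝ → ℝ} (hf : Measurable f) (C : ℝ)
    (h : ∀ u, |u| ≤ Δ / 2 → |f u| ≤ C) : Integrable f (uniformDither Δ) := by
  have := isProbabilityMeasure_uniformDither hΔ
  exact Integrable.of_bound hf.aestronglyMeasurable C ((ae_abs_le_uniformDither Δ).mono h)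

lemma integral_id_uniformDither (hΔ : 0 ≤ Δ) : ∫ u, u ∂(uniformDither Δ) = 0 := by
  rcases hΔ.eq_or_lt with rfl | h
  · simp [uniformDither]
  · rw [integral_uniformDither h, integral_id]
    ring

lemma integral_sq_uniformDither (hΔ : 0 ≤ Δ) : ∫ u, u ^ 2 ∂(uniformDither Δ) = Δ ^ 2 / 12 := by
  rcases hΔ.eq_or_lt with rfl | h
  · simp [uniformDither]
  · rw [integral_uniformDither h, integral_pow]
    push_cast
    field_simp
    ring

lemma integral_quantError (hΔ : 0 ≤ Δ) (a : ℝ) :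
    ∫ u, quantError Δ (a + u) ∂(uniformDither Δ) = 0 := by
  rcases hΔ.eq_or_lt with rfl | h
  · simp
  · have hint := integral_quantError_pow_period h 1 a
    simp only [pow_one] at hint
    rw [integral_uniformDither h, hint, intervalIntegral.integral_comp_sub_left (fun u => u),
      integral_id]
    ring

lemma integral_quantError_sq (hΔ : 0 ≤ Δ) (a : ℝ) :
    ∫ u, quantError Δ (a + u) ^ 2 ∂(uniformDither Δ) = Δ ^ 2 / 12 := by
  rcases hΔ.eq_or_lt with rfl | h
  · simp
  · rw [integral_uniformDither h, integral_quantError_pow_period h 2 a,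
      intervalIntegral.integral_comp_sub_left (fun u => u ^ 2), integral_pow]
    push_cast
    field_simp
    ring

lemma integrable_quantError (hΔ : 0 ≤ Δ) (a : ℝ) :
    Integrable (fun u => quantError Δ (a + u)) (uniformDither Δ) :=
  integrable_uniformDither hΔ (by fun_prop) (Δ / 2) fun _ _ => abs_quantError_le hΔ _

lemma integrable_id_uniformDither (hΔ : 0 ≤ Δ) : Integrable (fun u => u) (uniformDither Δ) :=
  integrable_uniformDither hΔ (by fun_prop) (Δ / 2) fun _ hu => hu

lemma integral_quantize_uniformDither (hΔ : 0 ≤ Δ) (a : ℝ) :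
    ∫ u, quantize Δ (a + u) ∂(uniformDither Δ) = a := by
  have := isProbabilityMeasure_uniformDither hΔ
  have hid := integrable_id_uniformDither hΔ
  have hadd : Integrable (fun u => a + u) (uniformDither Δ) := (integrable_const a).add hid
  calc ∫ u, quantize Δ (a + u) ∂(uniformDither Δ)
      = ∫ u, (quantError Δ (a + u) + (a + u)) ∂(uniformDither Δ) := by simp [quantError]
    _ = a := by
      rw [integral_add (integrable_quantError hΔ a) hadd, integral_add (integrable_const a) hid,
        integral_quantError hΔ, integral_id_uniformDither hΔ]
      simp

end UniformDither

section TriangularDither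

variable {Δ : ℝ}

/-- The law of the sum of two independent uniform dithers, that is, the law of one coordinate of
`triangularDither`. -/
def triangularLaw (Δ : ℝ) : Measure ℝ := Measure.conv (uniformDither Δ) (uniformDither Δ)

lemma isProbabilityMeasure_triangularLaw (hΔ : 0 ≤ Δ) : IsProbabilityMeasure (triangularLaw Δ) := by
  have := isProbabilityMeasure_uniformDither hΔ
  unfold triangularLaw
  infer_instance

lemma ae_abs_le_uniformDither_prod (hΔ : 0 ≤ Δ) :
    ∀ᵐ p ∂((uniformDither Δ).prod (uniformDither Δ)), |p.1| ≤ Δ / 2 ∧ |p.2| ≤ Δ / 2 := by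
  have := isProbabilityMeasure_uniformDither hΔ
  exact (Measure.quasiMeasurePreserving_fst.ae (ae_abs_le_uniformDither Δ)).and
    (Measure.quasiMeasurePreserving_snd.ae (ae_abs_le_uniformDither Δ))

lemma ae_abs_le_triangularLaw (hΔ : 0 ≤ Δ) : ∀ᵐ u ∂(triangularLaw Δ), |u| ≤ Δ := by
  unfold triangularLaw Measure.conv
  rw [ae_map_iff (by fun_prop) (measurableSet_le (by fun_prop) (by fun_prop))]
  filter_upwards [ae_abs_le_uniformDither_prod hΔ] with p hp
  linarith [abs_add_le p.1 p.2, hp.1, hp.2]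

lemma integrable_triangularLaw (hΔ : 0 ≤ Δ) {f : ℝ → ℝ} (hf : Measurable f) (C : ℝ)
    (h : ∀ u, |u| ≤ Δ → |f u| ≤ C) : Integrable f (triangularLaw Δ) := by
  have := isProbabilityMeasure_triangularLaw hΔ
  exact Integrable.of_bound hf.aestronglyMeasurable C ((ae_abs_le_triangularLaw hΔ).mono h)

lemma integral_triangularLaw (hΔ : 0 ≤ Δ) {f : ℝ → ℝ} (hf : Integrable f (triangularLaw Δ)) :
    ∫ u, f u ∂(triangularLaw Δ)
      = ∫ u, ∫ v, f (u + v) ∂(uniformDither Δ) ∂(uniformDither Δ) := by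
  have := isProbabilityMeasure_uniformDither hΔ
  exact integral_conv hf

lemma integrable_quantize_sub_triangularLaw (hΔ : 0 ≤ Δ) (a : ℝ) :
    Integrable (fun u => quantize Δ (a + u) - a) (triangularLaw Δ) :=
  integrable_triangularLaw hΔ (by fun_prop) (Δ / 2 + Δ) fun _ hu =>
    (abs_quantize_add_sub_le hΔ).trans (by gcongr)

lemma integrable_quantize_triangularLaw (hΔ : 0 ≤ Δ) (a : ℝ) :
    Integrable (fun u => quantize Δ (a + u)) (triangularLaw Δ) := by
  have := isProbabilityMeasure_triangularLaw hΔ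
  exact ((integrable_quantize_sub_triangularLaw hΔ a).add (integrable_const a)).congr
    (ae_of_all _ fun u => sub_add_cancel _ _)

lemma integral_quantize_triangularLaw (hΔ : 0 ≤ Δ) (a : ℝ) :
    ∫ u, quantize Δ (a + u) ∂(triangularLaw Δ) = a := by
  have := isProbabilityMeasure_uniformDither hΔ
  rw [integral_triangularLaw hΔ (integrable_quantize_triangularLaw hΔ a)]
  simp_rw [← add_assoc, integral_quantize_uniformDither hΔ]
  rw [integral_add (integrable_const a) (integrable_id_uniformDither hΔ),
    integral_id_uniformDither hΔ]
  simp

lemma integrable_mul_quantError (hΔ : 0 ≤ Δ) (a : ℝ) :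
    Integrable (fun p : ℝ × ℝ => p.2 * quantError Δ (a + p.1 + p.2))
      ((uniformDither Δ).prod (uniformDither Δ)) := by
  have := isProbabilityMeasure_uniformDither hΔ
  refine Integrable.of_bound (by fun_prop) (Δ / 2 * (Δ / 2))
    ((ae_abs_le_uniformDither_prod hΔ).mono fun p hp => ?_)
  rw [Real.norm_eq_abs, abs_mul]
  gcongr
  exacts [hp.2, abs_quantError_le hΔ _]

lemma integral_integral_mul_quantError (hΔ : 0 ≤ Δ) (a : ℝ) :
    ∫ u, ∫ v, v * quantError Δ (a + u + v) ∂(uniformDither Δ) ∂(uniformDither Δ) = 0 := by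
  have := isProbabilityMeasure_uniformDither hΔ
  rw [integral_integral_swap (integrable_mul_quantError hΔ a)]
  simp_rw [integral_const_mul, add_right_comm a, integral_quantError hΔ, mul_zero, integral_zero]

lemma integral_const_add_add_sq {T : Type*} [MeasurableSpace T] {ν : Measure T}
    [IsProbabilityMeasure ν] {X Y : T → ℝ} (hX : MemLp X 2 ν) (hY : MemLp Y 2 ν)
    (hX_mean : ∫ t, X t ∂ν = 0) (hY_mean : ∫ t, Y t ∂ν = 0) (c : ℝ) :
    ∫ t, (c + X t + Y t) ^ 2 ∂ν
      = c ^ 2 + ∫ t, X t ^ 2 ∂ν + ∫ t, Y t ^ 2 ∂ν + 2 * ∫ t, X t * Y t ∂ν := by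
  have hX₁ : Integrable X ν := hX.integrable one_le_two
  have hY₁ : Integrable Y ν := hY.integrable one_le_two
  have hXY : Integrable (fun t => X t * Y t) ν := hX.integrable_mul hY
  have hlin : Integrable (fun t => 2 * c * X t + 2 * c * Y t) ν :=
    (hX₁.const_mul _).add (hY₁.const_mul _)
  have hX_sq : Integrable (fun t => c ^ 2 + X t ^ 2) ν :=
    (integrable_const _).add hX.integrable_sq
  have hsq : Integrable (fun t => c ^ 2 + X t ^ 2 + Y t ^ 2) ν := hX_sq.add hY.integrable_sq
  have hquad : Integrable (fun t => c ^ 2 + X t ^ 2 + Y t ^ 2 + (2 * c * X t + 2 * c * Y t)) ν :=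
    hsq.add hlin
  calc ∫ t, (c + X t + Y t) ^ 2 ∂ν
      = ∫ t, (c ^ 2 + X t ^ 2 + Y t ^ 2 + (2 * c * X t + 2 * c * Y t) + 2 * (X t * Y t)) ∂ν := by
        congr 1 with t
        ring
    _ = c ^ 2 + ∫ t, X t ^ 2 ∂ν + ∫ t, Y t ^ 2 ∂ν + (2 * c * 0 + 2 * c * 0)
          + 2 * ∫ t, X t * Y t ∂ν := by
        rw [integral_add hquad (hXY.const_mul 2), integral_add hsq hlin,
          integral_add hX_sq hY.integrable_sq, integral_add (integrable_const _) hX.integrable_sq,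
          integral_add (hX₁.const_mul _) (hY₁.const_mul _), integral_const_mul,
          integral_const_mul, integral_const_mul, hX_mean, hY_mean, integral_const,
          probReal_univ, one_smul]
    _ = _ := by ring

lemma integral_quantize_sub_sq_uniformDither (hΔ : 0 ≤ Δ) (a u : ℝ) :
    ∫ v, (quantize Δ (a + u + v) - a) ^ 2 ∂(uniformDither Δ)
      = u ^ 2 + Δ ^ 2 / 6 + 2 * ∫ v, v * quantError Δ (a + u + v) ∂(uniformDither Δ) := by
  have := isProbabilityMeasure_uniformDither hΔ
  have hid : MemLp (fun v => v) 2 (uniformDither Δ) :=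
    .of_bound (by fun_prop) (Δ / 2) (ae_abs_le_uniformDither Δ)
  have herr : MemLp (fun v => quantError Δ (a + u + v)) 2 (uniformDither Δ) :=
    .of_bound (by fun_prop : Measurable _).aestronglyMeasurable (Δ / 2)
      (.of_forall fun _ => abs_quantError_le hΔ _)
  calc ∫ v, (quantize Δ (a + u + v) - a) ^ 2 ∂(uniformDither Δ)
      = ∫ v, (u + v + quantError Δ (a + u + v)) ^ 2 ∂(uniformDither Δ) := by
        congr 1 with v
        unfold quantError
        ring
    _ = u ^ 2 + Δ ^ 2 / 12 + Δ ^ 2 / 12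
          + 2 * ∫ v, v * quantError Δ (a + u + v) ∂(uniformDither Δ) := by
        rw [integral_const_add_add_sq hid herr (integral_id_uniformDither hΔ)
          (integral_quantError hΔ _), integral_sq_uniformDither hΔ, integral_quantError_sq hΔ]
    _ = _ := by ring

lemma integrable_quantize_sub_sq_triangularLaw (hΔ : 0 ≤ Δ) (a : ℝ) :
    Integrable (fun u => (quantize Δ (a + u) - a) ^ 2) (triangularLaw Δ) :=
  integrable_triangularLaw hΔ (by fun_prop) ((Δ / 2 + Δ) ^ 2) fun u hu => by
    rw [abs_pow]
    gcongr
    exact (abs_quantize_add_sub_le hΔ).trans (by gcongr)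

/-- The triangular dither makes the second moment of the quantization noise signal-independent;
this is the reason for the correction `Δb ^ 2 / 4` in `matQ`. -/
lemma integral_quantize_sub_sq_triangularLaw (hΔ : 0 ≤ Δ) (a : ℝ) :
    ∫ u, (quantize Δ (a + u) - a) ^ 2 ∂(triangularLaw Δ) = Δ ^ 2 / 4 := by
  have := isProbabilityMeasure_uniformDither hΔ
  have hid_sq : Integrable (fun u => u ^ 2) (uniformDither Δ) :=
    integrable_uniformDither hΔ (by fun_prop) ((Δ / 2) ^ 2) fun v hv => by
      rw [abs_pow]
      gcongr
  have hcross := (integrable_mul_quantError hΔ a).integral_prod_left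
  rw [integral_triangularLaw hΔ (integrable_quantize_sub_sq_triangularLaw hΔ a)]
  simp_rw [← add_assoc, integral_quantize_sub_sq_uniformDither hΔ a]
  rw [integral_add (by fun_prop) (hcross.const_mul 2), integral_add hid_sq (integrable_const _),
    integral_const_mul, integral_integral_mul_quantError hΔ, integral_sq_uniformDither hΔ]
  simp
  ring

lemma triangularDither_eq_pi (d : ℕ) (hΔ : 0 ≤ Δ) :
    triangularDither d Δ = Measure.pi fun _ => triangularLaw Δ := by
  have := isProbabilityMeasure_uniformDither hΔ
  unfold triangularDither triangularLaw uniformCube Measure.conv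
  rw [← Measure.pi_map_pi (μ := fun _ : Fin d => (uniformDither Δ).prod (uniformDither Δ))
    (f := fun _ p => p.1 + p.2) (fun _ => by fun_prop),
    ← (measurePreserving_arrowProdEquivProdArrow ℝ ℝ (Fin d) (fun _ => uniformDither Δ)
      (fun _ => uniformDither Δ)).map_eq, Measure.map_map (by fun_prop) (by fun_prop)]
  rfl

end TriangularDither

section SubGaussian

lemma l2Norm_nonneg {d : ℕ} (v : Fin d → ℝ) : 0 ≤ l2Norm v := Real.sqrt_nonneg _

lemma l2Norm_sq {d : ℕ} (v : Fin d → ℝ) : l2Norm v ^ 2 = v ⬝ᵥ v := by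
  rw [l2Norm, Real.sq_sqrt (Finset.sum_nonneg fun i _ => sq_nonneg _)]
  simp only [dotProduct, sq]

lemma l2Norm_smul {d : ℕ} (c : ℝ) (v : Fin d → ℝ) : l2Norm (c • v) = |c| * l2Norm v := by
  simp only [l2Norm, Pi.smul_apply, smul_eq_mul, mul_pow, ← Finset.mul_sum]
  rw [Real.sqrt_mul (sq_nonneg c), Real.sqrt_sq_eq_abs]

lemma lintegral_exp_sq_gaussianReal :
    ∫⁻ g, ENNReal.ofReal (Real.exp (g ^ 2 / 4)) ∂(gaussianReal 0 1) ≤ 2 := by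
  have hdensity (x : ℝ) : gaussianPDF 0 1 x * ENNReal.ofReal (Real.exp (x ^ 2 / 4))
      = ENNReal.ofReal ((√(2 * Real.pi))⁻¹ * Real.exp (-(1 / 4) * x ^ 2)) := by
    rw [gaussianPDF, ← ENNReal.ofReal_mul (gaussianPDFReal_nonneg _ _ _), gaussianPDFReal,
      mul_assoc, ← Real.exp_add]
    norm_num
    congr 3
    ring
  rw [gaussianReal_of_var_ne_zero 0 one_ne_zero,
    lintegral_withDensity_eq_lintegral_mul _ (measurable_gaussianPDF 0 1) (by fun_prop)]
  simp_rw [Pi.mul_apply, hdensity]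
  rw [← ofReal_integral_eq_lintegral_ofReal
    ((integrable_exp_neg_mul_sq (by norm_num)).const_mul _) (ae_of_all _ fun x => by positivity),
    integral_const_mul, integral_gaussian, ← ENNReal.ofReal_ofNat 2]
  refine ENNReal.ofReal_le_ofReal ?_
  rw [← Real.sqrt_inv, ← Real.sqrt_mul (by positivity), Real.sqrt_le_left (by norm_num)]
  field_simp
  norm_num

lemma lintegral_exp_mul_gaussianReal (t : ℝ) :
    ∫⁻ g, ENNReal.ofReal (Real.exp (t * g)) ∂(gaussianReal 0 1)
      = ENNReal.ofReal (Real.exp (t ^ 2 / 2)) := by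
  rw [← ofReal_integral_eq_lintegral_ofReal (integrable_exp_mul_gaussianReal t)
    (ae_of_all _ fun x => by positivity)]
  have hmgf := congrFun (mgf_id_gaussianReal (μ := 0) (v := 1)) t
  simp only [mgf, id, zero_mul, NNReal.coe_one, one_mul, zero_add] at hmgf
  rw [hmgf]

variable {T : Type*} [MeasurableSpace T] {ν : Measure T}

lemma lintegral_exp_sq_le_of_psi2Norm_lt {X : T → ℝ} {t : ℝ}
    (h : psi2Norm ν X < ENNReal.ofReal t) :
    ∫⁻ ω, ENNReal.ofReal (Real.exp (X ω ^ 2 / t ^ 2)) ∂ν ≤ 2 := by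
  obtain ⟨_, ⟨r, hr, rfl, hint⟩, hrt⟩ := sInf_lt_iff.1 h
  have hrt' : r ≤ t := (ENNReal.ofReal_lt_ofReal_iff_of_nonneg hr.le).1 hrt |>.le
  refine le_trans (lintegral_mono fun ω => ?_) hint
  gcongr

variable [IsProbabilityMeasure ν]

lemma lintegral_exp_sq_le_of_hasSubgaussianMGF {X : T → ℝ} (hX : Measurable X)
    {c : NNReal} (h : HasSubgaussianMGF X c ν) :
    ∫⁻ t, ENNReal.ofReal (Real.exp (X t ^ 2 / (4 * c))) ∂ν ≤ 2 := by
  rcases eq_or_ne c 0 with rfl | hc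
  · simp
  have : (0 : ℝ) < c := by positivity
  have hsq : √(2 * c : ℝ) ^ 2 = 2 * c := Real.sq_sqrt (by positivity)
  -- `exp (X² / (4c))` is an average of `exp (s X)` over a Gaussian `s`.
  have haverage (t : T) : ENNReal.ofReal (Real.exp (X t ^ 2 / (4 * c)))
      = ∫⁻ g, ENNReal.ofReal (Real.exp (g / √(2 * c) * X t)) ∂(gaussianReal 0 1) := by
    simp_rw [div_mul_eq_mul_div, mul_comm _ (X t), mul_div_right_comm]
    rw [lintegral_exp_mul_gaussianReal, div_pow, hsq]
    congr 2
    field_simp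
    norm_num
  calc ∫⁻ t, ENNReal.ofReal (Real.exp (X t ^ 2 / (4 * c))) ∂ν
      = ∫⁻ g, ∫⁻ t, ENNReal.ofReal (Real.exp (g / √(2 * c) * X t)) ∂ν ∂(gaussianReal 0 1) := by
        simp_rw [haverage]
        rw [lintegral_lintegral_swap (by fun_prop)]
    _ ≤ ∫⁻ g, ENNReal.ofReal (Real.exp (g ^ 2 / 4)) ∂(gaussianReal 0 1) := by
        refine lintegral_mono fun g => ?_
        rw [← ofReal_integral_eq_lintegral_ofReal (h.integrable_exp_mul _)
          (ae_of_all _ fun x => by positivity)]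
        refine ENNReal.ofReal_le_ofReal ((h.mgf_le (g / √(2 * c))).trans_eq ?_)
        rw [div_pow, hsq]
        congr 1
        field_simp
        norm_num
    _ ≤ 2 := lintegral_exp_sq_gaussianReal

lemma lintegral_exp_sq_le_of_psi2NormVec_le {d : ℕ} {x : T → Fin d → ℝ} {σ : ℝ} (hσ : 0 < σ)
    (h : psi2NormVec ν x ≤ ENNReal.ofReal σ) (v : Fin d → ℝ) :
    ∫⁻ ω, ENNReal.ofReal (Real.exp ((v ⬝ᵥ x ω) ^ 2 / (4 * σ ^ 2 * (v ⬝ᵥ v)))) ∂ν ≤ 2 := by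
  rcases eq_or_ne (v ⬝ᵥ v) 0 with hv | hv
  · simp [hv]
  have hN : l2Norm v ≠ 0 := by rwa [← l2Norm_sq, pow_ne_zero_iff two_ne_zero] at hv
  have hunit : l2Norm ((l2Norm v)⁻¹ • v) = 1 := by
    rw [l2Norm_smul, abs_of_nonneg (inv_nonneg.2 (l2Norm_nonneg v)), inv_mul_cancel₀ hN]
  have hle : psi2Norm ν (fun ω => ((l2Norm v)⁻¹ • v) ⬝ᵥ x ω) ≤ ENNReal.ofReal σ :=
    (le_iSup₂ (f := fun (u : Fin d → ℝ) (_ : l2Norm u = 1) => psi2Norm ν (fun ω => u ⬝ᵥ x ω))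
      _ hunit).trans h
  -- The infimum defining `psi2Norm` need not be attained, whence the factor `2`.
  have hlt := hle.trans_lt <|
    (ENNReal.ofReal_lt_ofReal_iff_of_nonneg hσ.le).2 (by linarith : σ < 2 * σ)
  convert lintegral_exp_sq_le_of_psi2Norm_lt hlt using 5 with ω
  rw [smul_dotProduct, smul_eq_mul, ← l2Norm_sq]
  field_simp
  norm_num

end SubGaussian

section VectorDither

variable {d : ℕ} {Δ : ℝ}

lemma isProbabilityMeasure_triangularDither (d : ℕ) (hΔ : 0 ≤ Δ) :
    IsProbabilityMeasure (triangularDither d Δ) := by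
  have := isProbabilityMeasure_triangularLaw hΔ
  rw [triangularDither_eq_pi d hΔ]
  infer_instance

@[fun_prop]
lemma measurable_quantizedCovariate (Δ : ℝ) :
    Measurable (fun p : (Fin d → ℝ) × (Fin d → ℝ) => quantizedCovariate Δ p.1 p.2) := by
  unfold quantizedCovariate
  fun_prop

lemma integral_triangularDither_eval (hΔ : 0 ≤ Δ) {f : ℝ → ℝ} (hf : Measurable f) (i : Fin d) :
    ∫ t, f (t i) ∂(triangularDither d Δ) = ∫ u, f u ∂(triangularLaw Δ) := by
  have := isProbabilityMeasure_triangularLaw hΔ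
  rw [triangularDither_eq_pi d hΔ]
  exact integral_comp_eval (μ := fun _ : Fin d => triangularLaw Δ) (i := i)
    hf.aestronglyMeasurable

lemma ae_abs_le_triangularDither (hΔ : 0 ≤ Δ) (i : Fin d) :
    ∀ᵐ t ∂(triangularDither d Δ), |t i| ≤ Δ := by
  have := isProbabilityMeasure_triangularLaw hΔ
  rw [triangularDither_eq_pi d hΔ]
  exact (Measure.quasiMeasurePreserving_eval (fun _ : Fin d => triangularLaw Δ) i).ae
    (ae_abs_le_triangularLaw hΔ)

lemma iIndepFun_triangularDither (hΔ : 0 ≤ Δ) {f : Fin d → ℝ → ℝ} (hf : ∀ i, Measurable (f i)) :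
    iIndepFun (fun i (t : Fin d → ℝ) => f i (t i)) (triangularDither d Δ) := by
  have := isProbabilityMeasure_triangularLaw hΔ
  rw [triangularDither_eq_pi d hΔ]
  exact iIndepFun_pi fun i => (hf i).aemeasurable

lemma integral_quantizedCovariate (hΔ : 0 ≤ Δ) (a : Fin d → ℝ) (i : Fin d) :
    ∫ t, quantizedCovariate Δ a t i ∂(triangularDither d Δ) = a i :=
  (integral_triangularDither_eval hΔ (f := fun u => quantize Δ (a i + u)) (by fun_prop) i).trans
    (integral_quantize_triangularLaw hΔ (a i))

lemma integral_quantize_sq_triangularLaw (hΔ : 0 ≤ Δ) (a : ℝ) :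
    ∫ u, quantize Δ (a + u) ^ 2 ∂(triangularLaw Δ) = a ^ 2 + Δ ^ 2 / 4 := by
  have := isProbabilityMeasure_triangularLaw hΔ
  have hsq := integrable_quantize_sub_sq_triangularLaw hΔ a
  have hlin := (integrable_quantize_triangularLaw hΔ a).const_mul (2 * a)
  have hadd : Integrable (fun u => (quantize Δ (a + u) - a) ^ 2 + 2 * a * quantize Δ (a + u))
      (triangularLaw Δ) := hsq.add hlin
  calc ∫ u, quantize Δ (a + u) ^ 2 ∂(triangularLaw Δ)
      = ∫ u, ((quantize Δ (a + u) - a) ^ 2 + 2 * a * quantize Δ (a + u) - a ^ 2)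
          ∂(triangularLaw Δ) := by
        congr 1 with u
        ring
    _ = Δ ^ 2 / 4 + 2 * a * a - a ^ 2 := by
        rw [integral_sub hadd (integrable_const _), integral_add hsq hlin, integral_const_mul,
          integral_quantize_triangularLaw hΔ, integral_quantize_sub_sq_triangularLaw hΔ]
        simp
    _ = a ^ 2 + Δ ^ 2 / 4 := by ring

lemma integral_quantizedCovariate_mul (hΔ : 0 ≤ Δ) (a : Fin d → ℝ) (i j : Fin d) :
    ∫ t, quantizedCovariate Δ a t i * quantizedCovariate Δ a t j ∂(triangularDither d Δ)
      = a i * a j + if i = j then Δ ^ 2 / 4 else 0 := by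
  rcases eq_or_ne i j with rfl | hij
  · simp only [quantizedCovariate, ← sq, if_true]
    rw [integral_triangularDither_eval hΔ (f := fun u => quantize Δ (a i + u) ^ 2) (by fun_prop),
      integral_quantize_sq_triangularLaw hΔ]
  · have hindep : IndepFun (fun t => quantizedCovariate Δ a t i)
        (fun t => quantizedCovariate Δ a t j) (triangularDither d Δ) :=
      (iIndepFun_triangularDither hΔ (f := fun i u => quantize Δ (a i + u))
        fun i => by fun_prop).indepFun hij
    rw [if_neg hij, add_zero, hindep.integral_fun_mul_eq_mul_integral (by fun_prop) (by fun_prop),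
      integral_quantizedCovariate hΔ, integral_quantizedCovariate hΔ]

lemma hasSubgaussianMGF_dotProduct_quantizedCovariate_sub (hΔ : 0 ≤ Δ) (a v : Fin d → ℝ) :
    HasSubgaussianMGF (fun t => v ⬝ᵥ (quantizedCovariate Δ a t - a))
      (9 / 4 * Δ ^ 2 * (v ⬝ᵥ v)).toNNReal (triangularDither d Δ) := by
  have := isProbabilityMeasure_triangularLaw hΔ
  have := isProbabilityMeasure_triangularDither d hΔ
  have hmem (i : Fin d) : ∀ᵐ t ∂(triangularDither d Δ), v i * (quantize Δ (a i + t i) - a i)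
      ∈ Set.Icc (-(|v i| * (3 * Δ / 2))) (|v i| * (3 * Δ / 2)) := by
    filter_upwards [ae_abs_le_triangularDither hΔ i] with t ht
    rw [Set.mem_Icc, ← abs_le, abs_mul]
    gcongr
    linarith [abs_quantize_add_sub_le (a := a i) (u := t i) hΔ]
  have hmean (i : Fin d) :
      ∫ t, v i * (quantize Δ (a i + t i) - a i) ∂(triangularDither d Δ) = 0 := by
    rw [integral_triangularDither_eval hΔ (f := fun u => v i * (quantize Δ (a i + u) - a i))
      (by fun_prop), integral_const_mul, integral_sub (integrable_quantize_triangularLaw hΔ _)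
      (integrable_const _), integral_quantize_triangularLaw hΔ]
    simp
  have hsum := HasSubgaussianMGF.sum_of_iIndepFun
    (iIndepFun_triangularDither hΔ (f := fun i u => v i * (quantize Δ (a i + u) - a i))
      fun i => by fun_prop) (s := Finset.univ) fun i _ =>
        hasSubgaussianMGF_of_mem_Icc_of_integral_eq_zero
          (Measurable.aemeasurable (by fun_prop)) (hmem i) (hmean i)
  suffices hparam : (9 / 4 * Δ ^ 2 * (v ⬝ᵥ v)).toNNReal
      = ∑ i, (‖|v i| * (3 * Δ / 2) - -(|v i| * (3 * Δ / 2))‖₊ / 2) ^ 2 by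
    rw [hparam]
    exact hsum
  rw [← NNReal.coe_inj, Real.coe_toNNReal _ (by rw [← l2Norm_sq]; positivity)]
  push_cast
  simp only [dotProduct, Finset.mul_sum]
  refine Finset.sum_congr rfl fun i _ => ?_
  rw [div_pow, Real.norm_eq_abs, sq_abs]
  linear_combination -(9 / 4 * Δ ^ 2) * sq_abs (v i)

lemma lintegral_exp_sq_dotProduct_quantizedCovariate_sub (hΔ : 0 ≤ Δ) (a v : Fin d → ℝ) :
    ∫⁻ t, ENNReal.ofReal (Real.exp ((v ⬝ᵥ (quantizedCovariate Δ a t - a)) ^ 2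
      / (9 * Δ ^ 2 * (v ⬝ᵥ v)))) ∂(triangularDither d Δ) ≤ 2 := by
  have := isProbabilityMeasure_triangularDither d hΔ
  have hmeas : Measurable fun t => v ⬝ᵥ (quantizedCovariate Δ a t - a) := by
    simp only [dotProduct, Pi.sub_apply]
    fun_prop
  convert lintegral_exp_sq_le_of_hasSubgaussianMGF hmeas
    (hasSubgaussianMGF_dotProduct_quantizedCovariate_sub hΔ a v) using 6
  rw [Real.coe_toNNReal _ (by rw [← l2Norm_sq]; positivity)]
  ring

end VectorDither

section Concentration

lemma exp_le_one_add_add_sq_mul_exp_abs (x : ℝ) :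
    Real.exp x ≤ 1 + x + x ^ 2 * Real.exp |x| := by
  have h := Complex.norm_exp_sub_sum_le_norm_mul_exp (x : ℂ) 2
  have hcast : Complex.exp x - ∑ m ∈ Finset.range 2, (x : ℂ) ^ m / (m.factorial : ℂ)
      = ((Real.exp x - (1 + x) : ℝ) : ℂ) := by
    simp [Finset.sum_range_succ]
  rw [hcast, Complex.norm_real, Complex.norm_real, Real.norm_eq_abs, Real.norm_eq_abs, sq_abs] at h
  linarith [le_abs_self (Real.exp x - (1 + x))]

lemma exp_neg_le_one_sub_add_sq {x : ℝ} (hx : 0 ≤ x) : Real.exp (-x) ≤ 1 - x + x ^ 2 := by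
  rcases le_total x 1 with h | h
  · have := Real.abs_exp_sub_one_sub_id_le (x := -x) (by rwa [abs_neg, abs_of_nonneg hx])
    rw [neg_sq] at this
    linarith [le_abs_self (Real.exp (-x) - 1 - -x)]
  · have : Real.exp (-x) ≤ 1 := Real.exp_le_one_iff.2 (by linarith)
    nlinarith

variable {Ω : Type*} [MeasurableSpace Ω] {μ : Measure Ω}

lemma integrable_of_lintegral_ofReal_le {f : Ω → ℝ} (hf : Measurable f) (hpos : ∀ ω, 0 ≤ f ω)
    {G : ℝ} (h : ∫⁻ ω, ENNReal.ofReal (f ω) ∂μ ≤ ENNReal.ofReal G) : Integrable f μ :=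
  (lintegral_ofReal_ne_top_iff_integrable hf.aestronglyMeasurable (ae_of_all _ hpos)).1
    (ne_top_of_le_ne_top ENNReal.ofReal_ne_top h)

lemma integral_le_of_lintegral_ofReal_le {f : Ω → ℝ} (hf : Measurable f) (hpos : ∀ ω, 0 ≤ f ω)
    {G : ℝ} (hG : 0 ≤ G) (h : ∫⁻ ω, ENNReal.ofReal (f ω) ∂μ ≤ ENNReal.ofReal G) :
    ∫ ω, f ω ∂μ ≤ G := by
  rw [integral_eq_lintegral_of_nonneg_ae (ae_of_all _ hpos) hf.aestronglyMeasurable]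
  exact ENNReal.toReal_le_of_le_ofReal hG h

variable [IsProbabilityMeasure μ]

lemma integrable_of_integrable_sq {f : Ω → ℝ} (hf : Measurable f)
    (h : Integrable (fun ω => f ω ^ 2) μ) : Integrable f μ :=
  ((memLp_two_iff_integrable_sq hf.aestronglyMeasurable).2 h).integrable one_le_two

lemma measureReal_sum_ge_le {ι : Type*} [Fintype ι] {Y : ι → Ω → ℝ} (hind : iIndepFun Y μ)
    (hm : ∀ k, Measurable (Y k)) {t B : ℝ} (u : ℝ) (ht : 0 ≤ t)
    (hint : ∀ k, Integrable (fun ω => Real.exp (t * Y k ω)) μ)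
    (hB : ∀ k, ∫ ω, Real.exp (t * Y k ω) ∂μ ≤ Real.exp B) :
    μ.real {ω | Fintype.card ι * u ≤ ∑ k, Y k ω} ≤ Real.exp (Fintype.card ι * (B - t * u)) := by
  have hmgf : mgf (∑ k, Y k) μ t ≤ Real.exp B ^ Fintype.card ι := by
    rw [hind.mgf_sum hm]
    calc ∏ k, mgf (Y k) μ t ≤ ∏ _k : ι, Real.exp B :=
          Finset.prod_le_prod (fun k _ => mgf_nonneg) fun k _ => hB k
      _ = _ := by simp
  calc μ.real {ω | Fintype.card ι * u ≤ ∑ k, Y k ω}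
      = μ.real {ω | Fintype.card ι * u ≤ (∑ k, Y k) ω} := by simp only [Finset.sum_apply]
    _ ≤ Real.exp (-t * (Fintype.card ι * u)) * mgf (∑ k, Y k) μ t :=
        measure_ge_le_exp_mul_mgf _ ht (hind.integrable_exp_mul_sum hm fun k _ => hint k)
    _ ≤ Real.exp (-t * (Fintype.card ι * u)) * Real.exp B ^ Fintype.card ι := by gcongr
    _ = Real.exp (Fintype.card ι * (B - t * u)) := by
        rw [← Real.exp_nat_mul, ← Real.exp_add]
        ring_nf

lemma integral_exp_mul_centered_le {Y W : Ω → ℝ} (hm : Measurable Y) (hY : Integrable Y μ)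
    (hW : Integrable W μ) {t G : ℝ} (hexp : ∀ ω, Real.exp (t * Y ω) ≤ 1 + t * Y ω + t ^ 2 * W ω)
    (hG : ∫ ω, W ω ∂μ ≤ G) :
    Integrable (fun ω => Real.exp (t * (Y ω - ∫ ω, Y ω ∂μ))) μ ∧
    ∫ ω, Real.exp (t * (Y ω - ∫ ω, Y ω ∂μ)) ∂μ ≤ Real.exp (t ^ 2 * G) := by
  set m : ℝ := ∫ ω, Y ω ∂μ
  have hlin : Integrable (fun ω => 1 + t * Y ω) μ := (integrable_const 1).add (hY.const_mul t)
  have hquad : Integrable (fun ω => 1 + t * Y ω + t ^ 2 * W ω) μ := hlin.add (hW.const_mul _)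
  have hint : Integrable (fun ω => Real.exp (t * Y ω)) μ :=
    hquad.mono' (by fun_prop) (ae_of_all _ fun ω => by
      rw [Real.norm_eq_abs, Real.abs_exp]
      exact hexp ω)
  have hmean : ∫ ω, Real.exp (t * Y ω) ∂μ ≤ Real.exp (t * m + t ^ 2 * G) :=
    calc ∫ ω, Real.exp (t * Y ω) ∂μ ≤ ∫ ω, (1 + t * Y ω + t ^ 2 * W ω) ∂μ :=
          integral_mono hint hquad hexp
      _ = 1 + t * m + t ^ 2 * ∫ ω, W ω ∂μ := by
          rw [integral_add hlin (hW.const_mul _),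
            integral_add (integrable_const 1) (hY.const_mul t), integral_const_mul,
            integral_const_mul]
          simp [m]
      _ ≤ t * m + t ^ 2 * G + 1 := by linarith [mul_le_mul_of_nonneg_left hG (sq_nonneg t)]
      _ ≤ Real.exp (t * m + t ^ 2 * G) := Real.add_one_le_exp _
  have hsplit (ω : Ω) :
      Real.exp (t * (Y ω - m)) = Real.exp (-(t * m)) * Real.exp (t * Y ω) := by
    rw [← Real.exp_add]
    ring_nf
  simp_rw [hsplit]
  refine ⟨hint.const_mul _, ?_⟩
  calc ∫ ω, Real.exp (-(t * m)) * Real.exp (t * Y ω) ∂μ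
      ≤ Real.exp (-(t * m)) * Real.exp (t * m + t ^ 2 * G) := by
        rw [integral_const_mul]
        gcongr
    _ = Real.exp (t ^ 2 * G) := by
        rw [← Real.exp_add]
        ring_nf

lemma integral_exp_mul_centered_le_of_weighted {Y : Ω → ℝ} (hm : Measurable Y) {t G : ℝ}
    (hG : 0 ≤ G)
    (h : ∫⁻ ω, ENNReal.ofReal (Y ω ^ 2 * Real.exp (|t| * |Y ω|)) ∂μ ≤ ENNReal.ofReal G) :
    Integrable (fun ω => Real.exp (t * (Y ω - ∫ ω, Y ω ∂μ))) μ ∧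
    ∫ ω, Real.exp (t * (Y ω - ∫ ω, Y ω ∂μ)) ∂μ ≤ Real.exp (t ^ 2 * G) := by
  have hpos (ω : Ω) : 0 ≤ Y ω ^ 2 * Real.exp (|t| * |Y ω|) := by positivity
  have hW := integrable_of_lintegral_ofReal_le (by fun_prop) hpos h
  have hsq : Integrable (fun ω => Y ω ^ 2) μ :=
    hW.mono' (by fun_prop) (ae_of_all _ fun ω => by
      rw [Real.norm_eq_abs, abs_of_nonneg (sq_nonneg _)]
      exact le_mul_of_one_le_right (sq_nonneg _) (Real.one_le_exp (by positivity)))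
  refine integral_exp_mul_centered_le hm (integrable_of_integrable_sq hm hsq) hW (fun ω => ?_)
    (integral_le_of_lintegral_ofReal_le (by fun_prop) hpos hG h)
  have := exp_le_one_add_add_sq_mul_exp_abs (t * Y ω)
  rw [abs_mul] at this
  linarith

variable {ι : Type*} [Fintype ι]

lemma measureReal_abs_sum_centered_ge_le {Y : ι → Ω → ℝ} (hind : iIndepFun Y μ)
    (hm : ∀ k, Measurable (Y k)) {t G : ℝ} (u : ℝ) (ht : 0 ≤ t) (hG : 0 ≤ G)
    (h : ∀ k, ∫⁻ ω, ENNReal.ofReal (Y k ω ^ 2 * Real.exp (t * |Y k ω|)) ∂μ ≤ ENNReal.ofReal G) :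
    μ.real {ω | Fintype.card ι * u ≤ |∑ k, (Y k ω - ∫ ω, Y k ω ∂μ)|}
      ≤ 2 * Real.exp (Fintype.card ι * (t ^ 2 * G - t * u)) := by
  have hmgf (k : ι) := integral_exp_mul_centered_le_of_weighted (hm k) (t := t) hG
    (by simpa only [abs_of_nonneg ht] using h k)
  have hmgf_neg (k : ι) := integral_exp_mul_centered_le_of_weighted (hm k) (t := -t) hG
    (by simpa only [abs_neg, abs_of_nonneg ht] using h k)
  simp only [neg_mul, ← mul_neg, neg_sq] at hmgf_neg
  have hupper := measureReal_sum_ge_le (Y := fun k ω => Y k ω - ∫ ω, Y k ω ∂μ)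
    (hind.comp (fun k y => y - ∫ ω, Y k ω ∂μ) fun k => by fun_prop)
    (fun k => by fun_prop) u ht (fun k => (hmgf k).1) (fun k => (hmgf k).2)
  have hlower := measureReal_sum_ge_le (Y := fun k ω => -(Y k ω - ∫ ω, Y k ω ∂μ))
    (hind.comp (fun k y => -(y - ∫ ω, Y k ω ∂μ)) fun k => by fun_prop)
    (fun k => by fun_prop) u ht (fun k => (hmgf_neg k).1) (fun k => (hmgf_neg k).2)
  simp only [Finset.sum_neg_distrib] at hlower
  calc μ.real {ω | Fintype.card ι * u ≤ |∑ k, (Y k ω - ∫ ω, Y k ω ∂μ)|}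
      = μ.real ({ω | Fintype.card ι * u ≤ ∑ k, (Y k ω - ∫ ω, Y k ω ∂μ)}
        ∪ {ω | Fintype.card ι * u ≤ -∑ k, (Y k ω - ∫ ω, Y k ω ∂μ)}) := by
        simp only [le_abs, Set.ofPred_or]
    _ ≤ _ := measureReal_union_le _ _
    _ ≤ _ := by linarith

lemma measureReal_sum_centered_le_le {X : ι → Ω → ℝ} (hind : iIndepFun X μ)
    (hm : ∀ k, Measurable (X k)) (hpos : ∀ k ω, 0 ≤ X k ω) {t G : ℝ} (u : ℝ) (ht : 0 ≤ t)
    (hG : 0 ≤ G) (h : ∀ k, ∫⁻ ω, ENNReal.ofReal (X k ω ^ 2) ∂μ ≤ ENNReal.ofReal G) :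
    μ.real {ω | ∑ k, (X k ω - ∫ ω, X k ω ∂μ) ≤ -(Fintype.card ι * u)}
      ≤ Real.exp (Fintype.card ι * (t ^ 2 * G - t * u)) := by
  have hsq (k : ι) : Integrable (fun ω => X k ω ^ 2) μ :=
    integrable_of_lintegral_ofReal_le (by fun_prop) (fun ω => sq_nonneg _) (h k)
  have hmgf (k : ι) := integral_exp_mul_centered_le (t := -t) (hm k)
    (integrable_of_integrable_sq (hm k) (hsq k)) (hsq k)
    (fun ω => (exp_neg_le_one_sub_add_sq (mul_nonneg ht (hpos k ω))).trans' (by simp) |>.trans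
      (by linarith [mul_pow t (X k ω) 2]))
    (integral_le_of_lintegral_ofReal_le (by fun_prop) (fun ω => sq_nonneg _) hG (h k))
  simp only [neg_mul, ← mul_neg, neg_sq] at hmgf
  have htail := measureReal_sum_ge_le (Y := fun k ω => -(X k ω - ∫ ω, X k ω ∂μ))
    (hind.comp (fun k y => -(y - ∫ ω, X k ω ∂μ)) fun k => by fun_prop)
    (fun k => by fun_prop) u ht (fun k => (hmgf k).1) (fun k => (hmgf k).2)
  simpa only [Finset.sum_neg_distrib, le_neg] using htail

lemma measureReal_sum_sq_ge_le {H : ι → Ω → ℝ} (hind : iIndepFun H μ)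
    (hm : ∀ k, Measurable (H k))
    (h : ∀ k, ∫⁻ ω, ENNReal.ofReal (Real.exp (H k ω ^ 2)) ∂μ ≤ 4) :
    μ.real {ω | Fintype.card ι * 3 ≤ ∑ k, H k ω ^ 2} ≤ Real.exp (-Fintype.card ι) := by
  replace h (k : ι) : ∫⁻ ω, ENNReal.ofReal (Real.exp (H k ω ^ 2)) ∂μ ≤ ENNReal.ofReal 4 := by
    simpa using h k
  have hexp_two : (4 : ℝ) ≤ Real.exp 2 := by
    have := Real.quadratic_le_exp_of_nonneg (x := 2) (by norm_num)
    norm_num at this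
    linarith
  have hint (k : ι) : Integrable (fun ω => Real.exp (H k ω ^ 2)) μ :=
    integrable_of_lintegral_ofReal_le (by fun_prop) (fun ω => (Real.exp_pos _).le) (h k)
  have hle (k : ι) : ∫ ω, Real.exp (H k ω ^ 2) ∂μ ≤ Real.exp 2 :=
    (integral_le_of_lintegral_ofReal_le (by fun_prop) (fun ω => (Real.exp_pos _).le)
      (by norm_num) (h k)).trans hexp_two
  have htail := measureReal_sum_ge_le (Y := fun k ω => H k ω ^ 2)
    (hind.comp (fun _ y => y ^ 2) fun _ => by fun_prop) (fun k => by fun_prop) 3 zero_le_one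
    (fun k => by simpa only [one_mul] using hint k) (fun k => by simpa only [one_mul] using hle k)
  exact htail.trans_eq (by norm_num)

end Concentration

section Norms

variable {d : ℕ}

lemma l1Norm_nonneg (v : Fin d → ℝ) : 0 ≤ l1Norm v := Finset.sum_nonneg fun _ _ => abs_nonneg _

lemma l1Norm_smul (c : ℝ) (v : Fin d → ℝ) : l1Norm (c • v) = |c| * l1Norm v := by
  simp only [l1Norm, Pi.smul_apply, smul_eq_mul, abs_mul, Finset.mul_sum]

lemma l1Norm_sub_le (u v : Fin d → ℝ) : l1Norm (u - v) ≤ l1Norm u + l1Norm v := by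
  simp only [l1Norm, ← Finset.sum_add_distrib]
  exact Finset.sum_le_sum fun i _ => abs_sub _ _

lemma l1Norm_eq_zero {v : Fin d → ℝ} : l1Norm v = 0 ↔ v = 0 := by
  rw [l1Norm, Finset.sum_eq_zero_iff_of_nonneg fun i _ => abs_nonneg (v i)]
  simp [funext_iff]

lemma dotProduct_le_mul_l1Norm {c : Fin d → ℝ} {L : ℝ} (hc : ∀ i, |c i| ≤ L) (v : Fin d → ℝ) :
    c ⬝ᵥ v ≤ L * l1Norm v := by
  rw [dotProduct, l1Norm, Finset.mul_sum]
  refine Finset.sum_le_sum fun i _ => ?_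
  calc c i * v i ≤ |c i| * |v i| := (le_abs_self _).trans_eq (abs_mul _ _)
    _ ≤ L * |v i| := by
      gcongr
      exact hc i

lemma sum_abs_le_sqrt_mul_l2Norm {S : Finset (Fin d)} {s : ℕ} (hS : S.card ≤ s) (v : Fin d → ℝ) :
    ∑ i ∈ S, |v i| ≤ √s * l2Norm v := by
  refine abs_le_of_sq_le_sq' ?_ (mul_nonneg (Real.sqrt_nonneg _) (l2Norm_nonneg v)) |>.2
  calc (∑ i ∈ S, |v i|) ^ 2 ≤ S.card * ∑ i ∈ S, |v i| ^ 2 := sq_sum_le_card_mul_sum_sq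
    _ ≤ s * ∑ i, |v i| ^ 2 := by
        gcongr
        exact Finset.subset_univ S
    _ = (√s * l2Norm v) ^ 2 := by
        rw [mul_pow, Real.sq_sqrt (Nat.cast_nonneg s), l2Norm_sq]
        simp only [sq_abs, dotProduct, ← sq]

lemma l1Norm_le_sqrt_mul_l2Norm {s : ℕ} {v : Fin d → ℝ} (hv : IsSparse s v) :
    l1Norm v ≤ √s * l2Norm v := by
  refine le_of_eq_of_le ?_ (sum_abs_le_sqrt_mul_l2Norm hv v)
  exact (Finset.sum_filter_of_ne fun i _ h => by simpa using h).symm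

end Norms

section Maurey

variable {d : ℕ}

/-- The extreme points `± eⱼ` of the `ℓ₁` ball, the sign being `+` for `true`. -/
def signedBasis (p : Fin d × Bool) : Fin d → ℝ := Pi.single p.1 (if p.2 then 1 else -1)

lemma sum_abs_smul_signedBasis (v : Fin d → ℝ) :
    ∑ j, |v j| • signedBasis (j, decide (0 ≤ v j)) = v := by
  ext i
  simp only [Finset.sum_apply, Pi.smul_apply, signedBasis, smul_eq_mul]
  rw [Finset.sum_eq_single i (fun j _ hj => by rw [Pi.single_eq_of_ne hj.symm, mul_zero])
    (by simp), Pi.single_eq_same]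
  rcases le_or_gt 0 (v i) with h | h
  · simp [h, abs_of_nonneg h]
  · simp [h.not_ge, abs_of_neg h]

lemma signedBasis_dotProduct_mulVec (B : Matrix (Fin d) (Fin d) ℝ) (p : Fin d × Bool) :
    signedBasis p ⬝ᵥ B *ᵥ signedBasis p = B p.1 p.1 := by
  rcases p with ⟨j, b⟩
  cases b <;> simp [signedBasis, Matrix.mulVec_single]

lemma sum_abs_mul_quadraticForm_add_signedBasis (B : Matrix (Fin d) (Fin d) ℝ) {v : Fin d → ℝ}
    (hv : l1Norm v = 1) (w : Fin d → ℝ) :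
    ∑ j, |v j| * ((w + signedBasis (j, decide (0 ≤ v j))) ⬝ᵥ
        B *ᵥ (w + signedBasis (j, decide (0 ≤ v j))))
      = (w + v) ⬝ᵥ B *ᵥ (w + v) - v ⬝ᵥ B *ᵥ v + ∑ j, |v j| * B j j := by
  set e : Fin d → Fin d → ℝ := fun j => signedBasis (j, decide (0 ≤ v j))
  have hsum : ∑ j, |v j| • e j = v := sum_abs_smul_signedBasis v
  have hexpand (j : Fin d) : |v j| * ((w + e j) ⬝ᵥ B *ᵥ (w + e j))
      = |v j| * (w ⬝ᵥ B *ᵥ w) + w ⬝ᵥ B *ᵥ (|v j| • e j) + (|v j| • e j) ⬝ᵥ B *ᵥ w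
        + |v j| * B j j := by
    rw [← signedBasis_dotProduct_mulVec B (j, decide (0 ≤ v j))]
    simp only [Matrix.mulVec_add, Matrix.mulVec_smul, dotProduct_add, add_dotProduct,
      dotProduct_smul, smul_dotProduct, smul_eq_mul, e]
    ring
  calc ∑ j, |v j| * ((w + e j) ⬝ᵥ B *ᵥ (w + e j))
      = l1Norm v * (w ⬝ᵥ B *ᵥ w) + w ⬝ᵥ B *ᵥ (∑ j, |v j| • e j)
          + (∑ j, |v j| • e j) ⬝ᵥ B *ᵥ w + ∑ j, |v j| * B j j := by
        simp only [hexpand, Finset.sum_add_distrib, ← Finset.sum_mul, ← dotProduct_sum,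
          ← sum_dotProduct, ← Matrix.mulVec_sum, l1Norm]
    _ = (w + v) ⬝ᵥ B *ᵥ (w + v) - v ⬝ᵥ B *ᵥ v + ∑ j, |v j| * B j j := by
        simp only [hsum, hv, Matrix.mulVec_add, dotProduct_add, add_dotProduct]
        ring

/-- Maurey's empirical method: average over `m` independent random signed basis vectors with
mean `v`, one at a time. -/
lemma quadraticForm_add_smul_nonneg (B : Matrix (Fin d) (Fin d) ℝ) {v : Fin d → ℝ}
    (hv : l1Norm v = 1) {T : ℝ} (hT : ∀ i, B i i ≤ T) {m : ℕ} {u : Fin d → ℝ}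
    (h : ∀ J : Fin m → Fin d × Bool,
      0 ≤ (u + ∑ i, signedBasis (J i)) ⬝ᵥ B *ᵥ (u + ∑ i, signedBasis (J i))) :
    0 ≤ (u + (m : ℝ) • v) ⬝ᵥ B *ᵥ (u + (m : ℝ) • v) + m * (T - v ⬝ᵥ B *ᵥ v) := by
  induction m generalizing u with
  | zero => simpa using h Fin.elim0
  | succ m ih =>
    set w := u + (m : ℝ) • v with hw
    set e : Fin d → Fin d → ℝ := fun j => signedBasis (j, decide (0 ≤ v j)) with he
    have hstep (j : Fin d) : 0 ≤ (w + e j) ⬝ᵥ B *ᵥ (w + e j) + m * (T - v ⬝ᵥ B *ᵥ v) := by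
      have hj := ih (u := u + e j) fun J => by
        simpa [Fin.sum_univ_succ, add_assoc, he] using h (Fin.cons (j, decide (0 ≤ v j)) J)
      rwa [add_right_comm, ← hw] at hj
    have hdiag : ∑ j, |v j| * B j j ≤ T :=
      calc ∑ j, |v j| * B j j ≤ ∑ j, |v j| * T := by
            gcongr with j
            exact hT j
        _ = l1Norm v * T := (Finset.sum_mul _ _ _).symm
        _ = T := by rw [hv, one_mul]
    have haverage : 0 ≤ ∑ j, |v j| * ((w + e j) ⬝ᵥ B *ᵥ (w + e j) + m * (T - v ⬝ᵥ B *ᵥ v)) :=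
      Finset.sum_nonneg fun j _ => mul_nonneg (abs_nonneg _) (hstep j)
    simp only [mul_add, Finset.sum_add_distrib, ← Finset.sum_mul] at haverage
    rw [sum_abs_mul_quadraticForm_add_signedBasis B hv, ← l1Norm, hv, one_mul] at haverage
    rw [show u + ((m + 1 : ℕ) : ℝ) • v = w + v by
      rw [hw, Nat.cast_succ, add_smul, one_smul, add_assoc]]
    push_cast
    linarith

lemma sub_one_mul_quadraticForm_add_nonneg (B : Matrix (Fin d) (Fin d) ℝ) {T : ℝ}
    (hT : ∀ i, B i i ≤ T) {m : ℕ} (hm : 0 < m)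
    (h : ∀ J : Fin m → Fin d × Bool,
      0 ≤ (∑ i, signedBasis (J i)) ⬝ᵥ B *ᵥ ∑ i, signedBasis (J i)) (v : Fin d → ℝ) :
    0 ≤ (m - 1) * (v ⬝ᵥ B *ᵥ v) + T * l1Norm v ^ 2 := by
  rcases (l1Norm_nonneg v).eq_or_lt' with hN | hN
  · rw [l1Norm_eq_zero.1 hN]
    simp [l1Norm]
  have hunit : l1Norm ((l1Norm v)⁻¹ • v) = 1 := by
    rw [l1Norm_smul, abs_of_pos (inv_pos.2 hN), inv_mul_cancel₀ hN.ne']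
  have hquad (c : ℝ) : (c • v) ⬝ᵥ B *ᵥ (c • v) = c ^ 2 * (v ⬝ᵥ B *ᵥ v) := by
    rw [Matrix.mulVec_smul, dotProduct_smul, smul_dotProduct, smul_eq_mul, smul_eq_mul]
    ring
  have hmaurey := quadraticForm_add_smul_nonneg B hunit hT (u := 0) (m := m) (by simpa using h)
  rw [zero_add, smul_smul, hquad, hquad] at hmaurey
  have : (0 : ℝ) < m := by exact_mod_cast hm
  have hscale : 0 ≤ (m : ℝ) * (l1Norm v ^ 2)⁻¹
      * ((m - 1) * (v ⬝ᵥ B *ᵥ v) + T * l1Norm v ^ 2) := by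
    convert hmaurey using 1
    field_simp
    ring
  exact (mul_nonneg_iff_of_pos_left (by positivity)).1 hscale

lemma restricted_strong_convexity (Q : Matrix (Fin d) (Fin d) ℝ) {κ T : ℝ} (hκ : 0 ≤ κ)
    (hT : ∀ i, Q i i ≤ T) {m : ℕ} (hm : 1 < m)
    (h : ∀ J : Fin m → Fin d × Bool, κ * ((∑ i, signedBasis (J i)) ⬝ᵥ ∑ i, signedBasis (J i))
      ≤ (∑ i, signedBasis (J i)) ⬝ᵥ Q *ᵥ ∑ i, signedBasis (J i)) (v : Fin d → ℝ) :
    κ * (v ⬝ᵥ v) - T / (m - 1) * l1Norm v ^ 2 ≤ v ⬝ᵥ Q *ᵥ v := by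
  set B : Matrix (Fin d) (Fin d) ℝ := Q - κ • 1
  have hform (w : Fin d → ℝ) : w ⬝ᵥ B *ᵥ w = w ⬝ᵥ Q *ᵥ w - κ * (w ⬝ᵥ w) := by
    rw [Matrix.sub_mulVec, dotProduct_sub, Matrix.smul_mulVec, Matrix.one_mulVec, dotProduct_smul,
      smul_eq_mul]
  have hdiag (i : Fin d) : B i i ≤ T := by
    simp only [B, Matrix.sub_apply, Matrix.smul_apply, Matrix.one_apply_eq, smul_eq_mul]
    linarith [hT i]
  have hmaurey := sub_one_mul_quadraticForm_add_nonneg B hdiag (zero_lt_one.trans hm)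
    (fun J => by rw [hform]; linarith [h J]) v
  have hm' : (0 : ℝ) < m - 1 := sub_pos.2 (by exact_mod_cast hm)
  have hdiv : 0 ≤ ((m - 1) * (v ⬝ᵥ B *ᵥ v) + T * l1Norm v ^ 2) / (m - 1) := by positivity
  rw [add_div, mul_div_cancel_left₀ _ hm'.ne', hform, mul_div_right_comm] at hdiv
  linarith

end Maurey

section Stationary

variable {d : ℕ} {Q : Matrix (Fin d) (Fin d) ℝ} {b θ θs : Fin d → ℝ} {lam r : ℝ}

lemma quadraticForm_sub_le_of_isStationary (hlam : 0 ≤ lam) (hθ : IsStationary Q b lam r θ)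
    (hr : l1Norm θs ≤ r) :
    (θ - θs) ⬝ᵥ Q *ᵥ (θ - θs)
      ≤ (b - Q *ᵥ θs) ⬝ᵥ (θ - θs) + lam * (l1Norm θs - l1Norm θ) := by
  obtain ⟨-, g, hg, hst⟩ := hθ
  have hvar := hst θs hr
  have hsubgrad := mul_le_mul_of_nonneg_left (hg θs) hlam
  have hsplit : (Q *ᵥ θ - b + lam • g) ⬝ᵥ (θs - θ)
      = (b - Q *ᵥ θs) ⬝ᵥ (θ - θs) - (θ - θs) ⬝ᵥ Q *ᵥ (θ - θs) + lam * (g ⬝ᵥ (θs - θ)) := by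
    rw [← neg_sub θ θs, dotProduct_comm (θ - θs), Matrix.mulVec_sub]
    simp only [add_dotProduct, sub_dotProduct, smul_dotProduct, smul_eq_mul, dotProduct_neg]
    ring
  linarith

lemma l1Norm_sub_l1Norm_le {S : Finset (Fin d)} (hS : ∀ i ∉ S, θs i = 0) (θ : Fin d → ℝ) :
    l1Norm θs - l1Norm θ ≤ ∑ i ∈ S, |(θ - θs) i| - ∑ i ∈ Sᶜ, |(θ - θs) i| := by
  have hon : ∑ i ∈ S, (|θs i| - |θ i|) ≤ ∑ i ∈ S, |(θ - θs) i| :=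
    Finset.sum_le_sum fun i _ => by
      rw [Pi.sub_apply, abs_sub_comm]
      exact abs_sub_abs_le_abs_sub _ _
  have hoff : ∑ i ∈ Sᶜ, (|θs i| - |θ i|) = -∑ i ∈ Sᶜ, |(θ - θs) i| := by
    rw [← Finset.sum_neg_distrib]
    refine Finset.sum_congr rfl fun i hi => ?_
    simp [hS i (Finset.mem_compl.1 hi)]
  calc l1Norm θs - l1Norm θ
      = ∑ i ∈ S, (|θs i| - |θ i|) + ∑ i ∈ Sᶜ, (|θs i| - |θ i|) := by
        rw [Finset.sum_add_sum_compl, Finset.sum_sub_distrib, l1Norm, l1Norm]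
    _ ≤ _ := by linarith

/-- If the restricted strong convexity deficit is at most `lam / 4` times the `ℓ₁` norm, the error
lies in the cone `A' ≤ 7 A`, where `A` and `A'` are its `ℓ₁` norms on and off the support. -/
lemma isStationary_cone_inequality {S : Finset (Fin d)} {κ η : ℝ} (hlam : 0 ≤ lam)
    (hη : 0 ≤ η) (hθ : IsStationary Q b lam r θ) (hS : ∀ i ∉ S, θs i = 0) (hr : l1Norm θs ≤ r)
    (hgrad : ∀ i, |(b - Q *ᵥ θs) i| ≤ lam / 2) (hηr : η * (2 * r) ≤ lam / 4)
    (hrsc : ∀ v, κ * (v ⬝ᵥ v) - η * l1Norm v ^ 2 ≤ v ⬝ᵥ Q *ᵥ v) :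
    4 * κ * l2Norm (θ - θs) ^ 2
      ≤ lam * (7 * ∑ i ∈ S, |(θ - θs) i| - ∑ i ∈ Sᶜ, |(θ - θs) i|) := by
  have hsplit : l1Norm (θ - θs) = ∑ i ∈ S, |(θ - θs) i| + ∑ i ∈ Sᶜ, |(θ - θs) i| :=
    (Finset.sum_add_sum_compl S _).symm
  have hdiam : l1Norm (θ - θs) ≤ 2 * r := by linarith [l1Norm_sub_le θ θs, hθ.1]
  have hdeficit : η * l1Norm (θ - θs) ^ 2
      ≤ lam / 4 * (∑ i ∈ S, |(θ - θs) i| + ∑ i ∈ Sᶜ, |(θ - θs) i|) :=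
    calc η * l1Norm (θ - θs) ^ 2 = η * l1Norm (θ - θs) * l1Norm (θ - θs) := by ring
      _ ≤ lam / 4 * l1Norm (θ - θs) := by
        gcongr
        · exact l1Norm_nonneg _
        · exact (mul_le_mul_of_nonneg_left hdiam hη).trans hηr
      _ = lam / 4 * (∑ i ∈ S, |(θ - θs) i| + ∑ i ∈ Sᶜ, |(θ - θs) i|) := by rw [hsplit]
  have hbasic := quadraticForm_sub_le_of_isStationary hlam hθ hr
  have hcorr := dotProduct_le_mul_l1Norm hgrad (θ - θs)
  have hsupport := mul_le_mul_of_nonneg_left (l1Norm_sub_l1Norm_le hS θ) hlam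
  have hconvex := hrsc (θ - θs)
  rw [← l2Norm_sq] at hconvex
  rw [hsplit] at hcorr
  linarith

lemma stationary_error_bound {κ η : ℝ} {s : ℕ} (hlam : 0 < lam) (hκ : 0 < κ) (hη : 0 ≤ η)
    (hθ : IsStationary Q b lam r θ) (hs : IsSparse s θs) (hr : l1Norm θs ≤ r)
    (hgrad : ∀ i, |(b - Q *ᵥ θs) i| ≤ lam / 2) (hηr : η * (2 * r) ≤ lam / 4)
    (hrsc : ∀ v, κ * (v ⬝ᵥ v) - η * l1Norm v ^ 2 ≤ v ⬝ᵥ Q *ᵥ v) :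
    l2Norm (θ - θs) ≤ 7 / 4 * (lam / κ) * √s ∧ l1Norm (θ - θs) ≤ 14 * (lam / κ) * s := by
  set S := Finset.univ.filter fun i => θs i ≠ 0
  have hcone := isStationary_cone_inequality (S := S) hlam.le hη hθ
    (fun i hi => by simpa [S] using hi) hr hgrad hηr hrsc
  have hsplit : l1Norm (θ - θs) = ∑ i ∈ S, |(θ - θs) i| + ∑ i ∈ Sᶜ, |(θ - θs) i| :=
    (Finset.sum_add_sum_compl S _).symm
  have hcauchy := sum_abs_le_sqrt_mul_l2Norm hs (θ - θs)
  set A := ∑ i ∈ S, |(θ - θs) i|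
  set A' := ∑ i ∈ Sᶜ, |(θ - θs) i|
  set N := l2Norm (θ - θs)
  have hN : 0 ≤ N := l2Norm_nonneg _
  have hA' : 0 ≤ A' := Finset.sum_nonneg fun _ _ => abs_nonneg _
  have hcone' : A' ≤ 7 * A := by
    linarith [nonneg_of_mul_nonneg_right (le_trans (by positivity) hcone) hlam]
  have hl2 : N ≤ 7 / 4 * (lam / κ) * √s := by
    rcases hN.eq_or_lt with hN0 | hNpos
    · rw [← hN0]
      positivity
    · have hquad : N * (4 * κ * N) ≤ N * (lam * (7 * √s)) :=
        calc N * (4 * κ * N) = 4 * κ * N ^ 2 := by ring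
          _ ≤ lam * (7 * A - A') := hcone
          _ ≤ lam * (7 * (√s * N)) := by
            gcongr
            linarith
          _ = N * (lam * (7 * √s)) := by ring
      rw [show 7 / 4 * (lam / κ) * √s = lam * (7 * √s) / (4 * κ) by field_simp,
        le_div_iff₀' (by positivity)]
      exact le_of_mul_le_mul_left hquad hNpos
  refine ⟨hl2, ?_⟩
  calc l1Norm (θ - θs) ≤ 8 * (√s * N) := by linarith
    _ ≤ 8 * (√s * (7 / 4 * (lam / κ) * √s)) := by gcongr
    _ = 14 * (lam / κ) * s := by
      linear_combination 14 * (lam / κ) * Real.mul_self_sqrt (Nat.cast_nonneg (α := ℝ) s)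

end Stationary

section Truncation

lemma truncate_eq_max_min {ζ : ℝ} (hζ : 0 ≤ ζ) (a : ℝ) : truncate ζ a = max (-ζ) (min a ζ) := by
  unfold truncate
  rcases lt_trichotomy a 0 with h | rfl | h
  · rw [Real.sign_of_neg h, abs_of_neg h, min_eq_left (h.le.trans hζ), neg_one_mul,
      ← max_neg_neg, neg_neg, max_comm]
  · simp [hζ]
  · rw [Real.sign_of_pos h, abs_of_pos h, one_mul, max_eq_right]
    exact (neg_nonpos.2 hζ).trans (le_min h.le hζ)

lemma measurable_truncate {ζ : ℝ} (hζ : 0 ≤ ζ) : Measurable (truncate ζ) := by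
  rw [funext (truncate_eq_max_min hζ)]
  fun_prop

lemma abs_truncate_le {ζ : ℝ} (hζ : 0 ≤ ζ) (a : ℝ) : |truncate ζ a| ≤ ζ := by
  rw [truncate_eq_max_min hζ, abs_le]
  exact ⟨le_max_left _ _, max_le (by linarith) (min_le_right _ _)⟩

lemma abs_truncate_le_abs {ζ : ℝ} (hζ : 0 ≤ ζ) (a : ℝ) : |truncate ζ a| ≤ |a| := by
  have ha := abs_nonneg a
  rw [truncate_eq_max_min hζ, abs_le]
  exact ⟨le_max_of_le_right (le_min (neg_abs_le a) (by linarith)),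
    max_le (by linarith) (min_le_of_left_le (le_abs_self a))⟩

lemma truncate_eq_self {ζ a : ℝ} (h : |a| ≤ ζ) : truncate ζ a = a := by
  rw [truncate_eq_max_min ((abs_nonneg a).trans h), min_eq_left (le_of_abs_le h),
    max_eq_right (neg_le_of_abs_le h)]

lemma abs_truncate_sub_le {ζ l : ℝ} (hζ : 0 < ζ) (hl : 0 ≤ l) (a : ℝ) :
    |truncate ζ a - a| ≤ |a| * (|a| / ζ) ^ l := by
  rcases le_total |a| ζ with h | h
  · rw [truncate_eq_self h, sub_self, abs_zero]
    positivity
  · refine le_trans ?_ (le_mul_of_one_le_right (abs_nonneg a)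
      (Real.one_le_rpow ((one_le_div hζ).2 h) hl))
    rw [truncate_eq_max_min hζ.le]
    rcases le_total a 0 with ha | ha
    · rw [abs_of_nonpos ha] at h ⊢
      rw [min_eq_left (by linarith), max_eq_left (by linarith), abs_of_nonneg (by linarith)]
      linarith
    · rw [abs_of_nonneg ha] at h ⊢
      rw [min_eq_right h, max_eq_right (by linarith), abs_of_nonpos (by linarith)]
      linarith

lemma abs_quantizedResponse_le {Δ ζ y u : ℝ} (hΔ : 0 ≤ Δ) (hu : |u| ≤ Δ / 2) :
    |quantizedResponse Δ ζ y u| ≤ |truncate ζ y| + Δ :=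
  calc |quantizedResponse Δ ζ y u|
      ≤ |truncate ζ y| + |quantize Δ (truncate ζ y + u) - truncate ζ y| := by
        rw [quantizedResponse, ← sub_le_iff_le_add']
        exact abs_sub_abs_le_abs_sub _ _
    _ ≤ |truncate ζ y| + Δ := by
        gcongr
        linarith [abs_quantize_add_sub_le (a := truncate ζ y) (u := u) hΔ]

end Truncation

section PointwiseBounds

lemma sq_le_two_mul_exp {x : ℝ} (hx : 0 ≤ x) : x ^ 2 ≤ 2 * Real.exp x := by
  linarith [Real.quadratic_le_exp_of_nonneg hx]

lemma exp_two_mul_mul_le (a b : ℝ) :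
    Real.exp (2 * a * b) ≤ Real.exp (a ^ 2) * Real.exp (b ^ 2) := by
  rw [← Real.exp_add]
  exact Real.exp_le_exp.2 (two_mul_le_add_sq a b)

lemma mul_sq_mul_exp_le {p q t : ℝ} (ht : t ≤ 1 / 2) :
    (p * q) ^ 2 * Real.exp (t * |p * q|) ≤ 4 * (Real.exp (p ^ 2) + Real.exp (q ^ 2)) := by
  have hamgm : |p * q| ≤ p ^ 2 / 2 + q ^ 2 / 2 := by
    rw [abs_mul]
    linarith [two_mul_le_add_sq |p| |q|, sq_abs p, sq_abs q]
  have hsq (z : ℝ) : Real.exp (z ^ 2) = Real.exp (z ^ 2 / 2) ^ 2 := by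
    rw [← Real.exp_nat_mul]
    congr 1
    push_cast
    ring
  calc (p * q) ^ 2 * Real.exp (t * |p * q|)
      ≤ 8 * Real.exp (1 / 2 * |p * q|) * Real.exp (1 / 2 * |p * q|) := by
        gcongr
        have hquad := sq_le_two_mul_exp (x := 1 / 2 * |p * q|) (by positivity)
        rw [mul_pow, sq_abs] at hquad
        linarith
    _ = 8 * Real.exp |p * q| := by
        rw [mul_assoc, ← Real.exp_add]
        ring_nf
    _ ≤ 8 * (Real.exp (p ^ 2 / 2) * Real.exp (q ^ 2 / 2)) := by
        rw [← Real.exp_add]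
        gcongr
    _ ≤ 4 * (Real.exp (p ^ 2) + Real.exp (q ^ 2)) := by
        rw [hsq p, hsq q]
        linarith [two_mul_le_add_sq (Real.exp (p ^ 2 / 2)) (Real.exp (q ^ 2 / 2))]

lemma sq_mul_exp_abs_rpow_le {q : ℝ} (hq : 0 ≤ q) (h : ℝ) :
    (h ^ 2 * Real.exp |h|) ^ q ≤ 2 ^ q * Real.exp (q ^ 2) * Real.exp (h ^ 2) :=
  calc (h ^ 2 * Real.exp |h|) ^ q ≤ (2 * Real.exp (2 * |h|)) ^ q := by
        refine Real.rpow_le_rpow (by positivity) ?_ hq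
        calc h ^ 2 * Real.exp |h| ≤ 2 * Real.exp |h| * Real.exp |h| := by
              gcongr
              exact (sq_abs h).symm.trans_le (sq_le_two_mul_exp (abs_nonneg h))
          _ = 2 * Real.exp (2 * |h|) := by rw [mul_assoc, ← Real.exp_add, two_mul |h|]
    _ = 2 ^ q * Real.exp (2 * |h| * q) := by
        rw [Real.mul_rpow (by norm_num) (by positivity), ← Real.exp_mul]
    _ ≤ 2 ^ q * (Real.exp (|h| ^ 2) * Real.exp (q ^ 2)) := by
        gcongr
        exact exp_two_mul_mul_le |h| q
    _ = 2 ^ q * Real.exp (q ^ 2) * Real.exp (h ^ 2) := by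
        rw [sq_abs]
        ring

lemma mul_sq_mul_exp_le_rpow_add {l : ℝ} (hl : 1 < l) {g h t : ℝ} (ht : t * |g| ≤ 1) :
    (g * h) ^ 2 * Real.exp (t * |g * h|) ≤ |g| ^ (2 * l)
      + 2 ^ (l / (l - 1)) * Real.exp ((l / (l - 1)) ^ 2) * Real.exp (h ^ 2) := by
  have hconj := Real.HolderConjugate.conjExponent hl
  have hyoung := Real.young_inequality_of_nonneg (a := g ^ 2) (b := h ^ 2 * Real.exp |h|)
    (sq_nonneg _) (by positivity) hconj
  have hexp : t * |g * h| ≤ |h| := by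
    rw [abs_mul, ← mul_assoc]
    exact mul_le_of_le_one_left (abs_nonneg _) ht
  calc (g * h) ^ 2 * Real.exp (t * |g * h|)
      ≤ (g * h) ^ 2 * Real.exp |h| := by gcongr
    _ = g ^ 2 * (h ^ 2 * Real.exp |h|) := by ring
    _ ≤ (g ^ 2) ^ l + (h ^ 2 * Real.exp |h|) ^ (l / (l - 1)) :=
        hyoung.trans (add_le_add (div_le_self (by positivity) hl.le)
          (div_le_self (by positivity) hconj.symm.lt.le))
    _ ≤ _ := by
        gcongr
        · rw [← sq_abs, Real.rpow_mul (abs_nonneg _), Real.rpow_two]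
        · exact sq_mul_exp_abs_rpow_le hconj.symm.nonneg h

lemma mul_rpow_mul_le_rpow_add_rpow {l : ℝ} (hl : 1 < l) {y h : ℝ} (hy : 0 ≤ y) (hh : 0 ≤ h) :
    y * y ^ l * h ≤ y ^ (2 * l) + h ^ (2 * l / (l - 1)) := by
  have : 0 < l - 1 := sub_pos.2 hl
  have hconj : (2 * l / (l + 1)).HolderConjugate (2 * l / (l - 1)) := by
    rw [Real.holderConjugate_iff]
    constructor
    · rw [one_lt_div (by positivity)]
      linarith
    · field_simp
      ring
  have hpow : (y ^ (l + 1)) ^ (2 * l / (l + 1)) = y ^ (2 * l) := by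
    rw [← Real.rpow_mul hy]
    congr 1
    field_simp
  calc y * y ^ l * h = y ^ (l + 1) * h := by
        rw [Real.rpow_add_one' hy (by positivity), mul_comm y]
    _ ≤ (y ^ (l + 1)) ^ (2 * l / (l + 1)) + h ^ (2 * l / (l - 1)) :=
        (Real.young_inequality_of_nonneg (by positivity) hh hconj).trans
          (add_le_add (div_le_self (by positivity) hconj.lt.le)
            (div_le_self (by positivity) hconj.symm.lt.le))
    _ = y ^ (2 * l) + h ^ (2 * l / (l - 1)) := by rw [hpow]

lemma rpow_le_exp_sq_mul_exp_sq {p h : ℝ} (hp : 0 ≤ p) (hh : 0 ≤ h) :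
    h ^ p ≤ Real.exp (p ^ 2) * Real.exp (h ^ 2) :=
  calc h ^ p ≤ Real.exp h ^ p := by
        gcongr
        linarith [Real.add_one_le_exp h]
    _ = Real.exp (p * h) := by rw [← Real.exp_mul, mul_comm]
    _ ≤ Real.exp (2 * p * h) := by
        gcongr
        linarith
    _ ≤ Real.exp (p ^ 2) * Real.exp (h ^ 2) := exp_two_mul_mul_le p h

end PointwiseBounds

section Moments

variable {Ω : Type*} [MeasurableSpace Ω] {μ : Measure Ω}

lemma lintegral_ofReal_const_mul_le {f : Ω → ℝ} {c B : ℝ} (hc : 0 ≤ c)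
    (h : ∫⁻ ω, ENNReal.ofReal (f ω) ∂μ ≤ ENNReal.ofReal B) :
    ∫⁻ ω, ENNReal.ofReal (c * f ω) ∂μ ≤ ENNReal.ofReal (c * B) := by
  simp only [ENNReal.ofReal_mul hc]
  rw [lintegral_const_mul' _ _ ENNReal.ofReal_ne_top]
  gcongr

lemma lintegral_ofReal_le_of_ae_le_add {f g h : Ω → ℝ} (hg : Measurable g) {A B : ℝ}
    (hA : 0 ≤ A) (hB : 0 ≤ B) (hf : ∀ᵐ ω ∂μ, f ω ≤ g ω + h ω)
    (hgA : ∫⁻ ω, ENNReal.ofReal (g ω) ∂μ ≤ ENNReal.ofReal A)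
    (hhB : ∫⁻ ω, ENNReal.ofReal (h ω) ∂μ ≤ ENNReal.ofReal B) :
    ∫⁻ ω, ENNReal.ofReal (f ω) ∂μ ≤ ENNReal.ofReal (A + B) :=
  calc ∫⁻ ω, ENNReal.ofReal (f ω) ∂μ
      ≤ ∫⁻ ω, (ENNReal.ofReal (g ω) + ENNReal.ofReal (h ω)) ∂μ :=
        lintegral_mono_ae <| hf.mono fun _ hω =>
          (ENNReal.ofReal_le_ofReal hω).trans ENNReal.ofReal_add_le
    _ = ∫⁻ ω, ENNReal.ofReal (g ω) ∂μ + ∫⁻ ω, ENNReal.ofReal (h ω) ∂μ :=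
        lintegral_add_left hg.ennreal_ofReal _
    _ ≤ ENNReal.ofReal A + ENNReal.ofReal B := add_le_add hgA hhB
    _ = ENNReal.ofReal (A + B) := (ENNReal.ofReal_add hA hB).symm

lemma lintegral_mul_sq_mul_exp_le {p q : Ω → ℝ} (hp : Measurable p)
    (hp_exp : ∫⁻ ω, ENNReal.ofReal (Real.exp (p ω ^ 2)) ∂μ ≤ 4)
    (hq_exp : ∫⁻ ω, ENNReal.ofReal (Real.exp (q ω ^ 2)) ∂μ ≤ 4) {t : ℝ} (ht : t ≤ 1 / 2) :
    ∫⁻ ω, ENNReal.ofReal ((p ω * q ω) ^ 2 * Real.exp (t * |p ω * q ω|)) ∂μ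
      ≤ ENNReal.ofReal 32 := by
  rw [show (32 : ℝ) = 4 * 4 + 4 * 4 by norm_num]
  refine lintegral_ofReal_le_of_ae_le_add (g := fun ω => 4 * Real.exp (p ω ^ 2))
    (h := fun ω => 4 * Real.exp (q ω ^ 2)) (by fun_prop) (by norm_num) (by norm_num)
    (ae_of_all _ fun _ => (mul_sq_mul_exp_le ht).trans_eq (mul_add _ _ _))
    (lintegral_ofReal_const_mul_le (by norm_num) (by simpa using hp_exp))
    (lintegral_ofReal_const_mul_le (by norm_num) (by simpa using hq_exp))

/-- The constant in the Bernstein bound for the product of a variable with `2 l` moments and a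
sub-Gaussian variable. -/
def momentConst (l : ℝ) : ℝ :=
  2 + 2 ^ (l / (l - 1)) * Real.exp ((l / (l - 1)) ^ 2) * 4

lemma momentConst_nonneg (l : ℝ) : 0 ≤ momentConst l := by
  unfold momentConst
  positivity

lemma lintegral_mul_sq_mul_exp_le_momentConst {l : ℝ} (hl : 1 < l) {g h : Ω → ℝ}
    (hg : Measurable g) (hg_moment : ∫⁻ ω, ENNReal.ofReal (|g ω| ^ (2 * l)) ∂μ ≤ 2)
    (hh_exp : ∫⁻ ω, ENNReal.ofReal (Real.exp (h ω ^ 2)) ∂μ ≤ 4) {t : ℝ}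
    (ht : ∀ᵐ ω ∂μ, t * |g ω| ≤ 1) :
    ∫⁻ ω, ENNReal.ofReal ((g ω * h ω) ^ 2 * Real.exp (t * |g ω * h ω|)) ∂μ
      ≤ ENNReal.ofReal (momentConst l) :=
  lintegral_ofReal_le_of_ae_le_add (by fun_prop) (by norm_num) (by positivity)
    (ht.mono fun ω hω => mul_sq_mul_exp_le_rpow_add hl hω) (by simpa using hg_moment)
    (lintegral_ofReal_const_mul_le (by positivity) (by simpa using hh_exp))

lemma lintegral_sq_sq_le {p : Ω → ℝ} {c : ℝ} (hc : 0 < c)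
    (h : ∫⁻ ω, ENNReal.ofReal (Real.exp (p ω ^ 2 / c)) ∂μ ≤ 4) :
    ∫⁻ ω, ENNReal.ofReal ((p ω ^ 2) ^ 2) ∂μ ≤ ENNReal.ofReal (2 * c ^ 2 * 4) := by
  refine (lintegral_mono fun ω => ENNReal.ofReal_le_ofReal ?_).trans
    (lintegral_ofReal_const_mul_le (by positivity) (by simpa using h))
  have hquad := sq_le_two_mul_exp (x := p ω ^ 2 / c) (by positivity)
  rw [div_pow, div_le_iff₀ (by positivity)] at hquad
  linarith

lemma memLp_two_of_lintegral_exp_sq_div_le {p : Ω → ℝ} (hp : Measurable p) {c : ℝ} (hc : 0 < c)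
    (h : ∫⁻ ω, ENNReal.ofReal (Real.exp (p ω ^ 2 / c)) ∂μ ≤ 4) : MemLp p 2 μ := by
  have hle : ∀ ω, p ω ^ 2 ≤ c * Real.exp (p ω ^ 2 / c) := fun ω =>
    calc p ω ^ 2 = c * (p ω ^ 2 / c) := (mul_div_cancel₀ _ hc.ne').symm
      _ ≤ c * Real.exp (p ω ^ 2 / c) := by
        gcongr
        linarith [Real.add_one_le_exp (p ω ^ 2 / c)]
  exact (memLp_two_iff_integrable_sq hp.aestronglyMeasurable).2 <|
    integrable_of_lintegral_ofReal_le (by fun_prop) (fun _ => sq_nonneg _)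
      ((lintegral_mono fun ω => ENNReal.ofReal_le_ofReal (hle ω)).trans
        (lintegral_ofReal_const_mul_le hc.le (B := 4) (by simpa using h)))

end Moments

section Independence

variable {Ω S T : Type*} [MeasurableSpace Ω] [MeasurableSpace S] [MeasurableSpace T]
  {μ : Measure Ω} [IsProbabilityMeasure μ] {p : Ω → S} {q : Ω → T}

lemma lintegral_comp_prod_of_indepFun (hp : Measurable p) (hq : Measurable q)
    (h : IndepFun p q μ) {F : S × T → ℝ≥0∞} (hF : Measurable F) :
    ∫⁻ ω, F (p ω, q ω) ∂μ = ∫⁻ ω, ∫⁻ t, F (p ω, t) ∂(μ.map q) ∂μ := by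
  have := Measure.isProbabilityMeasure_map (μ := μ) hq.aemeasurable
  have hmap := (indepFun_iff_map_prod_eq_prod_map_map hp.aemeasurable hq.aemeasurable).1 h
  rw [← lintegral_map hF (hp.prodMk hq), hmap, lintegral_prod _ hF.aemeasurable,
    lintegral_map (by fun_prop) hp]

lemma integral_comp_prod_of_indepFun (hp : Measurable p) (hq : Measurable q)
    (h : IndepFun p q μ) {F : S × T → ℝ} (hF : Measurable F)
    (hint : Integrable (fun ω => F (p ω, q ω)) μ) :
    ∫ ω, F (p ω, q ω) ∂μ = ∫ ω, ∫ t, F (p ω, t) ∂(μ.map q) ∂μ := by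
  have := Measure.isProbabilityMeasure_map (μ := μ) hq.aemeasurable
  have hmap := (indepFun_iff_map_prod_eq_prod_map_map hp.aemeasurable hq.aemeasurable).1 h
  have hprod : Integrable F ((μ.map p).prod (μ.map q)) := by
    rw [← hmap]
    exact (integrable_map_measure hF.aestronglyMeasurable (by fun_prop)).2 hint
  have hinner : StronglyMeasurable fun s => ∫ t, F (s, t) ∂(μ.map q) :=
    hF.stronglyMeasurable.integral_prod_right'
  rw [← integral_map (hp.prodMk hq).aemeasurable hF.aestronglyMeasurable, hmap,
    integral_prod _ hprod, integral_map hp.aemeasurable hinner.aestronglyMeasurable]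

end Independence

section SecondMoment

variable {Ω : Type*} [MeasurableSpace Ω] {μ : Measure Ω} {d : ℕ}

lemma integrable_mul_of_memLp_two {f g : Ω → ℝ} (hf : MemLp f 2 μ) (hg : MemLp g 2 μ) :
    Integrable (fun ω => f ω * g ω) μ :=
  hf.integrable_mul hg

section MemLp

variable {X : Ω → Fin d → ℝ} (hX : ∀ i, MemLp (fun ω => X ω i) 2 μ)

include hX

lemma memLp_dotProduct (v : Fin d → ℝ) : MemLp (fun ω => v ⬝ᵥ X ω) 2 μ :=
  memLp_finsetSum _ fun i _ => (hX i).const_mul (v i)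

lemma integral_mul_dotProduct {y : Ω → ℝ} (hy : MemLp y 2 μ) (v : Fin d → ℝ) :
    ∫ ω, y ω * (v ⬝ᵥ X ω) ∂μ = v ⬝ᵥ fun i => ∫ ω, y ω * X ω i ∂μ := by
  have hint : ∀ i, Integrable (fun ω => y ω * (v i * X ω i)) μ := fun i =>
    hy.integrable_mul ((hX i).const_mul (v i))
  simp only [dotProduct, Finset.mul_sum]
  rw [integral_finsetSum _ fun i _ => hint i]
  simp only [mul_left_comm (y _), integral_const_mul]

lemma integral_apply_mul_dotProduct (v : Fin d → ℝ) (i : Fin d) :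
    ∫ ω, X ω i * (v ⬝ᵥ X ω) ∂μ = (secondMoment μ X *ᵥ v) i := by
  rw [integral_mul_dotProduct hX (hX i), dotProduct_comm]
  rfl

lemma integral_dotProduct_sq (v : Fin d → ℝ) :
    ∫ ω, (v ⬝ᵥ X ω) ^ 2 ∂μ = v ⬝ᵥ secondMoment μ X *ᵥ v := by
  simp only [sq, integral_mul_dotProduct hX (memLp_dotProduct hX v), mul_comm]
  exact congrArg (v ⬝ᵥ ·) (funext (integral_apply_mul_dotProduct hX v))

end MemLp

section LinearModel

variable {x : Ω → Fin d → ℝ} {ε : Ω → ℝ} {θ : Fin d → ℝ}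
  (hx : ∀ i, MemLp (fun ω => x ω i) 2 μ) (hy : MemLp (response θ x ε) 2 μ)
  (hindep : IndepFun x ε μ) (hx0 : ∀ i, ∫ ω, x ω i ∂μ = 0)

include hx hy hindep hx0

lemma integral_response_mul_apply (i : Fin d) :
    ∫ ω, response θ x ε ω * x ω i ∂μ = (secondMoment μ x *ᵥ θ) i := by
  have hsignal := memLp_dotProduct hx θ
  have hnoise : MemLp ε 2 μ := by
    refine (hy.sub hsignal).ae_eq (ae_of_all _ fun ω => ?_)
    simp only [Pi.sub_apply, response, dotProduct_comm θ, add_sub_cancel_left]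
  have hnoise_mul : ∫ ω, ε ω * x ω i ∂μ = 0 := by
    have hind : IndepFun ε (fun ω => x ω i) μ :=
      (hindep.comp (measurable_pi_apply i) measurable_id).symm
    rw [hind.integral_fun_mul_eq_mul_integral hnoise.1 (hx i).1, hx0 i, mul_zero]
  calc ∫ ω, response θ x ε ω * x ω i ∂μ
      = ∫ ω, (x ω i * (θ ⬝ᵥ x ω) + ε ω * x ω i) ∂μ := by
        congr 1 with ω
        rw [response, dotProduct_comm]
        ring
    _ = (secondMoment μ x *ᵥ θ) i := by
        rw [integral_add (integrable_mul_of_memLp_two (hx i) hsignal)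
          (integrable_mul_of_memLp_two hnoise (hx i)), hnoise_mul, add_zero,
          integral_apply_mul_dotProduct hx]

lemma quadraticForm_secondMoment_le_integral_response_sq :
    θ ⬝ᵥ secondMoment μ x *ᵥ θ ≤ ∫ ω, response θ x ε ω ^ 2 ∂μ := by
  have hsignal := memLp_dotProduct hx θ
  have hcross : ∫ ω, response θ x ε ω * (θ ⬝ᵥ x ω) ∂μ = θ ⬝ᵥ secondMoment μ x *ᵥ θ := by
    simp only [integral_mul_dotProduct hx hy, integral_response_mul_apply hx hy hindep hx0]
  have hmul := (integrable_mul_of_memLp_two hy hsignal).const_mul 2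
  have hsub : Integrable
      (fun ω => response θ x ε ω ^ 2 - 2 * (response θ x ε ω * (θ ⬝ᵥ x ω))) μ :=
    hy.integrable_sq.sub hmul
  have hresidual : 0 ≤ ∫ ω, (response θ x ε ω - θ ⬝ᵥ x ω) ^ 2 ∂μ :=
    integral_nonneg fun ω => sq_nonneg _
  simp only [sub_sq, mul_assoc] at hresidual
  rw [integral_add hsub hsignal.integrable_sq, integral_sub hy.integrable_sq hmul,
    integral_const_mul, hcross, integral_dotProduct_sq hx] at hresidual
  linarith

end LinearModel

lemma isHermitian_secondMoment (X : Ω → Fin d → ℝ) : (secondMoment μ X).IsHermitian :=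
  Matrix.IsHermitian.ext fun i j => by simp [secondMoment, mul_comm]

end SecondMoment

lemma mul_dotProduct_self_le_of_le_spectrum {ι : Type*} [Fintype ι] [DecidableEq ι]
    {A : Matrix ι ι ℝ} (hA : A.IsHermitian) {κ : ℝ} (h : ∀ ev ∈ spectrum ℝ A, κ ≤ ev)
    (v : ι → ℝ) : κ * (v ⬝ᵥ v) ≤ v ⬝ᵥ A *ᵥ v := by
  have hpsd : (A - algebraMap ℝ (Matrix ι ι ℝ) κ).PosSemidef := by
    refine Matrix.posSemidef_iff_isHermitian_and_spectrum_nonneg.2 ⟨hA.sub ?_, fun ev hev => ?_⟩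
    · rw [Algebra.algebraMap_eq_smul_one]
      exact Matrix.isHermitian_one.smul (IsSelfAdjoint.all κ)
    · rw [← spectrum.sub_singleton_eq] at hev
      obtain ⟨a, ha, b, rfl, rfl⟩ := hev
      exact sub_nonneg.2 (h a ha)
  have hnonneg := hpsd.dotProduct_mulVec_nonneg v
  rw [Algebra.algebraMap_eq_smul_one, Matrix.sub_mulVec, dotProduct_sub, Matrix.smul_mulVec,
    Matrix.one_mulVec, dotProduct_smul, smul_eq_mul, star_trivial] at hnonneg
  linarith

/-- The random vector `q` is sub-Gaussian at scale `S`: `⟨v, q⟩` has a square-exponential moment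
at scale `S ‖v‖₂` in every direction `v`. The bound `4` makes room for a sum of two independent
vectors. -/
def HasSubgaussianScale {Ω : Type*} [MeasurableSpace Ω] {d : ℕ} (μ : Measure Ω) (S : ℝ)
    (q : Ω → Fin d → ℝ) : Prop :=
  ∀ v : Fin d → ℝ,
    ∫⁻ ω, ENNReal.ofReal (Real.exp ((v ⬝ᵥ q ω) ^ 2 / (S ^ 2 * (v ⬝ᵥ v)))) ∂μ ≤ 4

namespace HasSubgaussianScale

variable {Ω : Type*} [MeasurableSpace Ω] {d : ℕ} {μ : Measure Ω} {S : ℝ} {q : Ω → Fin d → ℝ}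

lemma lintegral_exp_dotProduct (h : HasSubgaussianScale μ S q) (v : Fin d → ℝ) :
    ∫⁻ ω, ENNReal.ofReal (Real.exp ((v ⬝ᵥ q ω / (S * l2Norm v)) ^ 2)) ∂μ ≤ 4 := by
  simpa only [div_pow, mul_pow, l2Norm_sq] using h v

lemma lintegral_exp_apply (h : HasSubgaussianScale μ S q) (i : Fin d) :
    ∫⁻ ω, ENNReal.ofReal (Real.exp ((q ω i / S) ^ 2)) ∂μ ≤ 4 := by
  simpa [div_pow] using h (Pi.single i 1)

lemma memLp_apply (h : HasSubgaussianScale μ S q) (hS : 0 < S) (hq : Measurable q) (i : Fin d) :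
    MemLp (fun ω => q ω i) 2 μ :=
  memLp_two_of_lintegral_exp_sq_div_le (by fun_prop) (pow_pos hS 2)
    (by simpa only [div_pow] using h.lintegral_exp_apply i)

end HasSubgaussianScale

lemma hasSubgaussianScale_of_psi2NormVec_le {Ω : Type*} [MeasurableSpace Ω] {d : ℕ}
    {μ : Measure Ω} [IsProbabilityMeasure μ] {x : Ω → Fin d → ℝ} {σ S : ℝ} (hσ : 0 < σ)
    (hS : 2 * σ ≤ S) (h : psi2NormVec μ x ≤ ENNReal.ofReal σ) : HasSubgaussianScale μ S x := by
  intro v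
  have hv : ∀ ω, (v ⬝ᵥ x ω) ^ 2 / (S ^ 2 * (v ⬝ᵥ v))
      ≤ (v ⬝ᵥ x ω) ^ 2 / (4 * σ ^ 2 * (v ⬝ᵥ v)) := by
    intro ω
    have : 0 ≤ v ⬝ᵥ v := l2Norm_sq v ▸ sq_nonneg _
    rw [← div_div, ← div_div]
    gcongr
    nlinarith
  calc ∫⁻ ω, ENNReal.ofReal (Real.exp ((v ⬝ᵥ x ω) ^ 2 / (S ^ 2 * (v ⬝ᵥ v)))) ∂μ
      ≤ ∫⁻ ω, ENNReal.ofReal (Real.exp ((v ⬝ᵥ x ω) ^ 2 / (4 * σ ^ 2 * (v ⬝ᵥ v)))) ∂μ :=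
        lintegral_mono fun ω => ENNReal.ofReal_le_ofReal (Real.exp_le_exp.2 (hv ω))
    _ ≤ 2 := lintegral_exp_sq_le_of_psi2NormVec_le hσ h v
    _ ≤ 4 := by norm_num

section TruncatedResponse

lemma rpow_max_one_le {z p : ℝ} (hz : 0 ≤ z) : max 1 z ^ p ≤ 1 + z ^ p := by
  have hpow : 0 ≤ z ^ p := by positivity
  rcases max_choice 1 z with h | h <;> rw [h]
  · rw [Real.one_rpow]
    linarith
  · linarith

lemma sq_le_one_add_rpow {z p : ℝ} (hz : 0 ≤ z) (hp : 2 ≤ p) : z ^ 2 ≤ 1 + z ^ p :=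
  calc z ^ 2 ≤ max 1 z ^ p := by
        rw [← Real.rpow_two]
        exact (Real.rpow_le_rpow hz (le_max_right 1 z) zero_le_two).trans
          (Real.rpow_le_rpow_of_exponent_le (le_max_left 1 z) hp)
    _ ≤ 1 + z ^ p := rpow_max_one_le hz

lemma abs_quantizedResponse_div_le {Δ ζ m y u : ℝ} (hΔ : 0 ≤ Δ) (hζ : 0 ≤ ζ) (hm : 0 < m)
    (hu : |u| ≤ Δ / 2) : |quantizedResponse Δ ζ y u / (Δ + m)| ≤ max 1 (|y| / m) := by
  rw [abs_div, abs_of_pos (by positivity : 0 < Δ + m), div_le_iff₀ (by positivity)]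
  calc |quantizedResponse Δ ζ y u| ≤ |truncate ζ y| + Δ := abs_quantizedResponse_le hΔ hu
    _ ≤ |y| / m * m + 1 * Δ := by
        rw [div_mul_cancel₀ _ hm.ne', one_mul]
        exact add_le_add_left (abs_truncate_le_abs hζ y) Δ
    _ ≤ max 1 (|y| / m) * m + max 1 (|y| / m) * Δ := by
        gcongr
        · exact le_max_right _ _
        · exact le_max_left _ _
    _ = max 1 (|y| / m) * (Δ + m) := by ring

/-- The constant in the bias caused by truncating the response. -/
def biasConst (l : ℝ) : ℝ := 1 + Real.exp ((2 * l / (l - 1)) ^ 2) * 4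

lemma biasConst_pos (l : ℝ) : 0 < biasConst l := by
  unfold biasConst
  positivity

lemma abs_truncate_sub_mul_le {l m S ζ : ℝ} (hl : 1 < l) (hm : 0 < m) (hS : 0 < S) (hζ : 0 < ζ)
    (y X : ℝ) :
    |truncate ζ y * X - y * X| ≤ m * S * (m / ζ) ^ l *
      ((|y| / m) ^ (2 * l) + Real.exp ((2 * l / (l - 1)) ^ 2) * Real.exp ((X / S) ^ 2)) := by
  have : 0 < l - 1 := sub_pos.2 hl
  have hscale : |y| / ζ = |y| / m * (m / ζ) := (div_mul_div_cancel₀ hm.ne').symm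
  calc |truncate ζ y * X - y * X| = |truncate ζ y - y| * |X| := by rw [← sub_mul, abs_mul]
    _ ≤ |y| * (|y| / ζ) ^ l * |X| := by
        gcongr
        exact abs_truncate_sub_le hζ (by positivity) y
    _ = m * S * (m / ζ) ^ l * (|y| / m * (|y| / m) ^ l * (|X| / S)) := by
        rw [hscale, Real.mul_rpow (by positivity) (by positivity)]
        field_simp
    _ ≤ m * S * (m / ζ) ^ l * ((|y| / m) ^ (2 * l) + (|X| / S) ^ (2 * l / (l - 1))) := by
        gcongr
        exact mul_rpow_mul_le_rpow_add_rpow hl (by positivity) (by positivity)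
    _ ≤ _ := by
        gcongr
        refine (rpow_le_exp_sq_mul_exp_sq (by positivity) (by positivity)).trans_eq ?_
        rw [div_pow |X|, sq_abs, div_pow X]

variable {Ω : Type*} [MeasurableSpace Ω] {μ : Measure Ω} {y u X : Ω → ℝ} {l m : ℝ}

lemma lintegral_rpow_div_le {M : ℝ} (hl : 0 < l) (hM : 0 < M)
    (h : ∫⁻ ω, ENNReal.ofReal (|y ω| ^ (2 * l)) ∂μ ≤ ENNReal.ofReal M) :
    ∫⁻ ω, ENNReal.ofReal ((|y ω| / M ^ (1 / (2 * l))) ^ (2 * l)) ∂μ ≤ 1 := by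
  have hpow : (M ^ (1 / (2 * l))) ^ (2 * l) = M := by
    rw [← Real.rpow_mul hM.le, one_div_mul_cancel (by positivity), Real.rpow_one]
  have hdiv : ∀ ω, (|y ω| / M ^ (1 / (2 * l))) ^ (2 * l) = M⁻¹ * |y ω| ^ (2 * l) := fun ω => by
    rw [Real.div_rpow (abs_nonneg _) (by positivity), hpow, div_eq_inv_mul]
  simpa only [hdiv, inv_mul_cancel₀ hM.ne', ENNReal.ofReal_one] using
    lintegral_ofReal_const_mul_le (inv_nonneg.2 hM.le) h

section Moments

variable [IsProbabilityMeasure μ]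
  (hy_moment : ∫⁻ ω, ENNReal.ofReal ((|y ω| / m) ^ (2 * l)) ∂μ ≤ 1)

include hy_moment

lemma lintegral_one_add_rpow_div_le :
    ∫⁻ ω, ENNReal.ofReal (1 + (|y ω| / m) ^ (2 * l)) ∂μ ≤ ENNReal.ofReal 2 := by
  rw [show ENNReal.ofReal 2 = ENNReal.ofReal (1 + 1) by norm_num]
  exact lintegral_ofReal_le_of_ae_le_add measurable_const zero_le_one zero_le_one
    (ae_of_all _ fun _ => le_rfl) (by simp) (by simpa using hy_moment)

lemma lintegral_sq_le_of_lintegral_rpow_div_le (hl : 1 ≤ l) (hm : 0 < m) :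
    ∫⁻ ω, ENNReal.ofReal (y ω ^ 2) ∂μ ≤ ENNReal.ofReal (m ^ 2 * 2) := by
  refine (lintegral_mono fun ω => ENNReal.ofReal_le_ofReal ?_).trans
    (lintegral_ofReal_const_mul_le (sq_nonneg m) (lintegral_one_add_rpow_div_le hy_moment))
  calc y ω ^ 2 = m ^ 2 * (|y ω| / m) ^ 2 := by
        rw [div_pow, sq_abs]
        field_simp
    _ ≤ m ^ 2 * (1 + (|y ω| / m) ^ (2 * l)) := by
        gcongr
        exact sq_le_one_add_rpow (by positivity) (by linarith)

lemma memLp_two_of_lintegral_rpow_div_le (hl : 1 ≤ l) (hm : 0 < m) (hy : Measurable y) :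
    MemLp y 2 μ :=
  (memLp_two_iff_integrable_sq hy.aestronglyMeasurable).2 <|
    integrable_of_lintegral_ofReal_le (by fun_prop) (fun _ => sq_nonneg _)
      (lintegral_sq_le_of_lintegral_rpow_div_le hy_moment hl hm)

lemma lintegral_rpow_quantizedResponse_le {Δ ζ : ℝ} (hΔ : 0 ≤ Δ) (hζ : 0 ≤ ζ) (hl : 0 ≤ l)
    (hm : 0 < m) (hu : ∀ᵐ ω ∂μ, |u ω| ≤ Δ / 2) :
    ∫⁻ ω, ENNReal.ofReal (|quantizedResponse Δ ζ (y ω) (u ω) / (Δ + m)| ^ (2 * l)) ∂μ ≤ 2 :=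
  calc ∫⁻ ω, ENNReal.ofReal (|quantizedResponse Δ ζ (y ω) (u ω) / (Δ + m)| ^ (2 * l)) ∂μ
      ≤ ∫⁻ ω, ENNReal.ofReal (1 + (|y ω| / m) ^ (2 * l)) ∂μ := by
        refine lintegral_mono_ae (hu.mono fun ω hω => ENNReal.ofReal_le_ofReal ?_)
        exact (Real.rpow_le_rpow (abs_nonneg _) (abs_quantizedResponse_div_le hΔ hζ hm hω)
          (by positivity)).trans (rpow_max_one_le (by positivity))
    _ ≤ 2 := by simpa using lintegral_one_add_rpow_div_le hy_moment

lemma abs_integral_truncate_mul_sub_le {S ζ : ℝ} (hl : 1 < l) (hm : 0 < m) (hS : 0 < S)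
    (hζ : 0 < ζ) (hy : Measurable y) (hX : Measurable X)
    (hX_exp : ∫⁻ ω, ENNReal.ofReal (Real.exp ((X ω / S) ^ 2)) ∂μ ≤ 4) :
    |∫ ω, truncate ζ (y ω) * X ω ∂μ - ∫ ω, y ω * X ω ∂μ|
      ≤ m * S * (m / ζ) ^ l * biasConst l := by
  have hy2 := memLp_two_of_lintegral_rpow_div_le hy_moment hl.le hm hy
  have hX2 : MemLp X 2 μ := memLp_two_of_lintegral_exp_sq_div_le hX (pow_pos hS 2)
    (by simpa only [div_pow] using hX_exp)
  have htruncate := measurable_truncate hζ.le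
  have htruncate2 : MemLp (fun ω => truncate ζ (y ω)) 2 μ :=
    hy2.of_le (htruncate.comp hy).aestronglyMeasurable
      (ae_of_all _ fun ω => abs_truncate_le_abs hζ.le (y ω))
  let envelope : Ω → ℝ := fun ω => (|y ω| / m) ^ (2 * l)
    + Real.exp ((2 * l / (l - 1)) ^ 2) * Real.exp ((X ω / S) ^ 2)
  have henvelope_meas : Measurable envelope := by fun_prop
  have henvelope_nonneg : ∀ ω, 0 ≤ envelope ω := fun ω => by positivity
  have henvelope : ∫⁻ ω, ENNReal.ofReal (envelope ω) ∂μ ≤ ENNReal.ofReal (biasConst l) :=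
    lintegral_ofReal_le_of_ae_le_add (by fun_prop) zero_le_one (by positivity)
      (ae_of_all _ fun _ => le_rfl) (by simpa using hy_moment)
      (lintegral_ofReal_const_mul_le (by positivity) (by simpa using hX_exp))
  rw [← integral_sub (integrable_mul_of_memLp_two htruncate2 hX2)
    (integrable_mul_of_memLp_two hy2 hX2)]
  calc |∫ ω, (truncate ζ (y ω) * X ω - y ω * X ω) ∂μ|
      ≤ ∫ ω, m * S * (m / ζ) ^ l * envelope ω ∂μ :=
        norm_integral_le_of_norm_le (f := fun ω => truncate ζ (y ω) * X ω - y ω * X ω)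
          ((integrable_of_lintegral_ofReal_le henvelope_meas henvelope_nonneg
            henvelope).const_mul _)
          (ae_of_all _ fun ω => abs_truncate_sub_mul_le hl hm hS hζ (y ω) (X ω))
    _ ≤ m * S * (m / ζ) ^ l * biasConst l := by
        rw [integral_const_mul]
        gcongr
        exact integral_le_of_lintegral_ofReal_le henvelope_meas henvelope_nonneg
          (biasConst_pos l).le henvelope

end Moments

end TruncatedResponse

/-- The scale of the sub-Gaussian tails of a quantized covariate. -/
def subgScale (σ Δ : ℝ) : ℝ := 3 * (σ + Δ)

lemma subgScale_pos {σ Δ : ℝ} (hσ : 0 < σ) (hΔ : 0 ≤ Δ) : 0 < subgScale σ Δ := by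
  unfold subgScale
  positivity

lemma add_sq_div_le {p q A B C : ℝ} (hA : 0 < A) (hB : 0 ≤ B) (hC : A + B ≤ C)
    (hq : B = 0 → q = 0) : (p + q) ^ 2 / C ≤ p ^ 2 / A + q ^ 2 / B := by
  rcases hB.eq_or_lt with rfl | hB
  · rw [hq rfl, add_zero, div_zero, add_zero]
    gcongr
    linarith
  · rw [div_add_div _ _ hA.ne' hB.ne', div_le_div_iff₀ (by linarith) (by positivity)]
    calc (p + q) ^ 2 * (A * B) ≤ (p ^ 2 * B + A * q ^ 2) * (A + B) := by
          nlinarith [sq_nonneg (p * B - q * A)]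
      _ ≤ (p ^ 2 * B + A * q ^ 2) * C := by gcongr

lemma dotProduct_quantizedCovariate_sq_div_le {d : ℕ} {σ Δ : ℝ} (hσ : 0 < σ) (hΔ : 0 ≤ Δ)
    (a v : Fin d → ℝ) {t : Fin d → ℝ} (ht : ∀ i, |t i| ≤ Δ) :
    (v ⬝ᵥ quantizedCovariate Δ a t) ^ 2 / (subgScale σ Δ ^ 2 * (v ⬝ᵥ v))
      ≤ (v ⬝ᵥ a) ^ 2 / (4 * σ ^ 2 * (v ⬝ᵥ v))
        + (v ⬝ᵥ (quantizedCovariate Δ a t - a)) ^ 2 / (9 * Δ ^ 2 * (v ⬝ᵥ v)) := by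
  have herror_zero (h0 : 9 * Δ ^ 2 = 0) : v ⬝ᵥ (quantizedCovariate Δ a t - a) = 0 := by
    obtain rfl : Δ = 0 := by simpa using h0
    have hq : quantizedCovariate 0 a t = a := by
      ext i
      have := (abs_quantize_add_sub_le hΔ : |quantize 0 (a i + t i) - a i| ≤ _)
      rw [← sub_eq_zero, ← abs_nonpos_iff]
      exact this.trans (by linarith [ht i])
    rw [hq, sub_self, dotProduct_zero]
  have hsplit : v ⬝ᵥ quantizedCovariate Δ a t
      = v ⬝ᵥ a + v ⬝ᵥ (quantizedCovariate Δ a t - a) := by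
    rw [← dotProduct_add, add_sub_cancel]
  rw [div_mul_eq_div_div, div_mul_eq_div_div _ (4 * σ ^ 2), div_mul_eq_div_div _ (9 * Δ ^ 2),
    ← add_div, hsplit]
  refine div_le_div_of_nonneg_right
    (add_sq_div_le (by positivity) (by positivity) ?_ herror_zero) (l2Norm_sq v ▸ sq_nonneg _)
  unfold subgScale
  nlinarith [mul_nonneg hσ.le hΔ]

/-- A single observation of the sampling scheme: covariate `x`, noise `ε`, uniform dither `φ` and
triangular dither vector `τ`, mutually independent. -/
structure DitheredSample {Ω : Type*} [MeasurableSpace Ω] (μ : Measure Ω) {d : ℕ} (Δ Δb : ℝ)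
    (x : Ω → Fin d → ℝ) (ε φ : Ω → ℝ) (τ : Ω → Fin d → ℝ) : Prop where
  measurable_x : Measurable x
  measurable_ε : Measurable ε
  measurable_φ : Measurable φ
  measurable_τ : Measurable τ
  law_φ : μ.map φ = uniformDither Δ
  law_τ : μ.map τ = triangularDither d Δb
  indep_x_ε : IndepFun x ε μ
  indep_φ_τ : IndepFun φ τ μ
  indep_signal_dither : IndepFun (fun ω => (x ω, ε ω)) (fun ω => (φ ω, τ ω)) μ

lemma SamplingScheme.sample {Ω : Type*} [MeasurableSpace Ω] {μ : Measure Ω} {n d : ℕ} {Δ Δb : ℝ}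
    {x : Fin n → Ω → Fin d → ℝ} {ε φ : Fin n → Ω → ℝ} {τ : Fin n → Ω → Fin d → ℝ}
    (h : SamplingScheme μ Δ Δb x ε φ τ) (k : Fin n) :
    DitheredSample μ Δ Δb (x k) (ε k) (φ k) (τ k) where
  measurable_x := h.measurable_x k
  measurable_ε := h.measurable_ε k
  measurable_φ := h.measurable_φ k
  measurable_τ := h.measurable_τ k
  law_φ := h.law_φ k
  law_τ := h.law_τ k
  indep_x_ε := h.indep_x_ε k
  indep_φ_τ := h.indep_φ_τ k
  indep_signal_dither := h.indep_signal_dither k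

@[fun_prop]
lemma measurable_quantizedResponse {Δ ζ : ℝ} (hζ : 0 ≤ ζ) :
    Measurable fun p : ℝ × ℝ => quantizedResponse Δ ζ p.1 p.2 := by
  have := measurable_truncate hζ
  unfold quantizedResponse
  fun_prop

namespace DitheredSample

variable {Ω : Type*} [MeasurableSpace Ω] {μ : Measure Ω} {d : ℕ} {σ Δ Δb : ℝ}
  {x : Ω → Fin d → ℝ} {ε φ : Ω → ℝ} {τ : Ω → Fin d → ℝ} (h : DitheredSample μ Δ Δb x ε φ τ)

include h

lemma indepFun_x_τ : IndepFun x τ μ :=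
  h.indep_signal_dither.comp measurable_fst measurable_snd

lemma measurable_response (θ : Fin d → ℝ) : Measurable (response θ x ε) := by
  have := h.measurable_x
  have := h.measurable_ε
  unfold response
  fun_prop

lemma measurable_covariate : Measurable fun ω => quantizedCovariate Δb (x ω) (τ ω) := by
  have := h.measurable_x
  have := h.measurable_τ
  fun_prop

lemma measurable_response_quantized {ζ : ℝ} (hζ : 0 ≤ ζ) (θ : Fin d → ℝ) :
    Measurable fun ω => quantizedResponse Δ ζ (response θ x ε ω) (φ ω) := by
  have := h.measurable_response θ
  have := h.measurable_φ
  fun_prop (disch := assumption)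

lemma ae_abs_φ_le : ∀ᵐ ω ∂μ, |φ ω| ≤ Δ / 2 :=
  ae_of_ae_map h.measurable_φ.aemeasurable (h.law_φ ▸ ae_abs_le_uniformDither Δ)

lemma ae_abs_τ_le (hΔb : 0 ≤ Δb) : ∀ᵐ ω ∂μ, ∀ i, |τ ω i| ≤ Δb :=
  ae_of_ae_map h.measurable_τ.aemeasurable
    (h.law_τ ▸ ae_all_iff.2 fun i => ae_abs_le_triangularDither hΔb i)

variable [IsProbabilityMeasure μ]

lemma hasSubgaussianScale_covariate (hσ : 0 < σ) (hΔb : 0 ≤ Δb)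
    (hψ : psi2NormVec μ x ≤ ENNReal.ofReal σ) :
    HasSubgaussianScale μ (subgScale σ Δb) fun ω => quantizedCovariate Δb (x ω) (τ ω) := by
  intro v
  let signal : (Fin d → ℝ) → ℝ≥0∞ := fun a =>
    ENNReal.ofReal (Real.exp ((v ⬝ᵥ a) ^ 2 / (4 * σ ^ 2 * (v ⬝ᵥ v))))
  let error : (Fin d → ℝ) × (Fin d → ℝ) → ℝ≥0∞ := fun p =>
    ENNReal.ofReal (Real.exp ((v ⬝ᵥ (quantizedCovariate Δb p.1 p.2 - p.1)) ^ 2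
      / (9 * Δb ^ 2 * (v ⬝ᵥ v))))
  have hproduct : Measurable fun p : (Fin d → ℝ) × (Fin d → ℝ) => signal p.1 * error p := by
    have : Measurable fun p : (Fin d → ℝ) × (Fin d → ℝ) =>
        v ⬝ᵥ (quantizedCovariate Δb p.1 p.2 - p.1) := by
      simp only [dotProduct_sub]
      fun_prop
    fun_prop
  calc ∫⁻ ω, ENNReal.ofReal (Real.exp ((v ⬝ᵥ quantizedCovariate Δb (x ω) (τ ω)) ^ 2
        / (subgScale σ Δb ^ 2 * (v ⬝ᵥ v)))) ∂μ
      ≤ ∫⁻ ω, signal (x ω) * error (x ω, τ ω) ∂μ := by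
        refine lintegral_mono_ae ((h.ae_abs_τ_le hΔb).mono fun ω hω => ?_)
        simp only [signal, error]
        rw [← ENNReal.ofReal_mul (Real.exp_pos _).le, ← Real.exp_add]
        exact ENNReal.ofReal_le_ofReal <| Real.exp_le_exp.2 <|
          dotProduct_quantizedCovariate_sq_div_le hσ hΔb (x ω) v hω
    _ = ∫⁻ ω, signal (x ω) * ∫⁻ t, error (x ω, t) ∂(triangularDither d Δb) ∂μ := by
        rw [lintegral_comp_prod_of_indepFun h.measurable_x h.measurable_τ h.indepFun_x_τ hproduct,
          h.law_τ]
        simp only [lintegral_const_mul' _ _ ENNReal.ofReal_ne_top, signal]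
    _ ≤ ∫⁻ ω, signal (x ω) * 2 ∂μ := by
        gcongr with ω
        exact lintegral_exp_sq_dotProduct_quantizedCovariate_sub hΔb (x ω) v
    _ ≤ 2 * 2 := by
        rw [lintegral_mul_const' _ _ (by norm_num)]
        gcongr
        exact lintegral_exp_sq_le_of_psi2NormVec_le hσ hψ v
    _ = 4 := by norm_num

lemma secondMoment_covariate (hΔb : 0 ≤ Δb) (hx : ∀ i, MemLp (fun ω => x ω i) 2 μ)
    (hq : ∀ i, MemLp (fun ω => quantizedCovariate Δb (x ω) (τ ω) i) 2 μ) :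
    secondMoment μ (fun ω => quantizedCovariate Δb (x ω) (τ ω))
      = secondMoment μ x + (Δb ^ 2 / 4) • (1 : Matrix (Fin d) (Fin d) ℝ) := by
  ext i j
  calc ∫ ω, quantizedCovariate Δb (x ω) (τ ω) i * quantizedCovariate Δb (x ω) (τ ω) j ∂μ
      = ∫ ω, (x ω i * x ω j + if i = j then Δb ^ 2 / 4 else 0) ∂μ := by
        rw [integral_comp_prod_of_indepFun (F := fun p : (Fin d → ℝ) × (Fin d → ℝ) =>
          quantizedCovariate Δb p.1 p.2 i * quantizedCovariate Δb p.1 p.2 j) h.measurable_x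
          h.measurable_τ h.indepFun_x_τ (by fun_prop) (integrable_mul_of_memLp_two (hq i) (hq j)),
          h.law_τ]
        simp only [integral_quantizedCovariate_mul hΔb]
    _ = secondMoment μ x i j + ((Δb ^ 2 / 4) • (1 : Matrix (Fin d) (Fin d) ℝ)) i j := by
        rw [integral_add (integrable_mul_of_memLp_two (hx i) (hx j)) (integrable_const _)]
        simp [secondMoment, Matrix.one_apply]

-- Given the signal, the two dithers are independent and each quantizer is unbiased.
lemma integral_quantizedResponse_mul_covariate (hΔ : 0 ≤ Δ) (hΔb : 0 ≤ Δb) {ζ : ℝ} (hζ : 0 ≤ ζ)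
    (θ : Fin d → ℝ) (i : Fin d)
    (hint : Integrable (fun ω => quantizedResponse Δ ζ (response θ x ε ω) (φ ω)
      * quantizedCovariate Δb (x ω) (τ ω) i) μ) :
    ∫ ω, quantizedResponse Δ ζ (response θ x ε ω) (φ ω) * quantizedCovariate Δb (x ω) (τ ω) i ∂μ
      = ∫ ω, truncate ζ (response θ x ε ω) * x ω i ∂μ := by
  have := isProbabilityMeasure_uniformDither hΔ
  have := isProbabilityMeasure_triangularDither d hΔb
  have hlaw : μ.map (fun ω => (φ ω, τ ω)) = (uniformDither Δ).prod (triangularDither d Δb) := by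
    rw [(indepFun_iff_map_prod_eq_prod_map_map h.measurable_φ.aemeasurable
      h.measurable_τ.aemeasurable).1 h.indep_φ_τ, h.law_φ, h.law_τ]
  let F : ((Fin d → ℝ) × ℝ) × (ℝ × (Fin d → ℝ)) → ℝ := fun p =>
    quantizedResponse Δ ζ (p.1.1 ⬝ᵥ θ + p.1.2) p.2.1 * quantizedCovariate Δb p.1.1 p.2.2 i
  have hF : Measurable F := by
    have := measurable_truncate hζ
    unfold F quantizedResponse
    fun_prop
  calc ∫ ω, quantizedResponse Δ ζ (response θ x ε ω) (φ ω)
        * quantizedCovariate Δb (x ω) (τ ω) i ∂μ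
      = ∫ ω, ∫ t, F ((x ω, ε ω), t) ∂((uniformDither Δ).prod (triangularDither d Δb)) ∂μ := by
        rw [← hlaw]
        exact integral_comp_prod_of_indepFun (h.measurable_x.prodMk h.measurable_ε)
          (h.measurable_φ.prodMk h.measurable_τ) h.indep_signal_dither hF hint
    _ = ∫ ω, truncate ζ (response θ x ε ω) * x ω i ∂μ := by
        congr 1 with ω
        exact (integral_prod_mul (fun u => quantizedResponse Δ ζ (x ω ⬝ᵥ θ + ε ω) u)
          fun t => quantizedCovariate Δb (x ω) t i).trans <|
          congrArg₂ _ (integral_quantize_uniformDither hΔ _) (integral_quantizedCovariate hΔb _ i)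

end DitheredSample

section EmpiricalMoments

variable {n d : ℕ}

lemma matQ_mulVec (Δb : ℝ) (x : Fin n → Fin d → ℝ) (v : Fin d → ℝ) (i : Fin d) :
    (matQ Δb x *ᵥ v) i = (1 / (n : ℝ)) * ∑ k, x k i * (v ⬝ᵥ x k) - Δb ^ 2 / 4 * v i := by
  rw [matQ, Matrix.sub_mulVec, Matrix.smul_mulVec, Matrix.smul_mulVec, Matrix.one_mulVec,
    Matrix.sum_mulVec]
  simp only [Matrix.vecMulVec_mulVec, dotProduct_comm (x _) v, Pi.sub_apply, Pi.smul_apply,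
    Finset.sum_apply, MulOpposite.smul_eq_mul_unop, MulOpposite.unop_op, smul_eq_mul]

lemma dotProduct_matQ_mulVec (Δb : ℝ) (x : Fin n → Fin d → ℝ) (v : Fin d → ℝ) :
    v ⬝ᵥ matQ Δb x *ᵥ v = (1 / (n : ℝ)) * ∑ k, (v ⬝ᵥ x k) ^ 2 - Δb ^ 2 / 4 * (v ⬝ᵥ v) := by
  rw [matQ, Matrix.sub_mulVec, Matrix.smul_mulVec, Matrix.smul_mulVec, Matrix.one_mulVec,
    Matrix.sum_mulVec, dotProduct_sub, dotProduct_smul, dotProduct_smul, dotProduct_sum]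
  simp only [Matrix.vecMulVec_mulVec, dotProduct_comm (x _) v, dotProduct_smul, sq,
    MulOpposite.smul_eq_mul_unop, MulOpposite.unop_op, smul_eq_mul]

lemma matQ_diag (Δb : ℝ) (x : Fin n → Fin d → ℝ) (i : Fin d) :
    matQ Δb x i i = (1 / (n : ℝ)) * ∑ k, x k i ^ 2 - Δb ^ 2 / 4 := by
  simp [matQ, Matrix.sum_apply, Matrix.vecMulVec_apply, sq]

lemma vecB_apply (x : Fin n → Fin d → ℝ) (y : Fin n → ℝ) (i : Fin d) :
    vecB x y i = (1 / (n : ℝ)) * ∑ k, y k * x k i := by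
  simp [vecB]

lemma abs_vecB_sub_matQ_mulVec_le (hn : 0 < n) {Δb u₁ u₂ β : ℝ} {x : Fin n → Fin d → ℝ}
    {y : Fin n → ℝ} {v : Fin d → ℝ} {i : Fin d} {a g : Fin n → ℝ}
    (hβ : ∀ k, |a k - (g k - Δb ^ 2 / 4 * v i)| ≤ β)
    (h₁ : |∑ k, (y k * x k i - a k)| ≤ n * u₁)
    (h₂ : |∑ k, (x k i * (v ⬝ᵥ x k) - g k)| ≤ n * u₂) :
    |(vecB x y - matQ Δb x *ᵥ v) i| ≤ u₁ + u₂ + β := by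
  have hn' : (0 : ℝ) < n := by exact_mod_cast hn
  have hbias : |∑ k, (a k - (g k - Δb ^ 2 / 4 * v i))| ≤ n * β :=
    calc _ ≤ ∑ k, |a k - (g k - Δb ^ 2 / 4 * v i)| := Finset.abs_sum_le_sum_abs _ _
      _ ≤ ∑ _k : Fin n, β := Finset.sum_le_sum fun k _ => hβ k
      _ = n * β := by simp
  have hsplit : (vecB x y - matQ Δb x *ᵥ v) i = (∑ k, (y k * x k i - a k)
      - ∑ k, (x k i * (v ⬝ᵥ x k) - g k) + ∑ k, (a k - (g k - Δb ^ 2 / 4 * v i))) / n := by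
    simp only [Pi.sub_apply, vecB_apply, matQ_mulVec, Finset.sum_sub_distrib, Finset.sum_const,
      Finset.card_univ, Fintype.card_fin, nsmul_eq_mul]
    field_simp
    ring
  rw [hsplit, abs_div, abs_of_pos hn', div_le_iff₀ hn']
  calc _ ≤ |∑ k, (y k * x k i - a k)| + |∑ k, (x k i * (v ⬝ᵥ x k) - g k)|
        + |∑ k, (a k - (g k - Δb ^ 2 / 4 * v i))| :=
        (abs_add_le _ _).trans (by gcongr; exact abs_sub _ _)
    _ ≤ (u₁ + u₂ + β) * n := by linarith

lemma le_dotProduct_matQ_mulVec (hn : 0 < n) {Δb κ t : ℝ} {x : Fin n → Fin d → ℝ}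
    {v : Fin d → ℝ} {g : Fin n → ℝ} (hg : ∀ k, κ + Δb ^ 2 / 4 * (v ⬝ᵥ v) ≤ g k)
    (h : -(n * t) ≤ ∑ k, ((v ⬝ᵥ x k) ^ 2 - g k)) :
    κ - t ≤ v ⬝ᵥ matQ Δb x *ᵥ v := by
  have hn' : (0 : ℝ) < n := by exact_mod_cast hn
  have hsum : n * (κ + Δb ^ 2 / 4 * (v ⬝ᵥ v)) ≤ ∑ k, g k := by
    simpa [mul_add] using Finset.card_nsmul_le_sum Finset.univ g _ fun k _ => hg k
  rw [Finset.sum_sub_distrib] at h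
  rw [dotProduct_matQ_mulVec, le_sub_iff_add_le, one_div_mul_eq_div, le_div_iff₀ hn']
  linarith

lemma matQ_diag_le (hn : 0 < n) {S : ℝ} (hS : 0 < S) (Δb : ℝ) {x : Fin n → Fin d → ℝ} {i : Fin d}
    (h : ∑ k, (x k i / S) ^ 2 ≤ n * 3) : matQ Δb x i i ≤ 3 * S ^ 2 := by
  have hn' : (0 : ℝ) < n := by exact_mod_cast hn
  simp only [div_pow, ← Finset.sum_div] at h
  rw [div_le_iff₀ (by positivity)] at h
  have hmean : (1 / (n : ℝ)) * ∑ k, x k i ^ 2 ≤ 3 * S ^ 2 := by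
    rw [one_div_mul_eq_div, div_le_iff₀ hn']
    linarith
  rw [matQ_diag]
  linarith [sq_nonneg Δb]

end EmpiricalMoments

section EmpiricalConcentration

variable {Ω : Type*} [MeasurableSpace Ω] {μ : Measure Ω} [IsProbabilityMeasure μ]
  {ι : Type*} [Fintype ι]

lemma measureReal_abs_sum_centered_gt_le_of_weighted {f : ι → Ω → ℝ} (hind : iIndepFun f μ)
    (hf : ∀ k, Measurable (f k)) {c t G : ℝ} (u : ℝ) (hc : 0 < c) (ht : 0 ≤ t) (hG : 0 ≤ G)
    (h : ∀ k, ∫⁻ ω, ENNReal.ofReal ((f k ω / c) ^ 2 * Real.exp (t * |f k ω / c|)) ∂μ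
      ≤ ENNReal.ofReal G) :
    μ.real {ω | Fintype.card ι * (c * u) < |∑ k, (f k ω - ∫ ω, f k ω ∂μ)|}
      ≤ 2 * Real.exp (Fintype.card ι * (t ^ 2 * G - t * u)) := by
  refine (measureReal_mono fun ω hω => ?_).trans
    (measureReal_abs_sum_centered_ge_le (Y := fun k ω => f k ω / c)
      (hind.comp (fun _ y => y / c) fun _ => by fun_prop) (fun k => (hf k).div_const c) u ht hG h)
  have hscale : ∑ k, (f k ω / c - ∫ ω, f k ω / c ∂μ) = (∑ k, (f k ω - ∫ ω, f k ω ∂μ)) / c := by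
    simp only [integral_div, ← sub_div, ← Finset.sum_div]
  simp only [Set.mem_ofPred_eq] at hω ⊢
  rw [hscale, abs_div, abs_of_pos hc, le_div_iff₀ hc]
  linarith

lemma measureReal_abs_sum_mul_centered_gt_le {Y W : ι → Ω → ℝ}
    (hind : iIndepFun (fun k ω => Y k ω * W k ω) μ) (hY : ∀ k, Measurable (Y k))
    (hW : ∀ k, Measurable (W k)) {l α S : ℝ} (hl : 1 < l) (hα : 0 < α) (hS : 0 < S)
    (hY_moment : ∀ k, ∫⁻ ω, ENNReal.ofReal (|Y k ω / α| ^ (2 * l)) ∂μ ≤ 2)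
    (hW_exp : ∀ k, ∫⁻ ω, ENNReal.ofReal (Real.exp ((W k ω / S) ^ 2)) ∂μ ≤ 4)
    {B ρ : ℝ} (hB : 1 ≤ B) (hρ : 0 ≤ ρ) (hY_bound : ∀ k, ∀ᵐ ω ∂μ, ρ * |Y k ω / α| ≤ B) :
    μ.real {ω | Fintype.card ι * (α * S * (ρ * (B + momentConst l)))
        < |∑ k, (Y k ω * W k ω - ∫ ω, Y k ω * W k ω ∂μ)|}
      ≤ 2 * Real.exp (-(Fintype.card ι * ρ ^ 2)) := by
  have hB0 : 0 < B := by linarith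
  have hG := momentConst_nonneg l
  refine (measureReal_abs_sum_centered_gt_le_of_weighted hind (fun k => (hY k).mul (hW k))
    (t := ρ / B) (G := momentConst l) _ (by positivity) (by positivity) hG fun k => ?_).trans ?_
  · simp only [mul_div_mul_comm]
    refine lintegral_mul_sq_mul_exp_le_momentConst hl ((hY k).div_const α) (hY_moment k)
      (hW_exp k) ((hY_bound k).mono fun ω hω => ?_)
    rwa [div_mul_eq_mul_div, div_le_one hB0]
  · have hexponent : (ρ / B) ^ 2 * momentConst l - ρ / B * (ρ * (B + momentConst l)) ≤ -ρ ^ 2 := by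
      have hsq : (ρ / B) ^ 2 * momentConst l ≤ ρ / B * ρ * momentConst l := by
        rw [sq]
        gcongr
        exact div_le_self hρ hB
      have hexpand : ρ / B * (ρ * (B + momentConst l)) = ρ ^ 2 + ρ / B * ρ * momentConst l := by
        field_simp
      linarith
    gcongr
    linarith [mul_le_mul_of_nonneg_left hexponent (Nat.cast_nonneg (α := ℝ) (Fintype.card ι))]

variable {d : ℕ} {X : ι → Ω → Fin d → ℝ} {S : ℝ}

lemma measureReal_abs_sum_apply_mul_dotProduct_centered_gt_le (hind : iIndepFun X μ)
    (hX : ∀ k, Measurable (X k)) (hS : 0 < S) (hXS : ∀ k, HasSubgaussianScale μ S (X k))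
    {ρ : ℝ} (hρ : 0 ≤ ρ) (hρ_le : ρ ≤ 1 / 2) (v : Fin d → ℝ) (i : Fin d) :
    μ.real {ω | Fintype.card ι * (S ^ 2 * l2Norm v * (33 * ρ))
        < |∑ k, (X k ω i * (v ⬝ᵥ X k ω) - ∫ ω, X k ω i * (v ⬝ᵥ X k ω) ∂μ)|}
      ≤ 2 * Real.exp (-(Fintype.card ι * ρ ^ 2)) := by
  rcases (l2Norm_nonneg v).eq_or_lt with h0 | hv
  · obtain rfl : v = 0 := dotProduct_self_eq_zero.1 (by rw [← l2Norm_sq, ← h0, sq, mul_zero])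
    simp [← h0, Real.exp_nonneg]
  refine (measureReal_abs_sum_centered_gt_le_of_weighted
    (hind.comp (fun _ w => w i * (v ⬝ᵥ w)) fun _ => by fun_prop) (fun k => by fun_prop)
    (t := ρ) (G := 32) _ (by positivity) hρ (by norm_num) fun k => ?_).trans_eq ?_
  · simp only [Function.comp_apply, show S ^ 2 * l2Norm v = S * (S * l2Norm v) by ring,
      mul_div_mul_comm]
    exact lintegral_mul_sq_mul_exp_le (by fun_prop) ((hXS k).lintegral_exp_apply i)
      ((hXS k).lintegral_exp_dotProduct v) hρ_le
  · congr 2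
    ring

lemma measureReal_sum_dotProduct_sq_centered_lt_le (hind : iIndepFun X μ)
    (hX : ∀ k, Measurable (X k)) (hS : 0 < S) (hXS : ∀ k, HasSubgaussianScale μ S (X k))
    {κ : ℝ} (hκ : 0 ≤ κ) (v : Fin d → ℝ) :
    μ.real {ω | ∑ k, ((v ⬝ᵥ X k ω) ^ 2 - ∫ ω, (v ⬝ᵥ X k ω) ^ 2 ∂μ)
        < -(Fintype.card ι * (κ * (v ⬝ᵥ v)))}
      ≤ Real.exp (-(Fintype.card ι * (κ ^ 2 / (32 * S ^ 4)))) := by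
  rcases (l2Norm_sq v ▸ sq_nonneg (l2Norm v) : 0 ≤ v ⬝ᵥ v).eq_or_lt with h0 | hv
  · obtain rfl : v = 0 := dotProduct_self_eq_zero.1 h0.symm
    simp [Real.exp_nonneg]
  have htail := measureReal_sum_centered_le_le (X := fun k ω => (v ⬝ᵥ X k ω) ^ 2)
    (hind.comp (fun _ w => (v ⬝ᵥ w) ^ 2) fun _ => by fun_prop) (fun k => by fun_prop)
    (fun _ _ => sq_nonneg _) (t := κ / (16 * S ^ 4 * (v ⬝ᵥ v))) (κ * (v ⬝ᵥ v)) (by positivity)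
    (by positivity) (fun k => lintegral_sq_sq_le (by positivity) (hXS k v))
  refine (measureReal_mono (Set.ofPred_subset_ofPred.2 fun _ => le_of_lt)).trans (htail.trans_eq ?_)
  congr 1
  field_simp
  ring

end EmpiricalConcentration

section EmpiricalEvents

variable {Ω : Type*} [MeasurableSpace Ω] {μ : Measure Ω}

lemma measureReal_exists_le {ι : Type*} [Fintype ι] {p : ι → Ω → Prop} {r : ℝ}
    (h : ∀ i, μ.real {ω | p i ω} ≤ r) : μ.real {ω | ∃ i, p i ω} ≤ Fintype.card ι * r := by
  rw [Set.ofPred_exists]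
  calc _ ≤ ∑ i, μ.real {ω | p i ω} := measureReal_iUnion_fintype_le _
    _ ≤ ∑ _i : ι, r := Finset.sum_le_sum fun i _ => h i
    _ = Fintype.card ι * r := by simp

variable [IsProbabilityMeasure μ]

lemma exists_measurableSet_forall_notMem {s : Set Ω} {r : ℝ} (h : μ.real s ≤ r) :
    ∃ E, MeasurableSet E ∧ 1 - r ≤ μ.real E ∧ ∀ ω ∈ E, ω ∉ s := by
  have hmeas := measurableSet_toMeasurable μ s
  refine ⟨(toMeasurable μ s)ᶜ, hmeas.compl, ?_, fun ω hω hs => hω (subset_toMeasurable μ s hs)⟩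
  rw [probReal_compl_eq_one_sub hmeas, Measure.real, measure_toMeasurable]
  exact sub_le_sub_left h 1

variable {n d : ℕ} {X : Fin n → Ω → Fin d → ℝ} {Y : Fin n → Ω → ℝ} {S : ℝ}

lemma measureReal_exists_gradient_gt_le (hn : 0 < n)
    (hind : iIndepFun (fun k ω => (X k ω, Y k ω)) μ) (hX : ∀ k, Measurable (X k))
    (hY : ∀ k, Measurable (Y k)) (hS : 0 < S) (hXS : ∀ k, HasSubgaussianScale μ S (X k))
    {l α : ℝ} (hl : 1 < l) (hα : 0 < α)
    (hY_moment : ∀ k, ∫⁻ ω, ENNReal.ofReal (|Y k ω / α| ^ (2 * l)) ∂μ ≤ 2)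
    {B ρ : ℝ} (hB : 1 ≤ B) (hρ : 0 ≤ ρ) (hρ_le : ρ ≤ 1 / 2)
    (hY_bound : ∀ k, ∀ᵐ ω ∂μ, ρ * |Y k ω / α| ≤ B) {Δb β : ℝ} {v : Fin d → ℝ}
    (hβ : ∀ k i, |∫ ω, Y k ω * X k ω i ∂μ
      - ((secondMoment μ (X k) *ᵥ v) i - Δb ^ 2 / 4 * v i)| ≤ β) :
    μ.real {ω | ∃ i, α * S * (ρ * (B + momentConst l)) + S ^ 2 * l2Norm v * (33 * ρ) + β
        < |(vecB (X · ω) (Y · ω) - matQ Δb (X · ω) *ᵥ v) i|}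
      ≤ d * (4 * Real.exp (-(n * ρ ^ 2))) := by
  refine (measureReal_exists_le fun i => ?_).trans_eq (by rw [Fintype.card_fin])
  have hindX : iIndepFun X μ := hind.comp (fun _ => Prod.fst) fun _ => measurable_fst
  have hcross := measureReal_abs_sum_mul_centered_gt_le (W := fun k ω => X k ω i)
    (hind.comp (fun _ p => p.2 * p.1 i) fun _ => by fun_prop) hY (fun k => by fun_prop) hl hα hS
    hY_moment (fun k => (hXS k).lintegral_exp_apply i) hB hρ hY_bound
  have hgram := measureReal_abs_sum_apply_mul_dotProduct_centered_gt_le hindX hX hS hXS hρ hρ_le v i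
  simp only [Fintype.card_fin] at hcross hgram
  refine (measureReal_mono fun ω hω => ?_).trans
    ((measureReal_union_le _ _).trans ((add_le_add hcross hgram).trans_eq (by ring)))
  by_contra h
  simp only [Set.mem_union, Set.mem_ofPred_eq, not_or, not_lt] at h hω
  refine hω.not_ge (abs_vecB_sub_matQ_mulVec_le hn (fun k => ?_) h.1 h.2)
  rw [integral_apply_mul_dotProduct fun j => (hXS k).memLp_apply hS (hX k) j]
  exact hβ k i

lemma measureReal_exists_matQ_diag_gt_le (hn : 0 < n) (hind : iIndepFun X μ)
    (hX : ∀ k, Measurable (X k)) (hS : 0 < S) (hXS : ∀ k, HasSubgaussianScale μ S (X k)) (Δb : ℝ) :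
    μ.real {ω | ∃ i, 3 * S ^ 2 < matQ Δb (X · ω) i i} ≤ d * Real.exp (-n) := by
  refine (measureReal_exists_le fun i => ?_).trans_eq (by rw [Fintype.card_fin])
  have htail := measureReal_sum_sq_ge_le (hind.comp (fun _ w => w i / S) fun _ => by fun_prop)
    (fun k => by fun_prop) fun k => (hXS k).lintegral_exp_apply i
  rw [Fintype.card_fin] at htail
  refine (measureReal_mono (Set.ofPred_subset_ofPred.2 fun ω hω => ?_)).trans htail
  by_contra! h
  exact hω.not_ge (matQ_diag_le hn hS Δb h.le)

lemma measureReal_exists_dotProduct_matQ_lt_le (hn : 0 < n) (hd : 0 < d) (hind : iIndepFun X μ)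
    (hX : ∀ k, Measurable (X k)) (hS : 0 < S) (hXS : ∀ k, HasSubgaussianScale μ S (X k))
    {κ Δb : ℝ} (hκ : 0 ≤ κ)
    (hmean : ∀ k v, κ * (v ⬝ᵥ v) + Δb ^ 2 / 4 * (v ⬝ᵥ v) ≤ v ⬝ᵥ secondMoment μ (X k) *ᵥ v)
    {m : ℕ} (z : (Fin m → Fin d × Bool) → Fin d → ℝ) :
    μ.real {ω | ∃ J, z J ⬝ᵥ matQ Δb (X · ω) *ᵥ z J < κ / 2 * (z J ⬝ᵥ z J)}
      ≤ Real.exp (m * Real.log (2 * d) - n * (κ ^ 2 / (128 * S ^ 4))) := by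
  refine (measureReal_exists_le (r := Real.exp (-(n * (κ ^ 2 / (128 * S ^ 4)))))
    fun J => ?_).trans_eq ?_
  · have htail := measureReal_sum_dotProduct_sq_centered_lt_le hind hX hS hXS
      (div_nonneg hκ zero_le_two) (z J)
    rw [Fintype.card_fin] at htail
    refine (measureReal_mono (Set.ofPred_subset_ofPred.2 fun ω hω => ?_)).trans
      (htail.trans_eq (by congr 3; ring))
    by_contra! h
    have hquad (k : Fin n) : κ * (z J ⬝ᵥ z J) + Δb ^ 2 / 4 * (z J ⬝ᵥ z J)
        ≤ ∫ ω, (z J ⬝ᵥ X k ω) ^ 2 ∂μ := by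
      rw [integral_dotProduct_sq fun j => (hXS k).memLp_apply hS (hX k) j]
      exact hmean k (z J)
    linarith [le_dotProduct_matQ_mulVec hn hquad h]
  · have : (0 : ℝ) < d := by exact_mod_cast hd
    rw [sub_eq_add_neg, Real.exp_add, Real.exp_nat_mul, Real.exp_log (by positivity)]
    simp [mul_comm]

lemma measureReal_not_restricted_strong_convexity_le (hn : 0 < n) (hd : 0 < d)
    (hind : iIndepFun X μ) (hX : ∀ k, Measurable (X k)) (hS : 0 < S)
    (hXS : ∀ k, HasSubgaussianScale μ S (X k)) {κ Δb : ℝ} (hκ : 0 ≤ κ)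
    (hmean : ∀ k v, κ * (v ⬝ᵥ v) + Δb ^ 2 / 4 * (v ⬝ᵥ v) ≤ v ⬝ᵥ secondMoment μ (X k) *ᵥ v)
    {m : ℕ} (hm : 1 < m) :
    μ.real {ω | ∃ v, v ⬝ᵥ matQ Δb (X · ω) *ᵥ v
        < κ / 2 * (v ⬝ᵥ v) - 3 * S ^ 2 / (m - 1) * l1Norm v ^ 2}
      ≤ d * Real.exp (-n) + Real.exp (m * Real.log (2 * d) - n * (κ ^ 2 / (128 * S ^ 4))) := by
  refine (measureReal_mono fun ω hω => ?_).trans ((measureReal_union_le _ _).trans (add_le_add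
      (measureReal_exists_matQ_diag_gt_le hn hind hX hS hXS Δb)
      (measureReal_exists_dotProduct_matQ_lt_le hn hd hind hX hS hXS hκ hmean
        fun J : Fin m → Fin d × Bool => ∑ i, signedBasis (J i))))
  obtain ⟨v, hv⟩ := hω
  by_contra h
  simp only [Set.mem_union, Set.mem_ofPred_eq, not_or, not_exists, not_lt] at h
  exact hv.not_ge (restricted_strong_convexity _ (by positivity) h.1 hm h.2 v)

end EmpiricalEvents

/-- The scale `M ^ (1 / (2 l))` of a response whose `2 l`-th absolute moment is at most `M`. -/
def responseScale (l M : ℝ) : ℝ := M ^ (1 / (2 * l))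

lemma responseScale_pos (l : ℝ) {M : ℝ} (hM : 0 < M) : 0 < responseScale l M :=
  Real.rpow_pos_of_pos hM _

/-- A single observation of the regression model with parameter `θ`: a dithered sample whose
covariate is centered and sub-Gaussian with covariance eigenvalues at least `κ`, and whose response
has `2 l`-th absolute moment at most `M`. -/
structure RegressionSample {Ω : Type*} [MeasurableSpace Ω] (μ : Measure Ω) {d : ℕ}
    (Δ Δb σ κ l M : ℝ) (θ : Fin d → ℝ) (x : Ω → Fin d → ℝ) (ε φ : Ω → ℝ) (τ : Ω → Fin d → ℝ) : Prop
    extends DitheredSample μ Δ Δb x ε φ τ where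
  integral_x : ∀ i, ∫ ω, x ω i ∂μ = 0
  psi2NormVec_x_le : psi2NormVec μ x ≤ ENNReal.ofReal σ
  le_of_mem_spectrum : ∀ ev ∈ spectrum ℝ (secondMoment μ x), κ ≤ ev
  lintegral_response_le :
    ∫⁻ ω, ENNReal.ofReal (|response θ x ε ω| ^ (2 * l)) ∂μ ≤ ENNReal.ofReal M

namespace RegressionSample

variable {Ω : Type*} [MeasurableSpace Ω] {μ : Measure Ω} {d : ℕ}
  {Δ Δb σ κ l M ζ : ℝ} {θ : Fin d → ℝ} {x : Ω → Fin d → ℝ} {ε φ : Ω → ℝ} {τ : Ω → Fin d → ℝ}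
  (h : RegressionSample μ Δ Δb σ κ l M θ x ε φ τ)

include h

lemma mul_dotProduct_self_le (v : Fin d → ℝ) :
    κ * (v ⬝ᵥ v) ≤ v ⬝ᵥ secondMoment μ x *ᵥ v :=
  mul_dotProduct_self_le_of_le_spectrum (isHermitian_secondMoment x) h.le_of_mem_spectrum v

lemma ae_abs_quantizedResponse_le (hΔ : 0 ≤ Δ) (hζ : 0 ≤ ζ) :
    ∀ᵐ ω ∂μ, |quantizedResponse Δ ζ (response θ x ε ω) (φ ω)| ≤ ζ + Δ :=
  h.ae_abs_φ_le.mono fun _ hω =>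
    (abs_quantizedResponse_le hΔ hω).trans (by gcongr; exact abs_truncate_le hζ _)

lemma ae_mul_abs_quantizedResponse_div_le (hΔ : 0 ≤ Δ) (hM : 0 < M) (hζ : 0 ≤ ζ) {ρ B : ℝ}
    (hρ : 0 ≤ ρ) (hρ_le : ρ ≤ 1) (hB : 0 ≤ B) (hρζ : ρ * ζ ≤ B * responseScale l M) :
    ∀ᵐ ω ∂μ, ρ * |quantizedResponse Δ ζ (response θ x ε ω) (φ ω) / (Δ + responseScale l M)|
      ≤ B + 1 := by
  have hm := responseScale_pos l hM
  refine (h.ae_abs_quantizedResponse_le hΔ hζ).mono fun ω hω => ?_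
  rw [abs_div, abs_of_pos (by positivity : 0 < Δ + responseScale l M), mul_div_assoc',
    div_le_iff₀ (by positivity)]
  calc ρ * |quantizedResponse Δ ζ (response θ x ε ω) (φ ω)| ≤ ρ * ζ + ρ * Δ := by
        rw [← mul_add]
        gcongr
    _ ≤ B * responseScale l M + 1 * Δ := by gcongr
    _ ≤ (B + 1) * (Δ + responseScale l M) := by nlinarith [mul_nonneg hB hΔ]

variable [IsProbabilityMeasure μ]

lemma hasSubgaussianScale_x (hσ : 0 < σ) (hΔb : 0 ≤ Δb) :
    HasSubgaussianScale μ (subgScale σ Δb) x :=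
  hasSubgaussianScale_of_psi2NormVec_le hσ (by unfold subgScale; linarith) h.psi2NormVec_x_le

lemma memLp_x (hσ : 0 < σ) (hΔb : 0 ≤ Δb) (i : Fin d) : MemLp (fun ω => x ω i) 2 μ :=
  (h.hasSubgaussianScale_x hσ hΔb).memLp_apply (subgScale_pos hσ hΔb) h.measurable_x i

lemma memLp_covariate (hσ : 0 < σ) (hΔb : 0 ≤ Δb) (i : Fin d) :
    MemLp (fun ω => quantizedCovariate Δb (x ω) (τ ω) i) 2 μ :=
  (h.hasSubgaussianScale_covariate hσ hΔb h.psi2NormVec_x_le).memLp_apply (subgScale_pos hσ hΔb)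
    h.measurable_covariate i

lemma memLp_response (hl : 1 ≤ l) (hM : 0 < M) : MemLp (response θ x ε) 2 μ :=
  memLp_two_of_lintegral_rpow_div_le (lintegral_rpow_div_le (by linarith) hM
    h.lintegral_response_le) hl (responseScale_pos l hM) (h.measurable_response θ)

lemma le_four_mul_subgScale_sq (hσ : 0 < σ) (hΔb : 0 ≤ Δb) (hd : 0 < d) :
    κ ≤ 4 * subgScale σ Δb ^ 2 := by
  let i : Fin d := ⟨0, hd⟩
  have hS := subgScale_pos hσ hΔb
  have := h.measurable_x
  calc κ ≤ ∫ ω, x ω i ^ 2 ∂μ := by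
        simpa [secondMoment, sq] using h.mul_dotProduct_self_le (Pi.single i 1)
    _ ≤ subgScale σ Δb ^ 2 * 4 := by
        refine integral_le_of_lintegral_ofReal_le (by fun_prop) (fun _ => sq_nonneg _)
          (by positivity) ((lintegral_mono fun ω => ENNReal.ofReal_le_ofReal ?_).trans
            (lintegral_ofReal_const_mul_le (sq_nonneg _) (by
              simpa using (h.hasSubgaussianScale_x hσ hΔb).lintegral_exp_apply i)))
        rw [← div_le_iff₀' (by positivity), ← div_pow]
        linarith [Real.add_one_le_exp ((x ω i / subgScale σ Δb) ^ 2)]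
    _ = 4 * subgScale σ Δb ^ 2 := mul_comm _ _

lemma mul_l2Norm_sq_le (hσ : 0 < σ) (hΔb : 0 ≤ Δb) (hl : 1 ≤ l) (hM : 0 < M) :
    κ * l2Norm θ ^ 2 ≤ 2 * responseScale l M ^ 2 := by
  have := h.measurable_response θ
  calc κ * l2Norm θ ^ 2 ≤ θ ⬝ᵥ secondMoment μ x *ᵥ θ := by
        rw [l2Norm_sq]
        exact h.mul_dotProduct_self_le θ
    _ ≤ ∫ ω, response θ x ε ω ^ 2 ∂μ :=
        quadraticForm_secondMoment_le_integral_response_sq (h.memLp_x hσ hΔb)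
          (h.memLp_response hl hM) h.indep_x_ε h.integral_x
    _ ≤ responseScale l M ^ 2 * 2 :=
        integral_le_of_lintegral_ofReal_le (by fun_prop) (fun _ => sq_nonneg _) (by positivity)
          (lintegral_sq_le_of_lintegral_rpow_div_le (lintegral_rpow_div_le (by linarith) hM
            h.lintegral_response_le) hl (responseScale_pos l hM))
    _ = 2 * responseScale l M ^ 2 := mul_comm _ _

lemma secondMoment_covariate_mulVec (hσ : 0 < σ) (hΔb : 0 ≤ Δb) (v : Fin d → ℝ) :
    secondMoment μ (fun ω => quantizedCovariate Δb (x ω) (τ ω)) *ᵥ v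
      = secondMoment μ x *ᵥ v + (Δb ^ 2 / 4) • v := by
  rw [h.secondMoment_covariate hΔb (h.memLp_x hσ hΔb) (h.memLp_covariate hσ hΔb), Matrix.add_mulVec,
    Matrix.smul_mulVec, Matrix.one_mulVec]

lemma le_dotProduct_secondMoment_covariate_mulVec (hσ : 0 < σ) (hΔb : 0 ≤ Δb) (v : Fin d → ℝ) :
    κ * (v ⬝ᵥ v) + Δb ^ 2 / 4 * (v ⬝ᵥ v)
      ≤ v ⬝ᵥ secondMoment μ (fun ω => quantizedCovariate Δb (x ω) (τ ω)) *ᵥ v := by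
  rw [h.secondMoment_covariate_mulVec hσ hΔb, dotProduct_add, dotProduct_smul, smul_eq_mul]
  gcongr
  exact h.mul_dotProduct_self_le v

lemma integral_quantizedResponse_mul_covariate_eq (hσ : 0 < σ) (hΔ : 0 ≤ Δ) (hΔb : 0 ≤ Δb)
    (hζ : 0 ≤ ζ) (i : Fin d) :
    ∫ ω, quantizedResponse Δ ζ (response θ x ε ω) (φ ω) * quantizedCovariate Δb (x ω) (τ ω) i ∂μ
      = ∫ ω, truncate ζ (response θ x ε ω) * x ω i ∂μ := by
  have hresponse : MemLp (fun ω => quantizedResponse Δ ζ (response θ x ε ω) (φ ω)) 2 μ :=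
    MemLp.of_bound (h.measurable_response_quantized hζ θ).aestronglyMeasurable _
      (h.ae_abs_quantizedResponse_le hΔ hζ)
  exact h.integral_quantizedResponse_mul_covariate hΔ hΔb hζ θ i
    (integrable_mul_of_memLp_two hresponse (h.memLp_covariate hσ hΔb i))

lemma abs_integral_quantizedResponse_mul_covariate_sub_le (hσ : 0 < σ) (hΔ : 0 ≤ Δ)
    (hΔb : 0 ≤ Δb) (hl : 1 < l) (hM : 0 < M) (hζ : 0 < ζ) (i : Fin d) :
    |∫ ω, quantizedResponse Δ ζ (response θ x ε ω) (φ ω) * quantizedCovariate Δb (x ω) (τ ω) i ∂μ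
        - (secondMoment μ x *ᵥ θ) i|
      ≤ responseScale l M * subgScale σ Δb * (responseScale l M / ζ) ^ l * biasConst l := by
  have hx := h.measurable_x
  rw [h.integral_quantizedResponse_mul_covariate_eq hσ hΔ hΔb hζ.le i,
    ← integral_response_mul_apply (h.memLp_x hσ hΔb) (h.memLp_response hl.le hM) h.indep_x_ε
      h.integral_x i]
  exact abs_integral_truncate_mul_sub_le
    (lintegral_rpow_div_le (by linarith) hM h.lintegral_response_le) hl (responseScale_pos l hM)
    (subgScale_pos hσ hΔb) hζ (h.measurable_response θ) (by fun_prop)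
    ((h.hasSubgaussianScale_x hσ hΔb).lintegral_exp_apply i)

end RegressionSample

section RegressionFamily

variable {Ω : Type*} [MeasurableSpace Ω] {μ : Measure Ω} [IsProbabilityMeasure μ] {n d : ℕ}
  {Δ Δb σ κ l M ζ : ℝ} {θ : Fin d → ℝ} {x : Fin n → Ω → Fin d → ℝ} {ε φ : Fin n → Ω → ℝ}
  {τ : Fin n → Ω → Fin d → ℝ}

lemma measureReal_exists_regression_gradient_gt_le (hn : 0 < n) (hσ : 0 < σ) (hΔ : 0 ≤ Δ)
    (hΔb : 0 ≤ Δb) (hl : 1 < l) (hM : 0 < M) (hζ : 0 < ζ)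
    (h : ∀ k, RegressionSample μ Δ Δb σ κ l M θ (x k) (ε k) (φ k) (τ k))
    (hind : iIndepFun (fun k ω => (x k ω, ε k ω, φ k ω, τ k ω)) μ) {B ρ : ℝ} (hB : 0 ≤ B)
    (hρ : 0 ≤ ρ) (hρ_le : ρ ≤ 1 / 2) (hρζ : ρ * ζ ≤ B * responseScale l M)
    (hbias : (responseScale l M / ζ) ^ l * biasConst l ≤ ρ) :
    μ.real {ω | ∃ i, (Δ + responseScale l M) * subgScale σ Δb * (ρ * (B + 1 + momentConst l))
        + subgScale σ Δb ^ 2 * l2Norm θ * (33 * ρ) + responseScale l M * subgScale σ Δb * ρ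
        < |(vecB (fun k => quantizedCovariate Δb (x k ω) (τ k ω))
              (fun k => quantizedResponse Δ ζ (response θ (x k) (ε k) ω) (φ k ω))
            - matQ Δb (fun k => quantizedCovariate Δb (x k ω) (τ k ω)) *ᵥ θ) i|}
      ≤ d * (4 * Real.exp (-(n * ρ ^ 2))) := by
  have hm := responseScale_pos l hM
  have hS := subgScale_pos hσ hΔb
  have hobservation : Measurable fun p : (Fin d → ℝ) × ℝ × ℝ × (Fin d → ℝ) =>
      (quantizedCovariate Δb p.1 p.2.2.2, quantizedResponse Δ ζ (p.1 ⬝ᵥ θ + p.2.1) p.2.2.1) := by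
    fun_prop (disch := exact hζ.le)
  refine measureReal_exists_gradient_gt_le hn (hind.comp (fun _ => _) fun _ => hobservation)
    (fun k => (h k).measurable_covariate) (fun k => (h k).measurable_response_quantized hζ.le θ) hS
    (fun k => (h k).hasSubgaussianScale_covariate hσ hΔb (h k).psi2NormVec_x_le) hl
    (by positivity : 0 < Δ + responseScale l M)
    (fun k => lintegral_rpow_quantizedResponse_le (lintegral_rpow_div_le (by linarith) hM
      (h k).lintegral_response_le) hΔ hζ.le (by linarith) hm (h k).ae_abs_φ_le)
    (by linarith) hρ hρ_le
    (fun k => (h k).ae_mul_abs_quantizedResponse_div_le hΔ hM hζ.le hρ (by linarith) hB hρζ)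
    fun k i => ?_
  rw [(h k).secondMoment_covariate_mulVec hσ hΔb, Pi.add_apply, Pi.smul_apply, smul_eq_mul,
    add_sub_cancel_right]
  calc _ ≤ responseScale l M * subgScale σ Δb * (responseScale l M / ζ) ^ l * biasConst l :=
        (h k).abs_integral_quantizedResponse_mul_covariate_sub_le hσ hΔ hΔb hl hM hζ i
    _ = responseScale l M * subgScale σ Δb * ((responseScale l M / ζ) ^ l * biasConst l) := by ring
    _ ≤ responseScale l M * subgScale σ Δb * ρ := by gcongr

lemma measureReal_not_regression_strong_convexity_le (hn : 0 < n) (hd : 0 < d) (hσ : 0 < σ)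
    (hΔb : 0 ≤ Δb) (hκ : 0 ≤ κ)
    (h : ∀ k, RegressionSample μ Δ Δb σ κ l M θ (x k) (ε k) (φ k) (τ k))
    (hind : iIndepFun (fun k ω => (x k ω, ε k ω, φ k ω, τ k ω)) μ) {p : ℕ} (hp : 1 < p) :
    μ.real {ω | ∃ v, v ⬝ᵥ matQ Δb (fun k => quantizedCovariate Δb (x k ω) (τ k ω)) *ᵥ v
        < κ / 2 * (v ⬝ᵥ v) - 3 * subgScale σ Δb ^ 2 / (p - 1) * l1Norm v ^ 2}
      ≤ d * Real.exp (-n)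
        + Real.exp (p * Real.log (2 * d) - n * (κ ^ 2 / (128 * subgScale σ Δb ^ 4))) := by
  have hcovariate : Measurable fun p : (Fin d → ℝ) × ℝ × ℝ × (Fin d → ℝ) =>
      quantizedCovariate Δb p.1 p.2.2.2 := by fun_prop
  exact measureReal_not_restricted_strong_convexity_le hn hd
    (hind.comp (fun _ => _) fun _ => hcovariate) (fun k => (h k).measurable_covariate)
    (subgScale_pos hσ hΔb)
    (fun k => (h k).hasSubgaussianScale_covariate hσ hΔb (h k).psi2NormVec_x_le) hκ
    (fun k => (h k).le_dotProduct_secondMoment_covariate_mulVec hσ hΔb) hp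

lemma exists_measurableSet_gradient_le_and_strong_convexity (hn : 0 < n) (hd : 0 < d) (hσ : 0 < σ)
    (hΔ : 0 ≤ Δ) (hΔb : 0 ≤ Δb) (hκ : 0 ≤ κ) (hl : 1 < l) (hM : 0 < M) (hζ : 0 < ζ)
    (h : ∀ k, RegressionSample μ Δ Δb σ κ l M θ (x k) (ε k) (φ k) (τ k))
    (hind : iIndepFun (fun k ω => (x k ω, ε k ω, φ k ω, τ k ω)) μ) {B ρ : ℝ} (hB : 0 ≤ B)
    (hρ : 0 ≤ ρ) (hρ_le : ρ ≤ 1 / 2) (hρζ : ρ * ζ ≤ B * responseScale l M)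
    (hbias : (responseScale l M / ζ) ^ l * biasConst l ≤ ρ) {p : ℕ} (hp : 1 < p)
    (hcard : p * Real.log (2 * d) + n * ρ ^ 2
      ≤ n * (κ ^ 2 / (128 * subgScale σ Δb ^ 4))) :
    ∃ E, MeasurableSet E ∧ 1 - 6 * (d * Real.exp (-(n * ρ ^ 2))) ≤ μ.real E ∧ ∀ ω ∈ E,
      (∀ i, |(vecB (fun k => quantizedCovariate Δb (x k ω) (τ k ω))
              (fun k => quantizedResponse Δ ζ (response θ (x k) (ε k) ω) (φ k ω))
            - matQ Δb (fun k => quantizedCovariate Δb (x k ω) (τ k ω)) *ᵥ θ) i|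
        ≤ (Δ + responseScale l M) * subgScale σ Δb * (ρ * (B + 1 + momentConst l))
          + subgScale σ Δb ^ 2 * l2Norm θ * (33 * ρ) + responseScale l M * subgScale σ Δb * ρ) ∧
      ∀ v, κ / 2 * (v ⬝ᵥ v) - 3 * subgScale σ Δb ^ 2 / (p - 1) * l1Norm v ^ 2
        ≤ v ⬝ᵥ matQ Δb (fun k => quantizedCovariate Δb (x k ω) (τ k ω)) *ᵥ v := by
  have hd_one : (1 : ℝ) ≤ d := by exact_mod_cast hd
  have hexp_n : Real.exp (-n) ≤ Real.exp (-(n * ρ ^ 2)) := Real.exp_le_exp.2 <|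
    neg_le_neg <| mul_le_of_le_one_right n.cast_nonneg (pow_le_one₀ hρ (by linarith))
  have hexp_maurey : Real.exp (p * Real.log (2 * d) - n * (κ ^ 2 / (128 * subgScale σ Δb ^ 4)))
      ≤ d * Real.exp (-(n * ρ ^ 2)) :=
    (Real.exp_le_exp.2 (by linarith)).trans (le_mul_of_one_le_left (Real.exp_pos _).le hd_one)
  have hfailure := (measureReal_union_le _ _).trans (add_le_add
    (measureReal_exists_regression_gradient_gt_le hn hσ hΔ hΔb hl hM hζ h hind hB hρ hρ_le hρζ
      hbias)
    (measureReal_not_regression_strong_convexity_le hn hd hσ hΔb hκ h hind hp))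
  obtain ⟨E, hE, hE_prob, hE_good⟩ := exists_measurableSet_forall_notMem <| hfailure.trans <|
    calc _ ≤ d * (4 * Real.exp (-(n * ρ ^ 2)))
          + (d * Real.exp (-(n * ρ ^ 2)) + d * Real.exp (-(n * ρ ^ 2))) := by gcongr
      _ = 6 * (d * Real.exp (-(n * ρ ^ 2))) := by ring
  exact ⟨E, hE, hE_prob, fun ω hω => by
    simpa only [Set.mem_union, Set.mem_ofPred_eq, not_or, not_exists, not_lt] using hE_good ω hω⟩

end RegressionFamily

section Parameters

lemma responseScale_sq {l M : ℝ} (hl : l ≠ 0) (hM : 0 ≤ M) :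
    responseScale l M ^ 2 = M ^ (1 / l) := by
  rw [responseScale, ← Real.rpow_mul_natCast hM]
  congr 1
  push_cast
  field_simp

lemma threshold_eq {l M σ D L N : ℝ} (hl : l ≠ 0) (hM : 0 < M) (hL : 0 ≤ L) (hN : 0 ≤ N) :
    √(σ * M ^ (1 / l) / (σ + D) * (N / L))
      = responseScale l M * √(σ / (σ + D)) / √(L / N) := by
  calc √(σ * M ^ (1 / l) / (σ + D) * (N / L))
      = √(responseScale l M ^ 2 * (σ / (σ + D)) / (L / N)) := by
        rw [responseScale_sq hl hM.le, div_div_eq_mul_div, mul_div_assoc']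
        congr 1
        ring
    _ = responseScale l M * √(σ / (σ + D)) / √(L / N) := by
        rw [Real.sqrt_div' _ (by positivity), Real.sqrt_mul (sq_nonneg _),
          Real.sqrt_sq (responseScale_pos l hM).le]

lemma sqrt_mul_threshold_le {l b M σ D L N ζ : ℝ} (hl : l ≠ 0) (hM : 0 < M) (hσ : 0 < σ)
    (hD : 0 ≤ D) (hb : 0 ≤ b) (hL : 0 < L) (hN : 0 < N)
    (hζ : ζ ≤ b * √(σ * M ^ (1 / l) / (σ + D) * (N / L))) :
    √(L / N) * ζ ≤ b * responseScale l M := by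
  have hm := responseScale_pos l hM
  have hr : 0 < √(L / N) := Real.sqrt_pos.2 (by positivity)
  have hle_one : √(σ / (σ + D)) ≤ 1 := Real.sqrt_le_one.2 (div_le_one_of_le₀ (by linarith)
    (by positivity))
  rw [threshold_eq hl hM hL.le hN.le] at hζ
  calc √(L / N) * ζ ≤ √(L / N) * (b * (responseScale l M * √(σ / (σ + D)) / √(L / N))) := by gcongr
    _ = b * responseScale l M * √(σ / (σ + D)) := by field_simp
    _ ≤ b * responseScale l M := mul_le_of_le_one_right (by positivity) hle_one

/-- The slope, in terms of the rate `√(δ log d / n)`, of the bound on `M ^ (1 / (2 l)) / ζ` provided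
by the lower bound on the truncation threshold `ζ`. -/
def truncationSlope (a σ Δ Δb : ℝ) : ℝ := √((σ + (Δ + Δb)) / σ) / a

lemma truncationSlope_pos {a σ Δ Δb : ℝ} (ha : 0 < a) (hσ : 0 < σ) (hΔ : 0 ≤ Δ) (hΔb : 0 ≤ Δb) :
    0 < truncationSlope a σ Δ Δb := by
  unfold truncationSlope
  positivity

lemma responseScale_div_threshold_le {l a M σ Δ Δb D L N ζ : ℝ} (hl : l ≠ 0) (ha : 0 < a)
    (hM : 0 < M) (hσ : 0 < σ) (hD : 0 ≤ D) (hD_le : D ≤ Δ + Δb) (hL : 0 < L) (hN : 0 < N)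
    (hζ : 0 < ζ) (hζ_ge : a * √(σ * M ^ (1 / l) / (σ + D) * (N / L)) ≤ ζ) :
    responseScale l M / ζ ≤ truncationSlope a σ Δ Δb * √(L / N) := by
  have hm := responseScale_pos l hM
  have hr : 0 < √(L / N) := Real.sqrt_pos.2 (by positivity)
  have hone_le : 1 ≤ √((σ + (Δ + Δb)) / σ) * √(σ / (σ + D)) := by
    rw [← Real.sqrt_mul' _ (by positivity), Real.one_le_sqrt, div_mul_div_comm, mul_comm σ,
      one_le_div (by positivity)]
    gcongr
  rw [threshold_eq hl hM hL.le hN.le] at hζ_ge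
  rw [div_le_iff₀ hζ, truncationSlope]
  calc responseScale l M
      ≤ √((σ + (Δ + Δb)) / σ) * √(σ / (σ + D)) * responseScale l M :=
        le_mul_of_one_le_left hm.le hone_le
    _ = √((σ + (Δ + Δb)) / σ) / a * √(L / N)
          * (a * (responseScale l M * √(σ / (σ + D)) / √(L / N))) := by field_simp
    _ ≤ _ := by gcongr

/-- The largest rate `√(δ log d / n)` at which the truncation bias stays below the rate itself. -/
def biasRadius (l a σ Δ Δb : ℝ) : ℝ :=
  (truncationSlope a σ Δ Δb ^ l * biasConst l) ^ (-(1 / (l - 1)))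

lemma biasRadius_pos {l a σ Δ Δb : ℝ} (ha : 0 < a) (hσ : 0 < σ) (hΔ : 0 ≤ Δ) (hΔb : 0 ≤ Δb) :
    0 < biasRadius l a σ Δ Δb := by
  have := truncationSlope_pos ha hσ hΔ hΔb
  have := biasConst_pos l
  unfold biasRadius
  positivity

lemma rpow_mul_biasConst_le {l a σ Δ Δb r z : ℝ} (hl : 1 < l) (ha : 0 < a) (hσ : 0 < σ)
    (hΔ : 0 ≤ Δ) (hΔb : 0 ≤ Δb) (hr : 0 < r) (hr_le : r ≤ biasRadius l a σ Δ Δb) (hz : 0 ≤ z)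
    (hz_le : z ≤ truncationSlope a σ Δ Δb * r) : z ^ l * biasConst l ≤ r := by
  set A := truncationSlope a σ Δ Δb
  set K := biasConst l
  have hA : 0 < A := truncationSlope_pos ha hσ hΔ hΔb
  have hK : 0 < K := biasConst_pos l
  have hl_sub : 0 < l - 1 := sub_pos.2 hl
  have hr_rpow : r ^ (l - 1) ≤ (A ^ l * K)⁻¹ := by
    calc r ^ (l - 1) ≤ ((A ^ l * K) ^ (-(1 / (l - 1)))) ^ (l - 1) :=
          Real.rpow_le_rpow hr.le hr_le hl_sub.le
      _ = (A ^ l * K)⁻¹ := by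
          rw [← Real.rpow_mul (by positivity), neg_mul, one_div_mul_cancel hl_sub.ne',
            Real.rpow_neg_one]
  calc z ^ l * K ≤ (A * r) ^ l * K := by gcongr
    _ = A ^ l * K * r ^ (l - 1) * r := by
        rw [Real.mul_rpow hA.le hr.le, mul_assoc _ (r ^ (l - 1)), ← Real.rpow_add_one hr.ne',
          sub_add_cancel]
        ring
    _ ≤ A ^ l * K * (A ^ l * K)⁻¹ * r := by gcongr
    _ = r := by rw [mul_inv_cancel₀ (by positivity), one_mul]

/-- The constant `C₀` bounding the penalty constant from below, in terms of the moment order and of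
the constant in the upper bound on the truncation threshold. -/
def minPenaltyConst (l b : ℝ) : ℝ := 18 * (2 * (b + 1 + momentConst l) + 68)

lemma minPenaltyConst_pos (l : ℝ) {b : ℝ} (hb : 0 ≤ b) : 0 < minPenaltyConst l b := by
  have := momentConst_nonneg l
  unfold minPenaltyConst
  positivity

/-- The regularization parameter `λ` with constant `C` at the rate `r = √(δ log d / n)`. -/
def penaltyLevel (C l κ σ Δ Δb M r : ℝ) : ℝ :=
  C * ((σ + Δb) ^ 2 / √κ) * (Δ + responseScale l M) * r

lemma penaltyLevel_pos {C κ σ Δ Δb M r : ℝ} (l : ℝ) (hC : 0 < C) (hκ : 0 < κ) (hσ : 0 < σ)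
    (hΔ : 0 ≤ Δ) (hΔb : 0 ≤ Δb) (hM : 0 < M) (hr : 0 < r) :
    0 < penaltyLevel C l κ σ Δ Δb M r := by
  have := responseScale_pos l hM
  unfold penaltyLevel
  positivity

lemma penaltyLevel_div_half {C l κ σ Δ Δb M r : ℝ} (hκ : 0 < κ) :
    penaltyLevel C l κ σ Δ Δb M r / (κ / 2) = 2 * C * errorFactor l κ σ Δ Δb M * r := by
  have hpow : κ ^ (3 / 2 : ℝ) = κ * √κ := by
    rw [Real.sqrt_eq_rpow, ← Real.rpow_one_add' hκ.le (by norm_num)]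
    norm_num
  rw [penaltyLevel, errorFactor, hpow, responseScale]
  have := Real.sqrt_pos.2 hκ
  field_simp

lemma gradient_bound_le_penaltyLevel {C l κ σ Δ Δb M r T b : ℝ} (hκ : 0 < κ) (hσ : 0 < σ)
    (hΔ : 0 ≤ Δ) (hΔb : 0 ≤ Δb) (hM : 0 < M) (hr : 0 ≤ r) (hb : 0 ≤ b)
    (hC : minPenaltyConst l b ≤ C) (hκ_le : κ ≤ 4 * subgScale σ Δb ^ 2)
    (hT : κ * T ^ 2 ≤ 2 * responseScale l M ^ 2) :
    (Δ + responseScale l M) * subgScale σ Δb * (r * (b + 1 + momentConst l))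
        + subgScale σ Δb ^ 2 * T * (33 * r) + responseScale l M * subgScale σ Δb * r
      ≤ penaltyLevel C l κ σ Δ Δb M r / 2 := by
  have hm := responseScale_pos l hM
  have hS := subgScale_pos hσ hΔb
  have hG := momentConst_nonneg l
  have hq : 0 < √κ := Real.sqrt_pos.2 hκ
  set m := responseScale l M
  set S := subgScale σ Δb with hS_def
  have hS_le : S ≤ S ^ 2 / √κ * 2 := by
    have : √κ ≤ 2 * S := Real.sqrt_le_iff.2 ⟨by positivity, by linarith⟩
    rw [div_mul_eq_mul_div, le_div_iff₀ hq]
    nlinarith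
  have hT_le : T ≤ 2 * m / √κ := by
    rw [le_div_iff₀' hq]
    refine abs_le_of_sq_le_sq' ?_ (by positivity) |>.2
    rw [mul_pow, Real.sq_sqrt hκ.le]
    linarith [sq_nonneg m]
  have hm_le : m ≤ Δ + m := by linarith
  calc (Δ + m) * S * (r * (b + 1 + momentConst l)) + S ^ 2 * T * (33 * r) + m * S * r
      ≤ (Δ + m) * (S ^ 2 / √κ * 2) * (r * (b + 1 + momentConst l))
          + S ^ 2 * (2 * (Δ + m) / √κ) * (33 * r) + (Δ + m) * (S ^ 2 / √κ * 2) * r := by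
        gcongr
        exact hT_le.trans (by gcongr)
    _ = (S / 3) ^ 2 / √κ * (Δ + m) * r * minPenaltyConst l b / 2 := by
        unfold minPenaltyConst
        ring
    _ ≤ (S / 3) ^ 2 / √κ * (Δ + m) * r * C / 2 := by gcongr
    _ = penaltyLevel C l κ σ Δ Δb M r / 2 := by
        rw [penaltyLevel, hS_def, subgScale]
        ring

/-- The exponential rate per observation in the lower-tail bound for the empirical quadratic form of
the quantized covariates. -/
def quadraticRate (κ σ Δb : ℝ) : ℝ := κ ^ 2 / (128 * subgScale σ Δb ^ 4)

lemma quadraticRate_pos {κ σ Δb : ℝ} (hκ : 0 < κ) (hσ : 0 < σ) (hΔb : 0 ≤ Δb) :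
    0 < quadraticRate κ σ Δb := by
  have := subgScale_pos hσ hΔb
  unfold quadraticRate
  positivity

lemma exists_maurey_length {γ L N : ℝ} (hγ : 0 < γ) (hL : 0 < L) (hN : 16 / γ * L ≤ N) :
    ∃ p : ℕ, 1 < p ∧ p * (2 * L) + L ≤ N * γ ∧ 1 / ((p : ℝ) - 1) ≤ 8 / γ * (L / N) := by
  have hN_pos : 0 < N := lt_of_lt_of_le (by positivity) hN
  rw [div_mul_eq_mul_div, div_le_iff₀ hγ] at hN
  set y := γ * N / (4 * L) with hy
  have hy_ge : 4 ≤ y := by rw [hy, le_div_iff₀ (by positivity)]; linarith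
  have hyL : y * (2 * L) = N * γ / 2 := by rw [hy]; field_simp; norm_num
  have hfloor_le : (⌊y⌋₊ : ℝ) ≤ y := Nat.floor_le (by linarith)
  have hlt_floor : y < ⌊y⌋₊ + 1 := Nat.lt_floor_add_one y
  refine ⟨⌊y⌋₊, Nat.one_lt_cast (α := ℝ) |>.1 (by linarith), ?_, ?_⟩
  · calc (⌊y⌋₊ : ℝ) * (2 * L) + L ≤ y * (2 * L) + L := by gcongr
      _ ≤ N * γ := by linarith
  · calc 1 / ((⌊y⌋₊ : ℝ) - 1) ≤ 1 / (y / 2) := one_div_le_one_div_of_le (by linarith) (by linarith)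
      _ = 8 / γ * (L / N) := by rw [hy]; field_simp; norm_num

/-- The largest value of `√(δ s log d / n)` at which the slack in the restricted strong convexity of
the empirical loss is absorbed by the penalty of level `C` on the `ℓ₁` ball of radius `R √s`. -/
def convexityRadius (C l κ σ Δ Δb M R : ℝ) : ℝ :=
  C * quadraticRate κ σ Δb * (Δ + responseScale l M) / (1728 * R * √κ)

lemma convexityRadius_pos {C κ σ Δ Δb M R : ℝ} (l : ℝ) (hC : 0 < C) (hκ : 0 < κ) (hσ : 0 < σ)
    (hΔ : 0 ≤ Δ) (hΔb : 0 ≤ Δb) (hM : 0 < M) (hR : 0 < R) :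
    0 < convexityRadius C l κ σ Δ Δb M R := by
  have := responseScale_pos l hM
  have := quadraticRate_pos hκ hσ hΔb
  unfold convexityRadius
  positivity

lemma convexity_slack_le_penaltyLevel {C l κ σ Δ Δb M R r t u : ℝ} (hκ : 0 < κ) (hσ : 0 < σ)
    (hΔb : 0 ≤ Δb) (hR : 0 < R) (hr : 0 ≤ r) (ht : 0 ≤ t)
    (ht_le : r * t ≤ convexityRadius C l κ σ Δ Δb M R)
    (hu : u ≤ 8 / quadraticRate κ σ Δb * r ^ 2) :
    3 * subgScale σ Δb ^ 2 * u * (2 * (R * t)) ≤ penaltyLevel C l κ σ Δ Δb M r / 4 := by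
  have hγ := quadraticRate_pos hκ hσ hΔb
  have : 0 < √κ := Real.sqrt_pos.2 hκ
  set γ := quadraticRate κ σ Δb with hγ_def
  calc 3 * subgScale σ Δb ^ 2 * u * (2 * (R * t))
      ≤ 3 * subgScale σ Δb ^ 2 * (8 / γ * r ^ 2) * (2 * (R * t)) := by gcongr
    _ = 48 * subgScale σ Δb ^ 2 * R / γ * r * (r * t) := by ring
    _ ≤ 48 * subgScale σ Δb ^ 2 * R / γ * r * convexityRadius C l κ σ Δ Δb M R := by gcongr
    _ = penaltyLevel C l κ σ Δ Δb M r / 4 := by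
        rw [penaltyLevel, convexityRadius, ← hγ_def, subgScale]
        field_simp
        ring

/-- The constant `c` in the sample-size condition `c δ s log d ≤ n`. -/
def sampleSizeConst (l a C κ σ Δ Δb M R : ℝ) : ℝ :=
  max (max ((1 / 2) ^ 2)⁻¹ (biasRadius l a σ Δ Δb ^ 2)⁻¹)
    (max (convexityRadius C l κ σ Δ Δb M R ^ 2)⁻¹ (16 / quadraticRate κ σ Δb))

lemma sampleSizeConst_pos (l a C κ σ Δ Δb M R : ℝ) : 0 < sampleSizeConst l a C κ σ Δ Δb M R :=
  lt_max_of_lt_left (lt_max_of_lt_left (by norm_num))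

lemma sqrt_div_mul_sqrt_le {L N s ρ : ℝ} (hs : 0 ≤ s) (hN : 0 < N) (hρ : 0 < ρ)
    (h : (ρ ^ 2)⁻¹ * (L * s) ≤ N) : √(L / N) * √s ≤ ρ := by
  rw [← Real.sqrt_mul' _ hs, Real.sqrt_le_left hρ.le, div_mul_eq_mul_div, div_le_iff₀ hN]
  rwa [inv_mul_le_iff₀ (by positivity)] at h

lemma rate_bounds_of_sampleSize {l a C κ σ Δ Δb M R L N s : ℝ} (ha : 0 < a) (hC : 0 < C)
    (hκ : 0 < κ) (hσ : 0 < σ) (hΔ : 0 ≤ Δ) (hΔb : 0 ≤ Δb) (hM : 0 < M) (hR : 0 < R) (hs : 1 ≤ s)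
    (hL : 0 < L) (hN : sampleSizeConst l a C κ σ Δ Δb M R * (L * s) ≤ N) :
    √(L / N) ≤ 1 / 2 ∧ √(L / N) ≤ biasRadius l a σ Δ Δb ∧
      √(L / N) * √s ≤ convexityRadius C l κ σ Δ Δb M R ∧ 16 / quadraticRate κ σ Δb * L ≤ N := by
  have hLs : L ≤ L * s := le_mul_of_one_le_right hL.le hs
  have hN_pos : 0 < N := lt_of_lt_of_le
    (mul_pos (sampleSizeConst_pos l a C κ σ Δ Δb M R) (hL.trans_le hLs)) hN
  have hsize {c : ℝ} (hc : c ≤ sampleSizeConst l a C κ σ Δ Δb M R) : c * (L * s) ≤ N :=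
    le_trans (by gcongr) hN
  have hrate {ρ : ℝ} (hρ : 0 < ρ) (hc : (ρ ^ 2)⁻¹ ≤ sampleSizeConst l a C κ σ Δ Δb M R) :
      √(L / N) * √s ≤ ρ := sqrt_div_mul_sqrt_le (by linarith) hN_pos hρ (hsize hc)
  have hrate_le : √(L / N) ≤ √(L / N) * √s :=
    le_mul_of_one_le_right (Real.sqrt_nonneg _) (Real.one_le_sqrt.2 hs)
  have hγ := quadraticRate_pos hκ hσ hΔb
  exact ⟨hrate_le.trans (hrate (by norm_num) (le_max_of_le_left (le_max_left _ _))),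
    hrate_le.trans (hrate (biasRadius_pos ha hσ hΔ hΔb) (le_max_of_le_left (le_max_right _ _))),
    hrate (convexityRadius_pos l hC hκ hσ hΔ hΔb hM hR) (le_max_of_le_right (le_max_left _ _)),
    le_trans (by gcongr) (hsize (le_max_of_le_right (le_max_right _ _)))⟩

lemma log_two_mul_le {d δ : ℝ} (hd : 2 ≤ d) (hδ : 1 ≤ δ) :
    Real.log (2 * d) ≤ 2 * (δ * Real.log d) := by
  have hlog : 0 ≤ Real.log d := Real.log_nonneg (by linarith)
  calc Real.log (2 * d) ≤ Real.log (d * d) := Real.log_le_log (by linarith) (by gcongr)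
    _ = 2 * (1 * Real.log d) := by rw [Real.log_mul (by linarith) (by linarith)]; ring
    _ ≤ 2 * (δ * Real.log d) := by gcongr

lemma mul_exp_neg_mul_log {d : ℝ} (hd : 0 < d) (δ : ℝ) :
    d * Real.exp (-(δ * Real.log d)) = d ^ (1 - δ) := by
  rw [Real.rpow_sub hd, Real.rpow_one, Real.exp_neg, Real.rpow_def_of_pos hd, mul_comm δ,
    div_eq_mul_inv]

end Parameters

section ErrorBounds

lemma regression_error_le {d s p : ℕ} {l σ Δ Δb κ M R b C r : ℝ} {Q : Matrix (Fin d) (Fin d) ℝ}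
    {g θs θ : Fin d → ℝ} (hσ : 0 < σ) (hΔ : 0 ≤ Δ) (hΔb : 0 ≤ Δb) (hκ : 0 < κ) (hM : 0 < M)
    (hR : 0 < R) (hb : 0 ≤ b) (hC : minPenaltyConst l b ≤ C) (hr : 0 < r)
    (hr_le : r * √s ≤ convexityRadius C l κ σ Δ Δb M R) (hp : 1 < p)
    (hp_le : 1 / ((p : ℝ) - 1) ≤ 8 / quadraticRate κ σ Δb * r ^ 2)
    (hθs : IsSparse s θs) (hθs_le : l2Norm θs ≤ R) (hκ_le : κ ≤ 4 * subgScale σ Δb ^ 2)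
    (hκθs : κ * l2Norm θs ^ 2 ≤ 2 * responseScale l M ^ 2)
    (hgrad : ∀ i, |(g - Q *ᵥ θs) i|
      ≤ (Δ + responseScale l M) * subgScale σ Δb * (r * (b + 1 + momentConst l))
        + subgScale σ Δb ^ 2 * l2Norm θs * (33 * r) + responseScale l M * subgScale σ Δb * r)
    (hconvex : ∀ v, κ / 2 * (v ⬝ᵥ v) - 3 * subgScale σ Δb ^ 2 / (p - 1) * l1Norm v ^ 2
      ≤ v ⬝ᵥ Q *ᵥ v)
    (hθ : IsStationary Q g (penaltyLevel C l κ σ Δ Δb M r) (R * √s) θ) :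
    l2Norm (θ - θs) ≤ 7 / 2 * C * errorFactor l κ σ Δ Δb M * (r * √s) ∧
      l1Norm (θ - θs) ≤ 28 * C * errorFactor l κ σ Δ Δb M * s * r := by
  have hp' : (0 : ℝ) < p - 1 := sub_pos.2 (by exact_mod_cast hp)
  have hfeasible : l1Norm θs ≤ R * √s := by
    rw [mul_comm]
    exact (l1Norm_le_sqrt_mul_l2Norm hθs).trans (by gcongr)
  have hslack : 3 * subgScale σ Δb ^ 2 / ((p : ℝ) - 1) * (2 * (R * √s))
      ≤ penaltyLevel C l κ σ Δ Δb M r / 4 := by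
    rw [div_eq_mul_one_div]
    exact convexity_slack_le_penaltyLevel hκ hσ hΔb hR hr.le (Real.sqrt_nonneg _) hr_le hp_le
  obtain ⟨hl2, hl1⟩ := stationary_error_bound
    (penaltyLevel_pos l ((minPenaltyConst_pos l hb).trans_le hC) hκ hσ hΔ hΔb hM hr)
    (half_pos hκ) (by positivity) hθ hθs hfeasible
    (fun i => (hgrad i).trans
      (gradient_bound_le_penaltyLevel hκ hσ hΔ hΔb hM hr.le hb hC hκ_le hκθs)) hslack hconvex
  rw [penaltyLevel_div_half hκ] at hl2 hl1
  exact ⟨hl2.trans_eq (by ring), hl1.trans_eq (by ring)⟩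

variable {n d s : ℕ} {l a b C κ σ Δ Δb M R δ D ζ r : ℝ} {θs : Fin d → ℝ} {Ω : Type*}
  [MeasurableSpace Ω] {μ : Measure Ω} [IsProbabilityMeasure μ] {x : Fin n → Ω → Fin d → ℝ}
  {ε φ : Fin n → Ω → ℝ} {τ : Fin n → Ω → Fin d → ℝ}

lemma exists_measurableSet_regression_error_le_of_rate (hl : 1 < l) (ha : 0 < a) (hb : 0 ≤ b)
    (hC : minPenaltyConst l b ≤ C) (hκ : 0 < κ) (hσ : 0 < σ) (hΔ : 0 ≤ Δ) (hΔb : 0 ≤ Δb)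
    (hM : 0 < M) (hR : 0 < R) (hn : 0 < n) (hd : 0 < d)
    (h : ∀ k, RegressionSample μ Δ Δb σ κ l M θs (x k) (ε k) (φ k) (τ k))
    (hind : iIndepFun (fun k ω => (x k ω, ε k ω, φ k ω, τ k ω)) μ)
    (hθs : IsSparse s θs) (hθs_le : l2Norm θs ≤ R) (hζ : 0 < ζ)
    (hζ_le : r * ζ ≤ b * responseScale l M)
    (hζ_ge : responseScale l M / ζ ≤ truncationSlope a σ Δ Δb * r) (hr : 0 < r)
    (hr_half : r ≤ 1 / 2) (hr_bias : r ≤ biasRadius l a σ Δ Δb)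
    (hr_convex : r * √s ≤ convexityRadius C l κ σ Δ Δb M R)
    (hlog : Real.log (2 * d) ≤ 2 * (n * r ^ 2))
    (hn_ge : 16 / quadraticRate κ σ Δb * (n * r ^ 2) ≤ n) :
    ∃ E, MeasurableSet E ∧ 1 - 6 * (d * Real.exp (-(n * r ^ 2))) ≤ μ.real E ∧ ∀ ω ∈ E, ∀ θ,
      IsStationary (matQ Δb fun k => quantizedCovariate Δb (x k ω) (τ k ω))
        (vecB (fun k => quantizedCovariate Δb (x k ω) (τ k ω))
          fun k => quantizedResponse Δ ζ (response θs (x k) (ε k) ω) (φ k ω))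
        (penaltyLevel C l κ σ Δ Δb M r) (R * √s) θ →
      l2Norm (θ - θs) ≤ 7 / 2 * C * errorFactor l κ σ Δ Δb M * (r * √s) ∧
        l1Norm (θ - θs) ≤ 28 * C * errorFactor l κ σ Δ Δb M * s * r := by
  have hn' : (0 : ℝ) < n := by exact_mod_cast hn
  obtain ⟨p, hp, hp_card, hp_slack⟩ :=
    exists_maurey_length (quadraticRate_pos hκ hσ hΔb) (by positivity) hn_ge
  rw [mul_div_cancel_left₀ _ hn'.ne'] at hp_slack
  have hm := responseScale_pos l hM
  obtain ⟨E, hE, hE_prob, hE_good⟩ := exists_measurableSet_gradient_le_and_strong_convexity hn hd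
    hσ hΔ hΔb hκ.le hl hM hζ h hind hb hr.le hr_half hζ_le
    (rpow_mul_biasConst_le hl ha hσ hΔ hΔb hr hr_bias (by positivity) hζ_ge) hp
    (le_trans (by gcongr) hp_card)
  let k : Fin n := ⟨0, hn⟩
  exact ⟨E, hE, hE_prob, fun ω hω θ hθ =>
    regression_error_le hσ hΔ hΔb hκ hM hR hb hC hr hr_convex hp hp_slack hθs hθs_le
      ((h k).le_four_mul_subgScale_sq hσ hΔb hd) ((h k).mul_l2Norm_sq_le hσ hΔb hl.le hM)
      (hE_good ω hω).1 (hE_good ω hω).2 hθ⟩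

lemma exists_measurableSet_regression_error_le (hl : 1 < l) (ha : 0 < a) (hb : 0 ≤ b)
    (hC : minPenaltyConst l b ≤ C) (hκ : 0 < κ) (hσ : 0 < σ) (hΔ : 0 ≤ Δ) (hΔb : 0 ≤ Δb)
    (hM : 0 < M) (hR : 0 < R) (hd : 2 ≤ d) (hs : 0 < s) (hδ : 1 ≤ δ)
    (h : ∀ k, RegressionSample μ Δ Δb σ κ l M θs (x k) (ε k) (φ k) (τ k))
    (hind : iIndepFun (fun k ω => (x k ω, ε k ω, φ k ω, τ k ω)) μ)
    (hθs : IsSparse s θs) (hθs_le : l2Norm θs ≤ R) (hD : 0 ≤ D) (hD_le : D ≤ Δ + Δb)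
    (hζ_ge : a * √(σ * M ^ (1 / l) / (σ + D) * (n / (δ * Real.log d))) ≤ ζ)
    (hζ_le : ζ ≤ b * √(σ * M ^ (1 / l) / (σ + D) * (n / (δ * Real.log d))))
    (hn : sampleSizeConst l a C κ σ Δ Δb M R * (δ * s * Real.log d) ≤ n) :
    ∃ E, MeasurableSet E ∧ 1 - 6 * (d : ℝ) ^ (1 - δ) ≤ μ.real E ∧ ∀ ω ∈ E, ∀ θ,
      IsStationary (matQ Δb fun k => quantizedCovariate Δb (x k ω) (τ k ω))
        (vecB (fun k => quantizedCovariate Δb (x k ω) (τ k ω))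
          fun k => quantizedResponse Δ ζ (response θs (x k) (ε k) ω) (φ k ω))
        (penaltyLevel C l κ σ Δ Δb M √(δ * Real.log d / n)) (R * √s) θ →
      l2Norm (θ - θs) ≤ 7 / 2 * C * errorFactor l κ σ Δ Δb M * √(δ * s * Real.log d / n) ∧
        l1Norm (θ - θs) ≤ 28 * C * errorFactor l κ σ Δ Δb M * s * √(δ * Real.log d / n) := by
  have hlog : 0 < Real.log d := Real.log_pos (by exact_mod_cast hd)
  have hL : 0 < δ * Real.log d := by positivity
  have hs' : (1 : ℝ) ≤ s := by exact_mod_cast hs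
  have hn_pos : (0 : ℝ) < n := by
    have := sampleSizeConst_pos l a C κ σ Δ Δb M R
    exact lt_of_lt_of_le (by positivity) hn
  have hr : 0 < √(δ * Real.log d / n) := Real.sqrt_pos.2 (by positivity)
  have hr_sq : n * √(δ * Real.log d / n) ^ 2 = δ * Real.log d := by
    rw [Real.sq_sqrt (by positivity), mul_div_cancel₀ _ hn_pos.ne']
  have hr_s : √(δ * s * Real.log d / n) = √(δ * Real.log d / n) * √s := by
    rw [← Real.sqrt_mul (by positivity), div_mul_eq_mul_div, mul_right_comm]
  obtain ⟨hr_half, hr_bias, hr_convex, hn_maurey⟩ := rate_bounds_of_sampleSize ha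
    ((minPenaltyConst_pos l hb).trans_le hC) hκ hσ hΔ hΔb hM hR hs' hL
    (hn.trans_eq' (by rw [mul_right_comm δ]))
  have hζ : 0 < ζ := lt_of_lt_of_le (by positivity) hζ_ge
  have hexp : d * Real.exp (-(n * √(δ * Real.log d / n) ^ 2)) = d ^ (1 - δ) := by
    rw [hr_sq, mul_exp_neg_mul_log (by positivity)]
  rw [hr_s, ← hexp]
  exact exists_measurableSet_regression_error_le_of_rate hl ha hb hC hκ hσ hΔ hΔb hM hR
    (by exact_mod_cast hn_pos) (by omega) h hind hθs hθs_le hζ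
    (sqrt_mul_threshold_le (by positivity) hM hσ hD hb hL hn_pos hζ_le)
    (responseScale_div_threshold_le (by positivity) ha hM hσ hD hD_le hL hn_pos hζ hζ_ge) hr
    hr_half hr_bias hr_convex
    (by rw [hr_sq]; exact log_two_mul_le (by exact_mod_cast hd) hδ) (by rwa [hr_sq])

end ErrorBounds

end QCS

end

open QCS in
theorem theorem4p1_general {n d s : ℕ} {l a b C κ σ Δ Δb M R δ D ζ : ℝ} {θs : Fin d → ℝ}
    {Ω : Type*} [MeasurableSpace Ω] {μ : Measure Ω} [IsProbabilityMeasure μ]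
    {x : Fin n → Ω → Fin d → ℝ} {ε φ : Fin n → Ω → ℝ} {τ : Fin n → Ω → Fin d → ℝ} (hl : 1 < l)
    (ha : 0 < a) (hb : 0 ≤ b) (hC : minPenaltyConst l b ≤ C) (hκ : 0 < κ) (hσ : 0 < σ)
    (hΔ : 0 ≤ Δ) (hΔb : 0 ≤ Δb) (hM : 0 < M) (hR : 0 < R) (hd : 2 ≤ d)
    (h : ∀ k, RegressionSample μ Δ Δb σ κ l M θs (x k) (ε k) (φ k) (τ k))
    (hind : iIndepFun (fun k ω => (x k ω, ε k ω, φ k ω, τ k ω)) μ)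
    (hθs : IsSparse s θs) (hθs_le : l2Norm θs ≤ R) (hD : 0 ≤ D) (hD_le : D ≤ Δ + Δb)
    (hζ_ge : a * √(σ * M ^ (1 / l) / (σ + D) * (n / (δ * Real.log d))) ≤ ζ)
    (hζ_le : ζ ≤ b * √(σ * M ^ (1 / l) / (σ + D) * (n / (δ * Real.log d))))
    (hn : sampleSizeConst l a C κ σ Δ Δb M R * (δ * s * Real.log d) ≤ n) :
    ∃ E, MeasurableSet E ∧ 1 - 6 * (d : ℝ) ^ (1 - δ) ≤ μ.real E ∧ ∀ ω ∈ E, ∀ θ,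
      IsStationary (matQ Δb fun k => quantizedCovariate Δb (x k ω) (τ k ω))
        (vecB (fun k => quantizedCovariate Δb (x k ω) (τ k ω))
          fun k => quantizedResponse Δ ζ (response θs (x k) (ε k) ω) (φ k ω))
        (penaltyLevel C l κ σ Δ Δb M √(δ * Real.log d / n)) (R * √s) θ →
      l2Norm (θ - θs) ≤ 7 / 2 * C * errorFactor l κ σ Δ Δb M * √(δ * s * Real.log d / n) ∧
        l1Norm (θ - θs) ≤ 28 * C * errorFactor l κ σ Δ Δb M * s * √(δ * Real.log d / n) := by
  have hd' : (1 : ℝ) < d := by exact_mod_cast hd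
  rcases s.eq_zero_or_pos with rfl | hs
  · refine ⟨Set.univ, .univ, ?_, fun ω _ θ hθ => ?_⟩
    · rw [probReal_univ]
      have : 0 ≤ (d : ℝ) ^ (1 - δ) := by positivity
      linarith
    · have hθ_zero : θ = 0 := l1Norm_eq_zero.1 <| (l1Norm_nonneg θ).antisymm' (by simpa using hθ.1)
      have hθs_zero : θs = 0 := l1Norm_eq_zero.1 <|
        (l1Norm_nonneg θs).antisymm' (by simpa using l1Norm_le_sqrt_mul_l2Norm hθs)
      simp [hθ_zero, hθs_zero, l2Norm, l1Norm]
  rcases le_total δ 1 with hδ | hδ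
  · refine ⟨∅, .empty, ?_, fun ω hω => absurd hω (Set.notMem_empty ω)⟩
    rw [measureReal_empty]
    linarith [Real.one_le_rpow hd'.le (sub_nonneg.2 hδ)]
  · exact exists_measurableSet_regression_error_le hl ha hb hC hκ hσ hΔ hΔb hM hR hd hs hδ h hind
      hθs hθs_le hD hD_le hζ_ge hζ_le hn

/-- `C₂, C₃` are absolute; `a, b` are the implied constants of the choice of the truncation
threshold `ζ`, in which the level `D` may be either of `Δ` and `Δb`; `l` is fixed; `C, C'` depend on `l, a, b, C₁` only. -/
theorem theorem4p1 :
    ∃ C₂ C₃ : ℝ, 0 < C₂ ∧ 0 < C₃ ∧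
    ∀ l a b : ℝ, 1 < l → 0 < a → a ≤ b →
    ∃ C₀ : ℝ, 0 < C₀ ∧ ∀ C₁ : ℝ, C₀ ≤ C₁ →
    ∃ C C' : ℝ, 0 < C ∧ 0 < C' ∧
    ∀ κ₀ σ Δ Δb M R : ℝ, 0 < κ₀ → 0 < σ → 0 ≤ Δ → 0 ≤ Δb → 0 < M → 0 < R →
    ∃ c : ℝ, 0 < c ∧
    ∀ (n d s : ℕ) (δ κ₁ D ζ lam : ℝ) (θs : Fin d → ℝ)
      (Ω : Type*) [MeasurableSpace Ω] (μ : Measure Ω) [IsProbabilityMeasure μ]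
      (x : Fin n → Ω → Fin d → ℝ) (ε φ : Fin n → Ω → ℝ) (τ : Fin n → Ω → Fin d → ℝ),
      2 ≤ d → 0 < δ → κ₀ < κ₁ →
      QCS.SamplingScheme μ Δ Δb x ε φ τ →
      (∀ k i, ∫ ω, x k ω i ∂μ = 0) →
      (∀ k, QCS.psi2NormVec μ (x k) ≤ ENNReal.ofReal σ) →
      (∀ k, ∀ ev ∈ spectrum ℝ (QCS.secondMoment μ (x k)), κ₀ ≤ ev ∧ ev ≤ κ₁) →
      QCS.IsSparse s θs →
      QCS.l2Norm θs ≤ R →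
      (∀ k, ∫⁻ ω, ENNReal.ofReal (|QCS.response θs (x k) (ε k) ω| ^ (2 * l)) ∂μ
        ≤ ENNReal.ofReal M) →
      (D = Δ ∨ D = Δb) →
      a * Real.sqrt (σ * M ^ (1 / l) / (σ + D) * (n / (δ * Real.log d))) ≤ ζ →
      ζ ≤ b * Real.sqrt (σ * M ^ (1 / l) / (σ + D) * (n / (δ * Real.log d))) →
      lam = C₁ * ((σ + Δb) ^ 2 / Real.sqrt κ₀) * (Δ + M ^ (1 / (2 * l)))
        * Real.sqrt (δ * Real.log d / n) →
      c * (δ * s * Real.log d) ≤ n →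
      ∃ E : Set Ω, MeasurableSet E ∧
        1 - 8 * (d : ℝ) ^ (1 - δ) - C₂ * Real.exp (-(C₃ * n)) ≤ μ.real E ∧
        ∀ ω ∈ E, ∀ θ : Fin d → ℝ,
          QCS.IsStationary
            (QCS.matQ Δb (fun k => QCS.quantizedCovariate Δb (x k ω) (τ k ω)))
            (QCS.vecB (fun k => QCS.quantizedCovariate Δb (x k ω) (τ k ω))
              (fun k => QCS.quantizedResponse Δ ζ (QCS.response θs (x k) (ε k) ω) (φ k ω)))
            lam (R * Real.sqrt s) θ →
          QCS.l2Norm (θ - θs)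
              ≤ C * QCS.errorFactor l κ₀ σ Δ Δb M * Real.sqrt (δ * s * Real.log d / n) ∧
          QCS.l1Norm (θ - θs)
              ≤ C' * QCS.errorFactor l κ₀ σ Δ Δb M * s * Real.sqrt (δ * Real.log d / n) := by
  refine ⟨1, 1, one_pos, one_pos, fun l a b hl ha hab => ?_⟩
  have hb : 0 ≤ b := ha.le.trans hab
  refine ⟨QCS.minPenaltyConst l b, QCS.minPenaltyConst_pos l hb, fun C₁ hC₁ => ?_⟩
  have hC₁_pos : 0 < C₁ := (QCS.minPenaltyConst_pos l hb).trans_le hC₁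
  refine ⟨7 / 2 * C₁, 28 * C₁, by positivity, by positivity,
    fun κ₀ σ Δ Δb M R hκ₀ hσ hΔ hΔb hM hR => ⟨QCS.sampleSizeConst l a C₁ κ₀ σ Δ Δb M R,
      QCS.sampleSizeConst_pos l a C₁ κ₀ σ Δ Δb M R, ?_⟩⟩
  rintro n d s δ κ₁ D ζ _ θs Ω _ μ _ x ε φ τ hd - - hsample hmean hψ hspec hθs hθs_le hmoment hD
    hζ_ge hζ_le rfl hn
  have hregression (k) : QCS.RegressionSample μ Δ Δb σ κ₀ l M θs (x k) (ε k) (φ k) (τ k) :=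
    { hsample.sample k with
      integral_x := hmean k
      psi2NormVec_x_le := hψ k
      le_of_mem_spectrum := fun ev hev => (hspec k ev hev).1
      lintegral_response_le := hmoment k }
  have hD_bounds : 0 ≤ D ∧ D ≤ Δ + Δb := by rcases hD with rfl | rfl <;> simp [hΔ, hΔb]
  obtain ⟨E, hE, hE_prob, hE_bound⟩ := theorem4p1_general hl ha hb hC₁ hκ₀ hσ hΔ hΔb hM hR hd
    hregression hsample.indep_samples hθs hθs_le hD_bounds.1 hD_bounds.2 hζ_ge hζ_le hn
  refine ⟨E, hE, hE_prob.trans' ?_, hE_bound⟩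
  have := Real.rpow_nonneg d.cast_nonneg (1 - δ)
  linarith [Real.exp_pos (-(1 * n))]
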